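/- **Conventions.** Let $R$ be a normed ring. A *seminormed $R$-module* is an $R$-module $M$ with a seminorm (so $\|0\|=0$, $\|-a\|=\|a\|$, $\|a+b\|\le\|a\|+\|b\|$) such that $\|ra\|\le |r|\,\|a\|$; morphisms are the seminorm non-increasing $R$-linear maps, and an isomorphism of seminormed modules is a bijective isometric $R$-linear map. Subquotients carry the induced seminorm (the infimum of the seminorms of representatives). For a simplicial set $X$ let $\pi(X)$ be its fundamental groupoid (the left adjoint of the nerve applied to $X$, with all morphisms inverted; it is generated by the edges of $X$, with relations given by the $2$-simplices). A *seminormed local coefficient system* on $X$ is a functor $\mathcal A$ from $\pi(X)$ to seminormed $R$-modules. Write $\sigma_0$ for the initial vertex of a simplex $\sigma$, and let $C^n_b(X;\mathcal A)$ be the module of functions $\varphi$ on $X_n$ with $\varphi(\sigma)\in\mathcal A(\sigma_0)$ and $\|\varphi\|_\infty=\sup_\sigma\|\varphi(\sigma)\|<\infty$, with coboundary $$(\delta\varphi)(\sigma)=\mathcal A([\sigma_{[0,1]}]^{-1})(\varphi(\partial_0\sigma))+\sum_{i=1}^{n+1}(-1)^i\varphi(\partial_i\sigma),$$ where $\sigma_{[0,1]}$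 is the edge of $\sigma$ from vertex $0$ to vertex $1$. The *bounded cohomology* $H^n_b(X;\mathcal A)$ is the cohomology of this complex, a seminormed $R$-module. A complex $C^\bullet$ of seminormed modules satisfies the *uniform boundary condition* $\mathrm{UBC}^q$ if there is $\kappa\ge 0$ such that every $b\in\operatorname{im}(\delta\colon C^{q-1}\to C^q)$ equals $\delta c$ for some $c$ with $\|c\|\le\kappa\|b\|$ (where $C^{-1}=0$). **The double complex of a map.** Let $f\colon X\to Y$ be a map of simplicial sets and $\mathcal A$ a seminormed local coefficient system on $X$. A *$(p,q)$-simplex of $f$* is a pair $(\sigma,\tau)$ of maps $\sigma\colon\Delta^p\times\Delta^q\to X$, $\tau\colon\Delta^p\to Y$ with $f\sigma=\tau\circ\mathrm{pr}_1$; these form a bisimplicial set by precomposition (Dress's bisimplicial set of $f$). Let $C^{p,q}_b(f;\mathcal A)$ be the seminormed module of bounded functions $\varphi$ on the $(p,q)$-simplices with $\varphi(\sigma,\tau)\in\mathcal A(\sigma(0,0))$, with the supremum seminorm. It is a double complex with the anticommuting differentials $$(d_h\varphi)(\sigma,\tau)=\mathcal A([\sigma|_{(0,0)\to(1,0)}]^{-1})\,\varphi(\partial^h_0(\sigma,\tau))+\sum_{i=1}^{p+1}(-1)^i\varphi(\partial^h_i(\sigma,\tau)),$$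 $$(d_v\varphi)(\sigma,\tau)=(-1)^p\Bigl(\mathcal A([\sigma|_{(0,0)\to(0,1)}]^{-1})\,\varphi(\partial^v_0(\sigma,\tau))+\sum_{j=1}^{q+1}(-1)^j\varphi(\partial^v_j(\sigma,\tau))\Bigr).$$ Let $(E_r^{p,q})$ be the first-quadrant spectral sequence of this double complex for the filtration of the total complex by $p$, so that $E_0^{p,q}=C_b^{p,q}(f;\mathcal A)$, $d_0=d_v$, and $d_1$ is induced by $d_h$. Each $E_r^{p,q}$ carries the seminorm induced from $C_b^{p,q}(f;\mathcal A)$ by passing to subquotients page by page. **The fibers.** For a $0$-simplex $y$ of $Y$ let $F_y=\Delta^0\times_Y X$ be the fiber over $y$ and $\mathcal A_y$ the restriction of $\mathcal A$ to $F_y$. For an edge $\gamma\colon\Delta^1\to Y$ from $y$ to $z$ let $F_\gamma$ be the fiber over $\gamma$ of $X^{\Delta^1}\to Y^{\Delta^1}$, and $\mathcal A_\gamma$ the pullback of $\mathcal A$ along the evaluation $F_\gamma\to X$ at the final vertex of $\Delta^1$. Evaluation at the two vertices, together with the isomorphisms $\mathcal A(x(0))\to\mathcal A(x(1))$ along the edges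 $x\in(F_\gamma)_0$, gives a zigzag $(F_y;\mathcal A_y)\leftarrow(F_\gamma;\mathcal A_\gamma)\to(F_z;\mathcal A_z)$ and thus maps $H_b^q(F_y;\mathcal A_y)\to H_b^q(F_\gamma;\mathcal A_\gamma)\leftarrow H_b^q(F_z;\mathcal A_z)$. **Theorem.** Let $f\colon X\to Y$ be a Kan fibration of simplicial sets and let $\mathcal A$ be a seminormed local coefficient system on $X$. 1. The spectral sequence $(E_r^{p,q})$ converges to $H^*_b(X;\mathcal A)$: every $H^n_b(X;\mathcal A)$ has a decreasing filtration $H_b^n(X;\mathcal A)=F^0\supseteq F^1\supseteq\dots\supseteq F^{n+1}=0$ with $E_\infty^{p,q}\cong F^pH^{p+q}_b(X;\mathcal A)/F^{p+1}H^{p+q}_b(X;\mathcal A)$ as $R$-modules, where $E_\infty^{p,q}=E_r^{p,q}$ for $r>\max(p,q+1)$. 2. For every $q\ge 0$ there is a seminormed local coefficient system $\mathcal H^q_b(F;\mathcal A)$ on $Y$ with value $H^q_b(F_y;\mathcal A_y)$ at $y$ which is given along an edge $\gamma$ from $y$ to $z$ by the zigzag above: it sends a class $\alpha$ to a class $\beta$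 if and only if $\alpha$ and $\beta$ have the same image in $H_b^q(F_\gamma;\mathcal A_\gamma)$. 3. There is an isomorphism of seminormed $R$-modules $$E_2^{p,q}\cong H^p_b(Y;\mathcal H^q_b(F;\mathcal A))$$ in each of the following cases: - (i) $Y$ has only finitely many $n$-simplices for every $n\le p+1$; - (ii) $q=0$; - (iii) $Y$ is connected and for some $0$-simplex $y$ of $Y$ the complex $C^\bullet_b(F_y;\mathcal A_y)$ satisfies $\mathrm{UBC}^q$. -/

import Mathlib

open CategoryTheory Simplicial MonoidalCategory CartesianMonoidalCategory Opposite
open SSet.modelCategoryQuillen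

universe u v w

namespace BddCoh

/-! ### Seminormed modules over a normed ring -/

/-- A seminormed module over the normed ring `R`: an `R`-module with a seminorm satisfying
`‖r • a‖ ≤ ‖r‖ * ‖a‖`. -/
structure SnMod (R : Type w) [NormedRing R] where
  carrier : Type v
  [grp : SeminormedAddCommGroup carrier]
  [mod : Module R carrier]
  norm_smul_le (r : R) (a : carrier) : ‖r • a‖ ≤ ‖r‖ * ‖a‖

namespace SnMod

variable {R : Type w} [NormedRing R]

instance : CoeSort (SnMod.{v} R) (Type v) := ⟨SnMod.carrier⟩
instance (M : SnMod.{v} R) : SeminormedAddCommGroup M := M.grp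
instance (M : SnMod.{v} R) : Module R M := M.mod

/-- Morphisms of seminormed modules: the seminorm non-increasing `R`-linear maps. -/
@[ext]
structure Hom (M N : SnMod.{v} R) where
  lin : M →ₗ[R] N
  norm_le (a : M) : ‖lin a‖ ≤ ‖a‖

/-- The category of seminormed `R`-modules and seminorm non-increasing linear maps. -/
instance : Category (SnMod.{v} R) where
  Hom := Hom
  id M := ⟨LinearMap.id, fun _ => le_rfl⟩
  comp f g := ⟨g.lin.comp f.lin, fun a => (g.norm_le _).trans (f.norm_le a)⟩

@[simp] theorem id_lin (M : SnMod.{v} R) : Hom.lin (𝟙 M) = LinearMap.id := rfl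

@[simp] theorem comp_lin {M N P : SnMod.{v} R} (f : M ⟶ N) (g : N ⟶ P) :
    Hom.lin (f ≫ g) = g.lin.comp f.lin := rfl

/-- The submodule of bounded families in a product of seminormed modules. -/
def bprodSubmodule {ι : Type u} (M : ι → SnMod.{v} R) : Submodule R (∀ i, M i) where
  carrier := {c | BddAbove (Set.range fun i => ‖c i‖)}
  zero_mem' := ⟨0, by rintro _ ⟨i, rfl⟩; simp⟩
  add_mem' := by
    rintro a b ⟨x, hx⟩ ⟨y, hy⟩
    refine ⟨x + y, ?_⟩
    rintro _ ⟨i, rfl⟩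
    exact (norm_add_le _ _).trans (add_le_add (hx ⟨i, rfl⟩) (hy ⟨i, rfl⟩))
  smul_mem' := by
    rintro r a ⟨x, hx⟩
    refine ⟨‖r‖ * x, ?_⟩
    rintro _ ⟨i, rfl⟩
    exact ((M i).norm_smul_le r _).trans
      (mul_le_mul_of_nonneg_left (hx ⟨i, rfl⟩) (norm_nonneg r))

theorem bprod_bddAbove {ι : Type u} {M : ι → SnMod.{v} R} (c : bprodSubmodule M) :
    BddAbove (Set.range fun i => ‖c.1 i‖) := c.2

/-- The supremum seminorm on bounded families. -/
noncomputable def bprodSeminorm {ι : Type u} (M : ι → SnMod.{v} R) :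
    AddGroupSeminorm (bprodSubmodule M) where
  toFun c := ⨆ i, ‖c.1 i‖
  map_zero' := by simp
  neg' c := by simp
  add_le' a b := by
    refine Real.iSup_le (fun i => (norm_add_le _ _).trans (add_le_add
      (le_ciSup (bprod_bddAbove a) i) (le_ciSup (bprod_bddAbove b) i))) ?_
    exact add_nonneg (Real.iSup_nonneg fun _ => norm_nonneg _)
      (Real.iSup_nonneg fun _ => norm_nonneg _)

/-- The bounded product of a family of seminormed modules, with the supremum seminorm. -/
noncomputable def bprod {ι : Type u} (M : ι → SnMod.{v} R) : SnMod.{max u v} R where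
  carrier := bprodSubmodule M
  grp := (bprodSeminorm M).toSeminormedAddCommGroup
  mod := inferInstance
  norm_smul_le r c := by
    change (⨆ i, ‖(r • c.1) i‖) ≤ ‖r‖ * ⨆ i, ‖c.1 i‖
    refine Real.iSup_le (fun i => ((M i).norm_smul_le r _).trans ?_) ?_
    · exact mul_le_mul_of_nonneg_left (le_ciSup (bprod_bddAbove c) i) (norm_nonneg r)
    · exact mul_nonneg (norm_nonneg r) (Real.iSup_nonneg fun _ => norm_nonneg _)

theorem bprod_norm {ι : Type u} {M : ι → SnMod.{v} R} (c : bprod M) :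
    ‖c‖ = ⨆ i, ‖c.1 i‖ := rfl

/-- The subquotient `S / (T ∩ S)` of a seminormed module, with the quotient seminorm
`‖x‖ = inf {‖s‖ | s ∈ S represents x}`. -/
noncomputable def subquot (M : SnMod.{v} R) (S T : Submodule R M) : SnMod.{v} R where
  carrier := S ⧸ T.submoduleOf S
  norm_smul_le r x := by
    refine le_of_forall_pos_le_add fun ε hε => ?_
    obtain ⟨m, rfl, hm⟩ := Submodule.Quotient.norm_mk_lt x
      (div_pos hε (by positivity : 0 < ‖r‖ + 1))
    rw [← Submodule.Quotient.mk_smul]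
    refine (Submodule.Quotient.norm_mk_le _ _).trans ((M.norm_smul_le r m).trans ?_)
    refine (mul_le_mul_of_nonneg_left hm.le (norm_nonneg r)).trans ?_
    rw [mul_add]
    gcongr
    rw [mul_div_assoc', div_le_iff₀ (by positivity)]
    nlinarith [norm_nonneg r]

end SnMod

/-! ### Seminormed cochain complexes and double complexes -/

/-- A (non-negatively graded) seminormed cochain complex: bounded linear coboundary maps `d` with
`d ∘ d = 0`. -/
structure SnComplex (R : Type w) [NormedRing R] where
  X : ℕ → SnMod.{v} R
  d (n : ℕ) : X n →ₗ[R] X (n + 1)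
  bounded (n : ℕ) : ∃ C : ℝ, ∀ x, ‖d n x‖ ≤ C * ‖x‖
  d_d (n : ℕ) (x : X n) : d (n + 1) (d n x) = 0

namespace SnComplex

variable {R : Type w} [NormedRing R] (K : SnComplex.{v} R)

/-- The coboundaries in degree `n` (zero for `n = 0`). -/
def cobound (n : ℕ) : Submodule R (K.X n) :=
  match n with
  | 0 => ⊥
  | n + 1 => LinearMap.range (K.d n)

/-- Cohomology, as a seminormed module: cocycles modulo coboundaries with the seminorm induced
from the cochains. -/
noncomputable def H (n : ℕ) : SnMod.{v} R :=
  (K.X n).subquot (LinearMap.ker (K.d n)) (K.cobound n)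

/-- The cohomology class of a cocycle. -/
noncomputable def cls (n : ℕ) : LinearMap.ker (K.d n) →ₗ[R] K.H n :=
  ((K.cobound n).submoduleOf (LinearMap.ker (K.d n))).mkQ

/-- The uniform boundary condition in degree `n`: for some `κ ≥ 0`, every `b` in the image of
`d : X (n - 1) → X n` is of the form `d c` with `‖c‖ ≤ κ * ‖b‖`.  (The condition is void
for `n = 0`, where the incoming coboundary map is zero.) -/
def UBC (n : ℕ) : Prop :=
  ∃ κ : ℝ, 0 ≤ κ ∧ ∀ m, m + 1 = n → ∀ b ∈ LinearMap.range (K.d m),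
    ∃ c : K.X m, K.d m c = b ∧ ‖c‖ ≤ κ * ‖b‖

end SnComplex

/-- A first-quadrant double cochain complex of seminormed modules, with bounded and anticommuting
horizontal and vertical differentials. -/
structure SnDoubleComplex (R : Type w) [NormedRing R] where
  X : ℕ → ℕ → SnMod.{v} R
  dh (p q : ℕ) : X p q →ₗ[R] X (p + 1) q
  dv (p q : ℕ) : X p q →ₗ[R] X p (q + 1)
  bounded_dh (p q : ℕ) : ∃ C : ℝ, ∀ x, ‖dh p q x‖ ≤ C * ‖x‖
  bounded_dv (p q : ℕ) : ∃ C : ℝ, ∀ x, ‖dv p q x‖ ≤ C * ‖x‖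
  dh_dh (p q : ℕ) (x : X p q) : dh (p + 1) q (dh p q x) = 0
  dv_dv (p q : ℕ) (x : X p q) : dv p (q + 1) (dv p q x) = 0
  dv_dh (p q : ℕ) (x : X p q) : dv (p + 1) q (dh p q x) + dh p (q + 1) (dv p q x) = 0

namespace SnDoubleComplex

variable {R : Type w} [NormedRing R] (K : SnDoubleComplex.{v} R)

/-- Families of elements, one in each bidegree.  The total complex in degree `n` is the submodule
`K.deg n` of the families supported on `p + q = n`. -/
abbrev Fam : Type v := ∀ p q : ℕ, K.X p q

/-- The horizontal component of the total differential arriving in bidegree `(p, q)`. -/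
def intoH (p q : ℕ) : K.Fam →ₗ[R] K.X p q :=
  match p with
  | 0 => 0
  | p + 1 => K.dh p q ∘ₗ (LinearMap.proj q : (∀ q, K.X p q) →ₗ[R] K.X p q) ∘ₗ
      (LinearMap.proj p : K.Fam →ₗ[R] ∀ q, K.X p q)

/-- The vertical component of the total differential arriving in bidegree `(p, q)`. -/
def intoV (p q : ℕ) : K.Fam →ₗ[R] K.X p q :=
  match q with
  | 0 => 0
  | q + 1 => K.dv p q ∘ₗ (LinearMap.proj q : (∀ q, K.X p q) →ₗ[R] K.X p q) ∘ₗ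
      (LinearMap.proj p : K.Fam →ₗ[R] ∀ q, K.X p q)

/-- The total differential `dh + dv`. -/
def D : K.Fam →ₗ[R] K.Fam :=
  LinearMap.pi fun p => LinearMap.pi fun q => K.intoH p q + K.intoV p q

/-- The total complex in degree `n`: families supported on `p + q = n`. -/
def deg (n : ℕ) : Submodule R K.Fam where
  carrier := {x | ∀ p q, p + q ≠ n → x p q = 0}
  zero_mem' _ _ _ := rfl
  add_mem' ha hb p q h := by simp [ha p q h, hb p q h]
  smul_mem' r a ha p q h := by simp [ha p q h]

/-- The filtration by the horizontal degree. -/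
def fil (s : ℕ) : Submodule R K.Fam where
  carrier := {x | ∀ p q, p < s → x p q = 0}
  zero_mem' _ _ _ := rfl
  add_mem' ha hb p q h := by simp [ha p q h, hb p q h]
  smul_mem' r a ha p q h := by simp [ha p q h]

/-- The `r`-cycles `{x ∈ F^p Tot^{p+q} | D x ∈ F^{p+r}}`. -/
def Z (r p q : ℕ) : Submodule R K.Fam :=
  K.deg (p + q) ⊓ K.fil p ⊓ (K.fil (p + r)).comap K.D

/-- The `r`-boundaries
`{x ∈ F^{p+1} Tot^{p+q} | D x ∈ F^{p+r}} + (D (F^{p+1-r}) ∩ F^p Tot^{p+q})`.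
The truncated subtraction is harmless as `F^s` is everything for `s ≤ 0`. -/
def B (r p q : ℕ) : Submodule R K.Fam :=
  (K.deg (p + q) ⊓ K.fil (p + 1) ⊓ (K.fil (p + r)).comap K.D) ⊔
    ((K.fil (p + 1 - r)).map K.D ⊓ K.deg (p + q) ⊓ K.fil p)

/-- The spectral sequence of the double complex for the filtration by the horizontal degree
(so that `d₀ = dv` and `d₁` is induced by `dh`): a first-quadrant cohomological spectral sequence
`E`, starting with page `0`, together with identifications `E_r^{p,q} = Z_r^{p,q} / B_r^{p,q}` for
which the differentials are induced by the total differential and the isomorphisms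
`H(E_r) ≅ E_{r+1}` are the canonical ones. -/
structure SpectralSeq where
  E : CohomologicalSpectralSequenceNat (ModuleCat.{v} R) 0
  π (r p q : ℕ) : K.Z r p q →ₗ[R] (E.page (r : ℤ)).X (p, q)
  π_surjective (r p q : ℕ) : Function.Surjective (π r p q)
  π_eq_zero_iff (r p q : ℕ) (z : K.Z r p q) : π r p q z = 0 ↔ (z : K.Fam) ∈ K.B r p q
  d_π (r p q p' q' : ℕ) (hp : p + r = p') (hq : q + 1 = q' + r)
    (z : K.Z r p q) (z' : K.Z r p' q') (h : (z' : K.Fam) = K.D z) :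
    (E.page (r : ℤ)).d (p, q) (p', q') (π r p q z) = π r p' q' z'
  iso_π (r p q : ℕ) (z : K.Z r p q) (z' : K.Z (r + 1) p q) (h : (z' : K.Fam) = z)
    (c : (E.page (r : ℤ)).cycles (p, q)) (hc : (E.page (r : ℤ)).iCycles (p, q) c = π r p q z) :
    (E.iso (r : ℤ) ((r + 1 : ℕ) : ℤ) (p, q)).hom ((E.page (r : ℤ)).homologyπ (p, q) c) =
      π (r + 1) p q z'

variable {K}

/-- The module `E_r^{p,q}`. -/
abbrev SpectralSeq.page (S : K.SpectralSeq) (r p q : ℕ) : ModuleCat.{v} R :=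
  (S.E.page (r : ℤ)).X (p, q)

/-- The seminorm on `E_r^{p,q}` induced from `K.X p q`: starting from the seminorm on
`E_0^{p,q} = K.X p q`, each page carries the subquotient seminorm of the previous one, so the
seminorm of `ξ` is the infimum of `‖z_{p,q}‖` over the `r`-cycles `z` representing `ξ`, where
`z_{p,q} ∈ K.X p q` is the leading component of `z`. -/
noncomputable def SpectralSeq.pageNorm (S : K.SpectralSeq) (r p q : ℕ) (ξ : S.page r p q) : ℝ :=
  sInf {t | ∃ z : K.Z r p q, S.π r p q z = ξ ∧ t = ‖(z : K.Fam) p q‖}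

/-- Convergence of the first-quadrant spectral sequence to a graded module `H`: each `H n` has a
decreasing filtration `H n = F⁰ ⊇ F¹ ⊇ ⋯ ⊇ F^{n+1} = 0` with `E_∞^{p,q} ≅ F^p H^{p+q} / F^{p+1} H^{p+q}`.
Here `E_∞^{p,q} = E_r^{p,q}` for `r > p` and `r > q + 1`, as from then on no non-zero differential
enters or leaves position `(p, q)`. -/
def SpectralSeq.ConvergesTo (S : K.SpectralSeq) (H : ℕ → SnMod.{v} R) : Prop :=
  ∃ F : (n : ℕ) → ℕ → Submodule R (H n),
    (∀ n, Antitone (F n)) ∧ (∀ n, F n 0 = ⊤) ∧ (∀ n, F n (n + 1) = ⊥) ∧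
    ∀ p q r : ℕ, p < r → q + 1 < r →
      Nonempty (S.page r p q ≃ₗ[R]
        (F (p + q) p ⧸ (F (p + q) (p + 1)).submoduleOf (F (p + q) p)))

end SnDoubleComplex

/-! ### The fundamental groupoid and local coefficient systems -/

/-- The fundamental groupoid of a simplicial set: its fundamental category (the left adjoint of
the nerve) with all morphisms inverted. -/
abbrev FundGrpd (X : SSet.{u}) : Type u :=
  CategoryTheory.FreeGroupoid ((SSet.truncation 2).obj X).HomotopyCategory

namespace FundGrpd

open SSet

variable {X Y : SSet.{u}}

/-- The object of the fundamental groupoid given by a `0`-simplex. -/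
def pt (x : X _⦋0⦌) : FundGrpd X := FreeGroupoid.mk (Truncated.HomotopyCategory.mk x)

/-- The morphism of the fundamental groupoid given by a `1`-simplex. -/
def edge {x y : X _⦋0⦌} (e : Edge x y) : pt x ⟶ pt y :=
  FreeGroupoid.homMk (Truncated.HomotopyCategory.homMk e.toTruncated)

theorem edge_comp {x y z : X _⦋0⦌} {e : Edge x y} {e' : Edge y z} {e'' : Edge x z}
    (h : Edge.CompStruct e e' e'') : edge e ≫ edge e' = edge e'' :=
  ((FreeGroupoid.of _).map_comp _ _).symm.trans
    (congrArg (FreeGroupoid.of _).map (Truncated.HomotopyCategory.homMk_comp_homMk h.toTruncated))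

theorem edge_id (x : X _⦋0⦌) : edge (Edge.id x) = 𝟙 (pt x) :=
  (congrArg (FreeGroupoid.of _).map (Truncated.HomotopyCategory.homMk_id _)).trans
    ((FreeGroupoid.of _).map_id _)

/-- The functor induced by a map of simplicial sets. -/
def map (f : X ⟶ Y) : FundGrpd X ⥤ FundGrpd Y :=
  FreeGroupoid.map (Truncated.mapHomotopyCategory ((truncation 2).map f))

theorem map_edge (f : X ⟶ Y) {x y : X _⦋0⦌} (e : Edge x y) :
    (map f).map (edge e) = edge (e.map f) :=
  FreeGroupoid.lift_map_homMk _ _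

end FundGrpd

/-- A seminormed local coefficient system on `X`. -/
abbrev LocalCoeff (R : Type w) [NormedRing R] (X : SSet.{u}) := FundGrpd X ⥤ SnMod.{v} R

namespace LocalCoeff

variable {R : Type w} [NormedRing R] {X Y : SSet.{u}}

/-- The value `A(x)` at a `0`-simplex. -/
abbrev at₀ (A : LocalCoeff.{u, v} R X) (x : X _⦋0⦌) : SnMod.{v} R := A.obj (FundGrpd.pt x)

/-- The restriction `f^* A` of a local coefficient system along a map of simplicial sets. -/
abbrev pullback (f : X ⟶ Y) (A : LocalCoeff.{u, v} R Y) : LocalCoeff.{u, v} R X :=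
  FundGrpd.map f ⋙ A

/-- For a set `S` with a map `b : S → X₀`, the seminormed module of the bounded functions `φ` on
`S` with `φ s ∈ A(b s)`, with the supremum seminorm. -/
noncomputable abbrev bfun (A : LocalCoeff.{u, v} R X) {S : Type u} (b : S → X _⦋0⦌) :
    SnMod.{max u v} R :=
  SnMod.bprod fun s => A.at₀ (b s)

/-- For `g : S → S'` and morphisms `h s` from `b' (g s)` to `b s` in the fundamental groupoid, the
operator `φ ↦ (s ↦ A(h s) (φ (g s)))`. -/
noncomputable def pull (A : LocalCoeff.{u, v} R X) {S S' : Type u} {b : S → X _⦋0⦌}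
    {b' : S' → X _⦋0⦌} (g : S → S') (h : ∀ s, FundGrpd.pt (b' (g s)) ⟶ FundGrpd.pt (b s)) :
    A.bfun b' →ₗ[R] A.bfun b where
  toFun φ := ⟨fun s => (A.map (h s)).lin (φ.1 (g s)), by
    obtain ⟨C, hC⟩ := SnMod.bprod_bddAbove φ
    refine ⟨C, ?_⟩
    rintro _ ⟨s, rfl⟩
    exact ((A.map (h s)).norm_le _).trans (hC ⟨g s, rfl⟩)⟩
  map_add' φ ψ := Subtype.ext (funext fun s => map_add (A.map (h s)).lin _ _)
  map_smul' r φ := Subtype.ext (funext fun s => map_smul (A.map (h s)).lin _ _)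

theorem pull_apply (A : LocalCoeff.{u, v} R X) {S S' : Type u} {b : S → X _⦋0⦌}
    {b' : S' → X _⦋0⦌} (g : S → S') (h : ∀ s, FundGrpd.pt (b' (g s)) ⟶ FundGrpd.pt (b s))
    (φ : A.bfun b') (s : S) : (A.pull g h φ).1 s = (A.map (h s)).lin (φ.1 (g s)) := rfl

theorem norm_pull_le (A : LocalCoeff.{u, v} R X) {S S' : Type u} {b : S → X _⦋0⦌}
    {b' : S' → X _⦋0⦌} (g : S → S') (h : ∀ s, FundGrpd.pt (b' (g s)) ⟶ FundGrpd.pt (b s))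
    (φ : A.bfun b') : ‖A.pull g h φ‖ ≤ ‖φ‖ := by
  rw [SnMod.bprod_norm, SnMod.bprod_norm]
  refine Real.iSup_le (fun s => ?_) (Real.iSup_nonneg fun _ => norm_nonneg _)
  exact ((A.map (h s)).norm_le _).trans (le_ciSup (SnMod.bprod_bddAbove φ) (g s))

theorem map_inv_map_inv (A : LocalCoeff.{u, v} R X) {a b c : FundGrpd X} {g : a ⟶ b} {h : b ⟶ c}
    {k : a ⟶ c} (e : g ≫ h = k) (x : A.obj c) :
    (A.map (inv g)).lin ((A.map (inv h)).lin x) = (A.map (inv k)).lin x := by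
  subst e
  rw [IsIso.inv_comp, A.map_comp]
  rfl

end LocalCoeff

/-! ### Alternating sums of coface operators -/

/-- The alternating sum of a finite family of operators. -/
def altSum {R : Type w} [Ring R] {M N : Type*} [AddCommGroup M] [AddCommGroup N] [Module R M]
    [Module R N] {k : ℕ} (a : Fin k → M →ₗ[R] N) : M →ₗ[R] N :=
  ∑ i : Fin k, (-1 : ℤ) ^ (i : ℕ) • a i

theorem altSum_comp_altSum {R : Type w} [Ring R] {M N P : Type*} [AddCommGroup M]
    [AddCommGroup N] [AddCommGroup P] [Module R M] [Module R N] [Module R P] {n : ℕ}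
    (a : Fin (n + 2) → M →ₗ[R] N) (b : Fin (n + 3) → N →ₗ[R] P)
    (h : ∀ i j : Fin (n + 2), i ≤ j → ∀ x, b j.succ (a i x) = b i.castSucc (a j x)) (x : M) :
    altSum b (altSum a x) = 0 := by
  have e : altSum b (altSum a x) = ∑ ij : Fin (n + 2) × Fin (n + 3),
      ((-1 : ℤ) ^ (ij.2 : ℕ) * (-1 : ℤ) ^ (ij.1 : ℕ)) • b ij.2 (a ij.1 x) := by
    rw [Fintype.sum_prod_type_right]
    simp only [altSum, LinearMap.sum_apply, LinearMap.smul_apply, map_sum, map_zsmul,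
      Finset.smul_sum, smul_smul]
    rw [Finset.sum_comm]
    refine Finset.sum_congr rfl fun _ _ => Finset.sum_congr rfl fun _ _ => ?_
    rw [mul_comm]
  rw [e]
  let S : Finset (Fin (n + 2) × Fin (n + 3)) := {ij | (ij.2 : ℕ) ≤ (ij.1 : ℕ)}
  rw [← Finset.sum_add_sum_compl S, ← eq_neg_iff_add_eq_zero, ← Finset.sum_neg_distrib]
  let φ : ∀ ij : Fin (n + 2) × Fin (n + 3), ij ∈ S → Fin (n + 2) × Fin (n + 3) := fun ij hij =>
    (Fin.castLT ij.2 (lt_of_le_of_lt (Finset.mem_filter.mp hij).right (Fin.is_lt ij.1)),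
      ij.1.succ)
  apply Finset.sum_bij φ
  · intro ij hij
    simp_rw [S, φ, Finset.compl_filter, Finset.mem_filter_univ, Fin.val_succ,
      Fin.val_castLT] at hij ⊢
    lia
  · rintro ⟨i, j⟩ hij ⟨i', j'⟩ hij' h
    rw [Prod.mk_inj]
    exact ⟨by simpa [φ] using! congr_arg Prod.snd h,
      by simpa [φ, Fin.castSucc_castLT] using! congr_arg Fin.castSucc (congr_arg Prod.fst h)⟩
  · rintro ⟨i', j'⟩ hij'
    simp_rw [S, Finset.compl_filter, Finset.mem_filter_univ, not_le] at hij'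
    refine ⟨(j'.pred <| ?_, Fin.castSucc i'), ?_, ?_⟩
    · rintro rfl
      simp only [Fin.val_zero, not_lt_zero] at hij'
    · simpa [S] using! Nat.le_sub_one_of_lt hij'
    · simp only [φ, Fin.castLT_castSucc, Fin.succ_pred]
  · rintro ⟨i, j⟩ hij
    have hj : (j : ℕ) ≤ (i : ℕ) := by simpa [S] using! hij
    dsimp only [φ]
    rw [h _ i (Fin.le_def.mpr (by simpa using hj)), Fin.castSucc_castLT, ← neg_smul]
    congr 1
    simp only [Fin.val_succ, pow_add, pow_one, Fin.val_castLT]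
    ring

theorem norm_altSum_le {R : Type w} [NormedRing R] {M N : SnMod.{v} R} {k : ℕ}
    (a : Fin k → M →ₗ[R] N) (h : ∀ i x, ‖a i x‖ ≤ ‖x‖) (x : M) : ‖altSum a x‖ ≤ k * ‖x‖ := by
  simp only [altSum, LinearMap.sum_apply, LinearMap.smul_apply]
  refine (norm_sum_le _ _).trans ((Finset.sum_le_card_nsmul _ _ ‖x‖ fun i _ => ?_).trans ?_)
  · rcases neg_one_pow_eq_or ℤ (i : ℕ) with hi | hi <;> simpa [hi] using h i x
  · simp

/-! ### Vertices and edges of simplices and prisms -/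

section Shapes

open SSet

/-- The `i`-th vertex of the standard simplex. -/
def vtx (n : ℕ) (i : Fin (n + 1)) : (Δ[n] : SSet.{u}) _⦋0⦌ := SSet.stdSimplex.obj₀Equiv.symm i

/-- The edge from the `i`-th to the `j`-th vertex of the standard simplex (degenerate for
`i = j`). -/
def stdEdge {n : ℕ} (i j : Fin (n + 1)) (h : i ≤ j) : Edge (vtx.{u} n i) (vtx n j) :=
  Edge.mk (SSet.stdSimplex.edge n i j h)
    (by ext k; fin_cases k; rfl) (by ext k; fin_cases k; rfl)

/-- The triangle spanned by three vertices of the standard simplex. -/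
def stdTriangle {n : ℕ} (i j k : Fin (n + 1)) (h : i ≤ j) (h' : j ≤ k) :
    Edge.CompStruct (stdEdge.{u} i j h) (stdEdge j k h') (stdEdge i k (h.trans h')) :=
  Edge.CompStruct.mk (SSet.stdSimplex.triangle i j k h h')
    (by ext l; fin_cases l <;> rfl) (by ext l; fin_cases l <;> rfl)
    (by ext l; fin_cases l <;> rfl)

theorem stdEdge_map {m n : ℕ} (α : ⦋m⦌ ⟶ ⦋n⦌) (i j : Fin (m + 1)) (h : i ≤ j) :
    (stdEdge.{u} i j h).map (SSet.stdSimplex.map α) =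
      stdEdge (α.toOrderHom i) (α.toOrderHom j) (α.toOrderHom.monotone h) := by
  ext k
  fin_cases k <;> rfl

/-- The product of two edges. -/
def prodEdge {K L : SSet.{u}} {a a' : K _⦋0⦌} {b b' : L _⦋0⦌} (e : Edge a a') (e' : Edge b b') :
    Edge (X := K ⊗ L) (a, b) (a', b') :=
  Edge.mk (X := K ⊗ L) (e.edge, e'.edge) (Prod.ext e.src_eq e'.src_eq)
    (Prod.ext e.tgt_eq e'.tgt_eq)

/-- The product of two triangles. -/
def prodTriangle {K L : SSet.{u}} {a₀ a₁ a₂ : K _⦋0⦌} {b₀ b₁ b₂ : L _⦋0⦌}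
    {e₀₁ : Edge a₀ a₁} {e₁₂ : Edge a₁ a₂} {e₀₂ : Edge a₀ a₂}
    {e'₀₁ : Edge b₀ b₁} {e'₁₂ : Edge b₁ b₂} {e'₀₂ : Edge b₀ b₂}
    (h : Edge.CompStruct e₀₁ e₁₂ e₀₂) (h' : Edge.CompStruct e'₀₁ e'₁₂ e'₀₂) :
    Edge.CompStruct (prodEdge e₀₁ e'₀₁) (prodEdge e₁₂ e'₁₂) (prodEdge e₀₂ e'₀₂) :=
  Edge.CompStruct.mk (X := K ⊗ L) (h.simplex, h'.simplex) (Prod.ext h.d₂ h'.d₂)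
    (Prod.ext h.d₀ h'.d₀) (Prod.ext h.d₁ h'.d₁)

end Shapes

/-! ### Bounded cohomology with local coefficients -/

section BoundedCohomology

open SSet

variable {R : Type w} [NormedRing R] {X : SSet.{u}} (A : LocalCoeff.{u, v} R X)

/-- The initial vertex `σ₀` of an `n`-simplex, where `n`-simplices are regarded as maps
`Δ[n] ⟶ X`. -/
def vtx₀ {n : ℕ} (σ : Δ[n] ⟶ X) : X _⦋0⦌ := σ.app _ (vtx n 0)

/-- Bounded `n`-cochains: bounded functions on the `n`-simplices with `φ(σ) ∈ A(σ₀)`. -/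
noncomputable abbrev Cochain (n : ℕ) : SnMod.{max u v} R :=
  A.bfun (S := (Δ[n] : SSet.{u}) ⟶ X) vtx₀

/-- For `α : [m] → [n]` and an `n`-simplex `σ`, the edge of `σ` from `σ₀` to the initial vertex
`σ_{α(0)}` of `α^* σ`. -/
def opEdge {m n : ℕ} (α : ⦋m⦌ ⟶ ⦋n⦌) (σ : (Δ[n] : SSet.{u}) ⟶ X) :
    Edge (vtx₀ σ) (vtx₀ (SSet.stdSimplex.map α ≫ σ)) :=
  (stdEdge 0 (α.toOrderHom 0) (Fin.zero_le _)).map σ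

/-- The operator `φ ↦ (σ ↦ A([σ₀ → σ_{α(0)}]⁻¹) (φ (α^* σ)))` on bounded cochains. -/
noncomputable def cochainOp {m n : ℕ} (α : ⦋m⦌ ⟶ ⦋n⦌) : Cochain A m →ₗ[R] Cochain A n :=
  A.pull (fun σ => SSet.stdSimplex.map α ≫ σ) fun σ => inv (FundGrpd.edge (opEdge α σ))

/-- The coboundary operator
`(δ φ)(σ) = A([σ_{[0,1]}]⁻¹) (φ (∂₀ σ)) + ∑_{i ≥ 1} (-1)^i φ (∂ᵢ σ)`.  For `i ≥ 1` the edge from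
`σ₀` to `(∂ᵢ σ)₀ = σ₀` used by the `i`-th coface operator is degenerate, hence acts as the
identity. -/
noncomputable def cobdry (n : ℕ) : Cochain A n →ₗ[R] Cochain A (n + 1) :=
  altSum fun i : Fin (n + 2) => cochainOp A (SimplexCategory.δ i)

theorem edge_opEdge_comp {l m n : ℕ} (α : ⦋l⦌ ⟶ ⦋m⦌) (β : ⦋m⦌ ⟶ ⦋n⦌)
    (σ : (Δ[n] : SSet.{u}) ⟶ X) :
    FundGrpd.edge (opEdge β σ) ≫ FundGrpd.edge (opEdge α (SSet.stdSimplex.map β ≫ σ)) =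
      FundGrpd.edge (opEdge (α ≫ β) σ) := by
  have h := (stdTriangle.{u} 0 (β.toOrderHom 0) (β.toOrderHom (α.toOrderHom 0)) (Fin.zero_le _)
    (β.toOrderHom.monotone (Fin.zero_le _))).map σ
  refine FundGrpd.edge_comp (h.ofEq rfl ?_ rfl)
  rw [← stdEdge_map]
  rfl

theorem cochainOp_comp {l m n : ℕ} (α : ⦋l⦌ ⟶ ⦋m⦌) (β : ⦋m⦌ ⟶ ⦋n⦌) (φ : Cochain A l) :
    cochainOp A β (cochainOp A α φ) = cochainOp A (α ≫ β) φ :=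
  Subtype.ext (funext fun σ => A.map_inv_map_inv (edge_opEdge_comp α β σ)
    (φ.1 (SSet.stdSimplex.map (α ≫ β) ≫ σ)))

/-- The bounded cochain complex of `X` with local coefficients in `A`. -/
noncomputable def cochainComplex : SnComplex.{max u v} R where
  X := Cochain A
  d := cobdry A
  bounded n := ⟨_, norm_altSum_le _ fun _ φ => A.norm_pull_le _ _ φ⟩
  d_d n φ := altSum_comp_altSum _ _ (fun i j h x => by
    rw [cochainOp_comp, cochainOp_comp, SimplexCategory.δ_comp_δ h]) φ

/-- Bounded cohomology of `X` with local coefficients in `A`. -/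
noncomputable def Hb (n : ℕ) : SnMod.{max u v} R := (cochainComplex A).H n

end BoundedCohomology

/-! ### The bisimplicial set of a map and its double complex -/

section Dress

open SSet

variable {R : Type w} [NormedRing R] {X Y : SSet.{u}}

/-- A `(p, q)`-simplex of the map `f : X ⟶ Y`: a commutative square with top `σ`, bottom `τ` and
left-hand side the first projection `Δ[p] × Δ[q] ⟶ Δ[p]`. -/
@[ext]
structure BiSimplex (f : X ⟶ Y) (p q : ℕ) where
  σ : (Δ[p] : SSet.{u}) ⊗ Δ[q] ⟶ X
  τ : (Δ[p] : SSet.{u}) ⟶ Y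
  w : σ ≫ f = fst _ _ ≫ τ

variable {f : X ⟶ Y}

/-- The bisimplicial structure: precomposition with `α × β`. -/
def BiSimplex.op {p q p' q' : ℕ} (α : ⦋p'⦌ ⟶ ⦋p⦌) (β : ⦋q'⦌ ⟶ ⦋q⦌) (s : BiSimplex f p q) :
    BiSimplex f p' q' where
  σ := (SSet.stdSimplex.map α ⊗ₘ SSet.stdSimplex.map β) ≫ s.σ
  τ := SSet.stdSimplex.map α ≫ s.τ
  w := by simp [s.w]

/-- The vertex `σ(0, 0)`. -/
def BiSimplex.vtx₀ {p q : ℕ} (s : BiSimplex f p q) : X _⦋0⦌ := s.σ.app _ (vtx p 0, vtx q 0)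

/-- The edge of `σ` from `σ(0, 0)` to `σ(α(0), β(0))`. -/
def BiSimplex.opEdge {p q p' q' : ℕ} (α : ⦋p'⦌ ⟶ ⦋p⦌) (β : ⦋q'⦌ ⟶ ⦋q⦌) (s : BiSimplex f p q) :
    Edge s.vtx₀ (s.op α β).vtx₀ :=
  (prodEdge (stdEdge 0 (α.toOrderHom 0) (Fin.zero_le _))
    (stdEdge 0 (β.toOrderHom 0) (Fin.zero_le _))).map s.σ

variable (f) (A : LocalCoeff.{u, v} R X)

/-- Bounded `(p, q)`-cochains of `f`: bounded functions on the `(p, q)`-simplices with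
`φ(σ, τ) ∈ A(σ(0, 0))`. -/
noncomputable abbrev BiCochain (p q : ℕ) : SnMod.{max u v} R :=
  A.bfun (S := BiSimplex f p q) BiSimplex.vtx₀

/-- The operator `φ ↦ ((σ, τ) ↦ A([σ(0, 0) → σ(α(0), β(0))]⁻¹) (φ ((α, β)^* (σ, τ))))`. -/
noncomputable def biOp {p q p' q' : ℕ} (α : ⦋p'⦌ ⟶ ⦋p⦌) (β : ⦋q'⦌ ⟶ ⦋q⦌) :
    BiCochain f A p' q' →ₗ[R] BiCochain f A p q :=
  A.pull (BiSimplex.op α β) fun s => inv (FundGrpd.edge (s.opEdge α β))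

/-- The horizontal differential
`(d_h φ)(σ, τ) = A([σ(0,0) → σ(1,0)]⁻¹) (φ (∂₀ʰ (σ, τ))) + ∑_{i ≥ 1} (-1)^i φ (∂ᵢʰ (σ, τ))`
(degenerate edges act as the identity). -/
noncomputable def bi_dh (p q : ℕ) : BiCochain f A p q →ₗ[R] BiCochain f A (p + 1) q :=
  altSum fun i : Fin (p + 2) => biOp f A (SimplexCategory.δ i) (𝟙 ⦋q⦌)

/-- The vertical differential
`(d_v φ)(σ, τ) = (-1)^p (A([σ(0,0) → σ(0,1)]⁻¹) (φ (∂₀ᵛ (σ, τ))) + ∑_{j ≥ 1} (-1)^j φ (∂ⱼᵛ (σ, τ)))`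
(degenerate edges act as the identity). -/
noncomputable def bi_dv (p q : ℕ) : BiCochain f A p q →ₗ[R] BiCochain f A p (q + 1) :=
  (-1 : ℤ) ^ p • altSum fun j : Fin (q + 2) => biOp f A (𝟙 ⦋p⦌) (SimplexCategory.δ j)

theorem BiSimplex.edge_opEdge_comp {p q p' q' p'' q'' : ℕ} (α : ⦋p'⦌ ⟶ ⦋p⦌) (β : ⦋q'⦌ ⟶ ⦋q⦌)
    (α' : ⦋p''⦌ ⟶ ⦋p'⦌) (β' : ⦋q''⦌ ⟶ ⦋q'⦌) (s : BiSimplex f p q) :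
    FundGrpd.edge (s.opEdge α β) ≫ FundGrpd.edge ((s.op α β).opEdge α' β') =
      FundGrpd.edge (s.opEdge (α' ≫ α) (β' ≫ β)) := by
  have h := (prodTriangle
    (stdTriangle.{u} 0 (α.toOrderHom 0) (α.toOrderHom (α'.toOrderHom 0)) (Fin.zero_le _)
      (α.toOrderHom.monotone (Fin.zero_le _)))
    (stdTriangle.{u} 0 (β.toOrderHom 0) (β.toOrderHom (β'.toOrderHom 0)) (Fin.zero_le _)
      (β.toOrderHom.monotone (Fin.zero_le _)))).map s.σ
  refine FundGrpd.edge_comp (h.ofEq rfl ?_ rfl)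
  rw [← stdEdge_map α 0 _ (Fin.zero_le _), ← stdEdge_map β 0 _ (Fin.zero_le _)]
  rfl

theorem biOp_comp {p q p' q' p'' q'' : ℕ} (α : ⦋p'⦌ ⟶ ⦋p⦌) (β : ⦋q'⦌ ⟶ ⦋q⦌)
    (α' : ⦋p''⦌ ⟶ ⦋p'⦌) (β' : ⦋q''⦌ ⟶ ⦋q'⦌) (φ : BiCochain f A p'' q'') :
    biOp f A α β (biOp f A α' β' φ) = biOp f A (α' ≫ α) (β' ≫ β) φ :=
  Subtype.ext (funext fun s => A.map_inv_map_inv (BiSimplex.edge_opEdge_comp f α β α' β' s)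
    (φ.1 (s.op (α' ≫ α) (β' ≫ β))))

/-- The double complex of bounded `(p, q)`-cochains of `f` with coefficients in `A`. -/
noncomputable def doubleComplex : SnDoubleComplex.{max u v} R where
  X := BiCochain f A
  dh := bi_dh f A
  dv := bi_dv f A
  bounded_dh p q := ⟨_, norm_altSum_le _ fun _ φ => A.norm_pull_le _ _ φ⟩
  bounded_dv p q := ⟨_, fun φ => by
    have := norm_altSum_le (fun j : Fin (q + 2) => biOp f A (𝟙 ⦋p⦌) (SimplexCategory.δ j))
      (fun _ φ => A.norm_pull_le _ _ φ) φ
    rcases neg_one_pow_eq_or ℤ p with hp | hp <;> simpa [bi_dv, hp] using this⟩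
  dh_dh p q φ := altSum_comp_altSum _ _ (fun i j h x => by
    rw [biOp_comp, biOp_comp, SimplexCategory.δ_comp_δ h]) φ
  dv_dv p q φ := by
    simp only [bi_dv, LinearMap.smul_apply, map_zsmul]
    rw [altSum_comp_altSum _ _ (fun i j h x => by
      rw [biOp_comp, biOp_comp, SimplexCategory.δ_comp_δ h]) φ, smul_zero, smul_zero]
  dv_dh p q φ := by
    have : altSum (fun j : Fin (q + 2) => biOp f A (𝟙 ⦋p + 1⦌) (SimplexCategory.δ j))
          (bi_dh f A p q φ) =
        bi_dh f A p (q + 1)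
          (altSum (fun j : Fin (q + 2) => biOp f A (𝟙 ⦋p⦌) (SimplexCategory.δ j)) φ) := by
      simp only [bi_dh, altSum, LinearMap.sum_apply, LinearMap.smul_apply, map_sum, map_zsmul]
      simp only [Finset.smul_sum, biOp_comp, Category.id_comp, Category.comp_id]
      rw [Finset.sum_comm]
      refine Finset.sum_congr rfl fun _ _ => Finset.sum_congr rfl fun _ _ => smul_comm _ _ _
    simp only [bi_dv, LinearMap.smul_apply, map_zsmul]
    rw [this, pow_succ]
    simp

end Dress

/-! ### The fibers and the local coefficient system of their bounded cohomology -/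

section Fibers

open SSet

variable {R : Type w} [NormedRing R] {X Y : SSet.{u}} (f : X ⟶ Y) (A : LocalCoeff.{u, v} R X)

/-- The fiber `F_y` of `f` over a `0`-simplex `y`, as a subcomplex of `X`: the simplices mapped to
the degenerate simplices on `y`. -/
def fiber (y : Y _⦋0⦌) : X.Subcomplex where
  obj n := {σ | f.app n σ = (SSet.const y : X ⟶ Y).app n σ}
  map {n m} α σ h := by
    change f.app m (X.map α σ) = (SSet.const y : X ⟶ Y).app m (X.map α σ)
    rw [NatTrans.naturality_apply, NatTrans.naturality_apply]
    exact congrArg (Y.map α) h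

/-- The local coefficient system `A_y` on the fiber `F_y`. -/
noncomputable abbrev fiberCoeff (y : Y _⦋0⦌) : LocalCoeff.{u, v} R (fiber f y).toSSet :=
  A.pullback (fiber f y).ι

/-- For `τ : Δ[p] ⟶ Y`, the fiber `F_τ` over `τ` of the induced map `X^{Δ[p]} ⟶ Y^{Δ[p]}` of mapping
spaces: its `n`-simplices are the maps `σ : Δ[p] × Δ[n] ⟶ X` over `τ`. -/
def simplexFiber {p : ℕ} (τ : (Δ[p] : SSet.{u}) ⟶ Y) : SSet.{u} where
  obj n := {σ : Δ[p] ⊗ SSet.stdSimplex.obj n.unop ⟶ X // σ ≫ f = fst _ _ ≫ τ}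
  map α := ↾fun σ => ⟨(Δ[p] ◁ SSet.stdSimplex.map α.unop) ≫ σ.1, by simp [σ.2]⟩
  map_id n := by
    refine ConcreteCategory.hom_ext _ _ fun σ => Subtype.ext ?_
    have h := congrArg (fun g => (Δ[p] ◁ g) ≫ σ.1) (SSet.stdSimplex.{u}.map_id n.unop)
    exact h.trans ((congrArg (· ≫ σ.1) (whiskerLeft_id _ _)).trans (Category.id_comp _))
  map_comp α β := by
    refine ConcreteCategory.hom_ext _ _ fun σ => Subtype.ext ?_
    have h := congrArg (fun g => (Δ[p] ◁ g) ≫ σ.1) (SSet.stdSimplex.{u}.map_comp β.unop α.unop)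
    exact h.trans ((congrArg (· ≫ σ.1) (whiskerLeft_comp _ _ _)).trans (Category.assoc _ _ _))

/-- The canonical `n`-simplex of `{i} × Δ[n]` in `Δ[p] × Δ[n]`. -/
def evalPt (p : ℕ) (i : Fin (p + 1)) (n : SimplexCategoryᵒᵖ) :
    ((Δ[p] : SSet.{u}) ⊗ SSet.stdSimplex.obj n.unop).obj n :=
  (SSet.stdSimplex.const p i n, SSet.stdSimplex.objEquiv.symm (𝟙 n.unop))

/-- Evaluation `F_τ ⟶ X` at the `i`-th vertex of `Δ[p]`. -/
def evalVtx {p : ℕ} (τ : (Δ[p] : SSet.{u}) ⟶ Y) (i : Fin (p + 1)) : simplexFiber f τ ⟶ X where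
  app n := ↾fun σ => σ.1.app n (evalPt p i n)
  naturality m n α := by
    refine ConcreteCategory.hom_ext _ _ fun σ => ?_
    refine Eq.trans ?_ (NatTrans.naturality_apply σ.1 α (evalPt p i m))
    refine congrArg (σ.1.app n) (Prod.ext rfl ?_)
    exact congrArg SSet.stdSimplex.objEquiv.symm ((Category.id_comp α.unop).trans
      (Category.comp_id α.unop).symm)

theorem app_congr {K L : SSet.{u}} {g h : K ⟶ L} (e : g = h) (n : SimplexCategoryᵒᵖ)
    (x : K.obj n) : g.app n x = h.app n x := by
  rw [e]

theorem evalVtx_comp {p : ℕ} (τ : (Δ[p] : SSet.{u}) ⟶ Y) (i : Fin (p + 1)) :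
    evalVtx f τ i ≫ f = SSet.const (τ.app _ (vtx p i)) := by
  ext n σ
  refine (app_congr σ.2 n (evalPt p i n)).trans ?_
  refine Eq.trans ?_ (NatTrans.naturality_apply τ (n.unop.const _ 0).op (vtx p i))
  rfl

theorem evalVtx_zero {p : ℕ} (τ : (Δ[p] : SSet.{u}) ⟶ Y) (i : Fin (p + 1))
    (x : (simplexFiber f τ) _⦋0⦌) :
    (evalVtx f τ i).app _ x = x.1.app _ (vtx p i, vtx 0 0) := by
  refine congrArg (x.1.app _) (Prod.ext rfl ?_)
  ext k
  fin_cases k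
  rfl

/-- A `1`-simplex of `Y` as a map `Δ[1] ⟶ Y`. -/
def edgeMap {y z : Y _⦋0⦌} (γ : Edge y z) : (Δ[1] : SSet.{u}) ⟶ Y := yonedaEquiv.symm γ.edge

theorem edgeMap_zero {y z : Y _⦋0⦌} (γ : Edge y z) : (edgeMap γ).app _ (vtx 1 0) = y :=
  Eq.trans (congrArg (fun a : ⦋0⦌ ⟶ ⦋1⦌ => Y.map a.op γ.edge) (by ext k; fin_cases k; rfl)) γ.src_eq

theorem edgeMap_one {y z : Y _⦋0⦌} (γ : Edge y z) : (edgeMap γ).app _ (vtx 1 1) = z :=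
  Eq.trans (congrArg (fun a : ⦋0⦌ ⟶ ⦋1⦌ => Y.map a.op γ.edge) (by ext k; fin_cases k; rfl)) γ.tgt_eq

/-- Restriction `F_γ ⟶ F_y` to the initial vertex of an edge `γ` from `y` to `z`. -/
def resSrc {y z : Y _⦋0⦌} (γ : Edge y z) : simplexFiber f (edgeMap γ) ⟶ (fiber f y).toSSet :=
  Subfunctor.lift (evalVtx f (edgeMap γ) 0) (by
    rintro n _ ⟨σ, rfl⟩
    have h := app_congr (evalVtx_comp f (edgeMap γ) 0) n σ
    rwa [edgeMap_zero] at h)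

/-- Restriction `F_γ ⟶ F_z` to the final vertex of an edge `γ` from `y` to `z`. -/
def resTgt {y z : Y _⦋0⦌} (γ : Edge y z) : simplexFiber f (edgeMap γ) ⟶ (fiber f z).toSSet :=
  Subfunctor.lift (evalVtx f (edgeMap γ) 1) (by
    rintro n _ ⟨σ, rfl⟩
    have h := app_congr (evalVtx_comp f (edgeMap γ) 1) n σ
    rwa [edgeMap_one] at h)

/-- The local coefficient system `A_γ` on `F_γ`, restricted from `X` along the evaluation at the final
vertex. -/
noncomputable abbrev edgeFiberCoeff {y z : Y _⦋0⦌} (γ : Edge y z) :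
    LocalCoeff.{u, v} R (simplexFiber f (edgeMap γ)) :=
  A.pullback (evalVtx f (edgeMap γ) 1)

/-- A `0`-simplex `x` of `F_γ` is an edge of `X`, from its initial to its final vertex. -/
def fiberEdge {y z : Y _⦋0⦌} (γ : Edge y z) (x : (simplexFiber f (edgeMap γ)) _⦋0⦌) :
    Edge ((evalVtx f (edgeMap γ) 0).app _ x) ((evalVtx f (edgeMap γ) 1).app _ x) :=
  ((prodEdge (stdEdge 0 1 (Fin.zero_le _)) (Edge.id (vtx 0 0))).map x.1).ofEq
    (evalVtx_zero f _ 0 x).symm (evalVtx_zero f _ 1 x).symm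

/-- The map `C_b^q(F_y; A_y) → C_b^q(F_γ; A_γ)` induced by `F_γ ⟶ F_y` and by the isomorphisms
`A(x(0)) → A(x(1))` of coefficients along the edges `x ∈ (F_γ)₀`. -/
noncomputable def resSrcCochain {y z : Y _⦋0⦌} (γ : Edge y z) (q : ℕ) :
    Cochain (fiberCoeff f A y) q →ₗ[R] Cochain (edgeFiberCoeff f A γ) q :=
  A.pull (S := (Δ[q] : SSet.{u}) ⟶ simplexFiber f (edgeMap γ))
    (S' := (Δ[q] : SSet.{u}) ⟶ (fiber f y).toSSet)
    (b := fun σ => (evalVtx f (edgeMap γ) 1).app _ (vtx₀ σ))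
    (b' := fun σ => (fiber f y).ι.app _ (vtx₀ σ))
    (fun σ => σ ≫ resSrc f γ) fun σ => FundGrpd.edge (fiberEdge f γ (vtx₀ σ))

/-- The map `C_b^q(F_z; A_z) → C_b^q(F_γ; A_γ)` induced by `F_γ ⟶ F_z`. -/
noncomputable def resTgtCochain {y z : Y _⦋0⦌} (γ : Edge y z) (q : ℕ) :
    Cochain (fiberCoeff f A z) q →ₗ[R] Cochain (edgeFiberCoeff f A γ) q :=
  A.pull (S := (Δ[q] : SSet.{u}) ⟶ simplexFiber f (edgeMap γ))
    (S' := (Δ[q] : SSet.{u}) ⟶ (fiber f z).toSSet)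
    (b := fun σ => (evalVtx f (edgeMap γ) 1).app _ (vtx₀ σ))
    (b' := fun σ => (fiber f z).ι.app _ (vtx₀ σ))
    (fun σ => σ ≫ resTgt f γ) fun _ => 𝟙 _

/-- The seminormed local coefficient system `y ↦ H_b^q(F_y; A_y)` on `Y`.  Its value along an edge `γ`
from `y` to `z` is the isomorphism `γ_* : H_b^q(F_y; A_y) ≅ H_b^q(F_z; A_z)` given by the zigzag
`F_y ← F_γ → F_z`: it sends `[φ]` to `[ψ]` exactly if the pullbacks of `φ` and `ψ` to
`C_b^q(F_γ; A_γ)` are cohomologous.  As the edges generate the fundamental groupoid, these data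
determine the system up to unique isomorphism compatible with the identifications `iso`. -/
structure FiberSystem (q : ℕ) where
  sys : LocalCoeff.{u, max u v} R Y
  iso (y : Y _⦋0⦌) : sys.at₀ y ≃ₗᵢ[R] Hb (fiberCoeff f A y) q
  transport {y z : Y _⦋0⦌} (γ : Edge y z)
    (φ : LinearMap.ker ((cochainComplex (fiberCoeff f A y)).d q))
    (ψ : LinearMap.ker ((cochainComplex (fiberCoeff f A z)).d q)) :
    (sys.map (FundGrpd.edge γ)).lin
        ((iso y).symm ((cochainComplex (fiberCoeff f A y)).cls q φ)) =
      (iso z).symm ((cochainComplex (fiberCoeff f A z)).cls q ψ) ↔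
    resSrcCochain f A γ q φ.1 - resTgtCochain f A γ q ψ.1 ∈
      (cochainComplex (edgeFiberCoeff f A γ)).cobound q

end Fibers

end BddCoh

namespace BddCoh

/-! ### Chain maps and deformation retractions of seminormed complexes -/

namespace SnComplex

variable {R : Type w} [NormedRing R] {K L M : SnComplex.{v} R}

/-! Convergence comes from the rows. In a (p, 0)-simplex τ is determined by σ, so the row q = 0 is
the complex of bounded cochains on X (`bottomEquiv`). Every row retracts onto this one: a prism
decomposition in the horizontal direction contracts Δ[q] to its initial vertex without changing τ
(`rowHomotopy_succ`). Under the retractions the vertical differentials become alternately 0 and ±1,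
so the total complex has the cohomology of the bottom row (`RowRetraction.convergesTo`).

The first page comes from the columns. Up to sign, column p consists of the uniformly bounded
families, indexed by the p-simplices τ of Y, of bounded cochains on the mapping space fibers F_τ.
Since {0} ⟶ Δ[p] is anodyne, the Kan condition makes F_τ ⟶ F_{τ₀} a trivial fibration (`resTo_rlp`).
A trivial fibration has a section and a fiberwise homotopy, which give a norm non-increasing
retraction of cochain complexes with a homotopy bounded by n + 1 in terms of the degree alone
(`CoeffMap.exists_retraction`). Hence F_τ and F_{τ₀} have isometrically isomorphic bounded
cohomology. The same holds at both ends of an edge, which defines `transport`; comparing inside the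
fiber over a 2-simplex shows that transport respects the relations of the fundamental groupoid.

For the second page, a vertical cocycle assigns to each τ a class on F_{τ₀}, that is, a bounded
cochain on Y with values in the cohomology of the fibers (`toBase`). Every bounded cochain arises
this way with arbitrarily small loss of norm, by choosing representatives simplex by simplex. The
one obstruction is injectivity: if all classes vanish, the primitives over the different τ must be
bounded uniformly. This is clear for finitely many simplices and for q = 0, where there are no
nonzero coboundaries. Under UBC it follows because over a connected base one constant serves all
fibers: a zigzag of trivial fibrations composes to a single span (`TrivEquiv.ubcWith`). The algebra
from this point to the isometry on page two is `SpectralSeq.exists_page_two_equiv`. -/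

theorem cls_surjective (K : SnComplex.{v} R) (n : ℕ) : Function.Surjective (K.cls n) :=
  Submodule.mkQ_surjective _

theorem cls_eq_zero_iff (n : ℕ) (z : LinearMap.ker (K.d n)) :
    K.cls n z = 0 ↔ z.1 ∈ K.cobound n := by
  exact Submodule.Quotient.mk_eq_zero _

theorem cls_eq_iff (n : ℕ) (z z' : LinearMap.ker (K.d n)) :
    K.cls n z = K.cls n z' ↔ z.1 - z'.1 ∈ K.cobound n := by
  rw [← sub_eq_zero, ← map_sub, cls_eq_zero_iff]
  rfl

theorem norm_cls_le (n : ℕ) (z : LinearMap.ker (K.d n)) : ‖K.cls n z‖ ≤ ‖z.1‖ :=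
  Submodule.Quotient.norm_mk_le _ _

theorem exists_cls_eq_norm_lt (n : ℕ) (ξ : K.H n) {ε : ℝ} (hε : 0 < ε) :
    ∃ z : LinearMap.ker (K.d n), K.cls n z = ξ ∧ ‖z.1‖ < ‖ξ‖ + ε := by
  obtain ⟨m, hm, h⟩ := Submodule.Quotient.norm_mk_lt (S := (K.cobound n).submoduleOf _) ξ hε
  exact ⟨m, hm, h⟩

theorem mem_cobound_succ {n : ℕ} {x : K.X (n + 1)} :
    x ∈ K.cobound (n + 1) ↔ ∃ y, K.d n y = x := Iff.rfl

theorem mem_cobound_zero {x : K.X 0} : x ∈ K.cobound 0 ↔ x = 0 := Iff.rfl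

/-- Norm non-increasing chain maps. -/
structure CMap (K L : SnComplex.{v} R) where
  f (n : ℕ) : K.X n →ₗ[R] L.X n
  norm_le (n : ℕ) (x : K.X n) : ‖f n x‖ ≤ ‖x‖
  comm (n : ℕ) (x : K.X n) : L.d n (f n x) = f (n + 1) (K.d n x)

namespace CMap

/-- The composition of two chain maps. -/
def comp (m : CMap K L) (m' : CMap L M) : CMap K M where
  f n := m'.f n ∘ₗ m.f n
  norm_le n x := (m'.norm_le n _).trans (m.norm_le n x)
  comm n x := by simp [m'.comm, m.comm]

variable (m : CMap K L)

theorem mem_cobound {n : ℕ} {x : K.X n} (hx : x ∈ K.cobound n) : m.f n x ∈ L.cobound n := by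
  cases n with
  | zero => rw [mem_cobound_zero.1 hx, map_zero]; exact zero_mem _
  | succ n =>
    obtain ⟨y, rfl⟩ := hx
    exact ⟨m.f n y, m.comm n y⟩

/-- The map induced on cocycles. -/
def onKer (n : ℕ) : LinearMap.ker (K.d n) →ₗ[R] LinearMap.ker (L.d n) :=
  (m.f n).restrict fun x hx => by
    rw [LinearMap.mem_ker] at hx ⊢
    rw [m.comm, hx, map_zero]

/-- The map induced on cohomology. -/
noncomputable def Hmap (n : ℕ) : K.H n →ₗ[R] L.H n :=
  Submodule.mapQ _ _ (m.onKer n) (by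
    intro x hx
    exact m.mem_cobound hx)

theorem Hmap_cls (n : ℕ) (z : LinearMap.ker (K.d n)) :
    m.Hmap n (K.cls n z) = L.cls n (m.onKer n z) := rfl

theorem norm_Hmap_le (n : ℕ) (ξ : K.H n) : ‖m.Hmap n ξ‖ ≤ ‖ξ‖ := by
  refine le_of_forall_pos_le_add fun ε hε => ?_
  obtain ⟨z, rfl, hz⟩ := K.exists_cls_eq_norm_lt n ξ hε
  rw [Hmap_cls]
  exact (norm_cls_le _ _).trans ((m.norm_le n _).trans hz.le)

theorem Hmap_comp (m' : CMap L M) (n : ℕ) (ξ : K.H n) :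
    (m.comp m').Hmap n ξ = m'.Hmap n (m.Hmap n ξ) := by
  obtain ⟨z, rfl⟩ := K.cls_surjective n ξ
  rfl

theorem Hmap_eq_of_eq {m m' : CMap K L} {n : ℕ} (h : ∀ x, m.f n x = m'.f n x) (ξ : K.H n) :
    m.Hmap n ξ = m'.Hmap n ξ := by
  obtain ⟨z, rfl⟩ := K.cls_surjective n ξ
  rw [Hmap_cls, Hmap_cls]
  congr 1
  exact Subtype.ext (h _)

/-- A norm non-increasing retraction of the chain map `m`, together with a bounded homotopy from
the idempotent endomorphism it defines to the identity. -/
structure Retraction (m : CMap K L) where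
  s : CMap L K
  s_m (n : ℕ) (x : K.X n) : s.f n (m.f n x) = x
  h (n : ℕ) : L.X (n + 1) →ₗ[R] L.X n
  -- The prism over an n-simplex has n + 1 top-dimensional simplices, each contributing a term of
  -- norm at most ‖x‖.
  norm_h_le (n : ℕ) (x : L.X (n + 1)) : ‖h n x‖ ≤ (n + 1) * ‖x‖
  h_zero (x : L.X 0) : m.f 0 (s.f 0 x) - x = h 0 (L.d 0 x)
  h_succ (n : ℕ) (x : L.X (n + 1)) :
    m.f (n + 1) (s.f (n + 1) x) - x = L.d n (h n x) + h (n + 1) (L.d (n + 1) x)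

namespace Retraction

variable {m} (r : m.Retraction)

theorem Hmap_s_m (n : ℕ) (ξ : K.H n) : r.s.Hmap n (m.Hmap n ξ) = ξ := by
  obtain ⟨z, rfl⟩ := K.cls_surjective n ξ
  rw [Hmap_cls, Hmap_cls]
  congr 1
  exact Subtype.ext (r.s_m n _)

theorem sub_mem_cobound (n : ℕ) (x : L.X n) (hx : L.d n x = 0) :
    m.f n (r.s.f n x) - x ∈ L.cobound n := by
  cases n with
  | zero => rw [r.h_zero, hx, map_zero]; exact zero_mem _
  | succ n => rw [r.h_succ, hx, map_zero, add_zero]; exact ⟨_, rfl⟩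

theorem Hmap_m_s (n : ℕ) (ξ : L.H n) : m.Hmap n (r.s.Hmap n ξ) = ξ := by
  obtain ⟨z, rfl⟩ := L.cls_surjective n ξ
  rw [Hmap_cls, Hmap_cls, cls_eq_iff]
  exact r.sub_mem_cobound n z.1 z.2

/-- Both `m` and `s` are norm non-increasing and `s` inverts `m` on cohomology, so `m` cannot shrink
a class. -/
theorem norm_Hmap (r : m.Retraction) (n : ℕ) (ξ : K.H n) : ‖m.Hmap n ξ‖ = ‖ξ‖ := by
  refine le_antisymm (m.norm_Hmap_le n ξ) ?_
  conv_lhs => rw [← r.Hmap_s_m n ξ]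
  exact r.s.norm_Hmap_le n _

theorem Hmap_injective (r : m.Retraction) (n : ℕ) : Function.Injective (m.Hmap n) :=
  Function.LeftInverse.injective (r.Hmap_s_m n)

/-- The isomorphism induced on cohomology by a chain map with a retraction. -/
noncomputable def HEquiv (n : ℕ) : K.H n ≃ₗ[R] L.H n :=
  { m.Hmap n with
    invFun := r.s.Hmap n
    left_inv := r.Hmap_s_m n
    right_inv := r.Hmap_m_s n }

end Retraction

end CMap

/-- The uniform boundary condition with a given constant. -/
def UBCWith (K : SnComplex.{v} R) (κ : ℝ) (n : ℕ) : Prop :=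
  ∀ m, m + 1 = n → ∀ b ∈ LinearMap.range (K.d m), ∃ c : K.X m, K.d m c = b ∧ ‖c‖ ≤ κ * ‖b‖

/-- A primitive found in `L` is brought back by `s` at no cost, so the constant does not change. -/
theorem CMap.Retraction.ubc_of_target {m : CMap K L} (r : m.Retraction) {κ : ℝ} (hκ : 0 ≤ κ)
    {n : ℕ} (h : L.UBCWith κ n) : K.UBCWith κ n := by
  rintro k rfl _ ⟨x, rfl⟩
  obtain ⟨c, hc, hn⟩ := h k rfl (m.f (k + 1) (K.d k x)) ⟨m.f k x, m.comm k x⟩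
  refine ⟨r.s.f k c, ?_, ?_⟩
  · rw [r.s.comm, hc, r.s_m]
  · exact (r.s.norm_le k c).trans
      (hn.trans (mul_le_mul_of_nonneg_left (m.norm_le _ _) hκ))

/-- A primitive of s b found in `K` maps to a primitive of m (s b), and the homotopy accounts for
the difference to b. Ending in degree n − 1, the homotopy has norm at most n, hence the constant κ +
n. -/
theorem CMap.Retraction.ubc_of_source {m : CMap K L} (r : m.Retraction) {κ : ℝ} (hκ : 0 ≤ κ)
    {n : ℕ} (h : K.UBCWith κ n) : L.UBCWith (κ + n) n := by
  rintro k rfl _ ⟨x, rfl⟩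
  obtain ⟨c, hc, hn⟩ := h k rfl (r.s.f (k + 1) (L.d k x)) ⟨r.s.f k x, r.s.comm k x⟩
  refine ⟨m.f k c - r.h k (L.d k x), ?_, ?_⟩
  · rw [map_sub, m.comm, hc]
    have := r.h_succ k (L.d k x)
    rw [L.d_d, map_zero, add_zero] at this
    rw [← this]
    abel
  · refine (norm_sub_le _ _).trans ?_
    have h1 : ‖m.f k c‖ ≤ κ * ‖L.d k x‖ := (m.norm_le k c).trans
      (hn.trans (mul_le_mul_of_nonneg_left (r.s.norm_le _ _) hκ))
    have h2 := r.norm_h_le k (L.d k x)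
    push_cast
    linarith

end SnComplex

/-! ### The spectral sequence of a double complex -/

namespace SnDoubleComplex

variable {R : Type w} [NormedRing R] (K : SnDoubleComplex.{v} R)

theorem D_apply (x : K.Fam) (p q : ℕ) : K.D x p q = K.intoH p q x + K.intoV p q x := rfl

@[simp] theorem intoH_zero (q : ℕ) (x : K.Fam) : K.intoH 0 q x = 0 := rfl
@[simp] theorem intoV_zero (p : ℕ) (x : K.Fam) : K.intoV p 0 x = 0 := rfl
@[simp] theorem intoH_succ (p q : ℕ) (x : K.Fam) : K.intoH (p + 1) q x = K.dh p q (x p q) := rfl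
@[simp] theorem intoV_succ (p q : ℕ) (x : K.Fam) : K.intoV p (q + 1) x = K.dv p q (x p q) := rfl

theorem D_D (x : K.Fam) : K.D (K.D x) = 0 := by
  funext p q
  rcases p with _ | _ | p <;> rcases q with _ | _ | q <;>
    simp [D_apply, K.dh_dh, K.dv_dv]
  all_goals
    exact (add_comm _ _).trans (K.dv_dh _ _ _)

variable {K}

theorem intoH_eq_zero {x : K.Fam} {p q : ℕ} (h : ∀ p', p' + 1 = p → x p' q = 0) :
    K.intoH p q x = 0 := by
  cases p with
  | zero => rfl
  | succ p => rw [intoH_succ, h p rfl, map_zero]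

theorem intoV_eq_zero {x : K.Fam} {p q : ℕ} (h : ∀ q', q' + 1 = q → x p q' = 0) :
    K.intoV p q x = 0 := by
  cases q with
  | zero => rfl
  | succ q => rw [intoV_succ, h q rfl, map_zero]

theorem D_mem_deg {n : ℕ} {x : K.Fam} (hx : x ∈ K.deg n) : K.D x ∈ K.deg (n + 1) := by
  intro p q h
  rw [D_apply, intoH_eq_zero fun p' hp => hx _ _ (by omega),
    intoV_eq_zero fun q' hp => hx _ _ (by omega), add_zero]

theorem D_mem_fil {s : ℕ} {x : K.Fam} (hx : x ∈ K.fil s) : K.D x ∈ K.fil s := by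
  intro p q h
  rw [D_apply, intoH_eq_zero fun p' hp => hx _ _ (by omega),
    intoV_eq_zero fun q' hp => hx _ _ (by omega), add_zero]

theorem fil_anti {s t : ℕ} (h : s ≤ t) {x : K.Fam} (hx : x ∈ K.fil t) : x ∈ K.fil s :=
  fun p q hp => hx p q (hp.trans_le h)

theorem mem_fil_zero (x : K.Fam) : x ∈ K.fil 0 := fun _ _ h => absurd h (Nat.not_lt_zero _)

theorem eq_zero_of_mem_deg_fil {n s : ℕ} (h : n < s) {x : K.Fam} (hd : x ∈ K.deg n)
    (hf : x ∈ K.fil s) : x = 0 := by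
  funext p q
  by_cases hp : p + q = n
  · exact hf p q (by omega)
  · exact hd p q hp

/-- The part of a family in the bidegrees `(p, q)` with `p + q + 1 = n`. -/
def predPart (n : ℕ) (x : K.Fam) : K.Fam := fun p q => if p + q + 1 = n then x p q else 0

theorem predPart_mem_deg (n : ℕ) (x : K.Fam) : predPart (n + 1) x ∈ K.deg n := by
  intro p q h
  exact if_neg (by omega)

theorem predPart_mem_fil {s : ℕ} (n : ℕ) {x : K.Fam} (hx : x ∈ K.fil s) :
    predPart n x ∈ K.fil s := by
  intro p q h
  simp [predPart, hx p q h]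

/-- The definition of `B` puts no total degree on the element whose differential is taken. Only its
part in degree n − 1 contributes to degree n, so a primitive may always be made homogeneous. -/
theorem D_predPart {n : ℕ} {x : K.Fam} (hx : K.D x ∈ K.deg n) : K.D (predPart n x) = K.D x := by
  funext p q
  by_cases hp : p + q = n
  · subst hp
    rw [D_apply, D_apply]
    congr 1
    · cases p with
      | zero => rfl
      | succ p => simp only [intoH_succ, predPart]; rw [if_pos (by omega)]
    · cases q with
      | zero => rfl
      | succ q => simp only [intoV_succ, predPart]; rw [if_pos (by omega)]
  · rw [hx p q hp, D_apply, intoH_eq_zero, intoV_eq_zero, add_zero]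
    · exact fun q' hq => if_neg (by omega)
    · exact fun q' hq => if_neg (by omega)

theorem mem_Z {r p q : ℕ} {x : K.Fam} :
    x ∈ K.Z r p q ↔ x ∈ K.deg (p + q) ∧ x ∈ K.fil p ∧ K.D x ∈ K.fil (p + r) := by
  simp only [Z, Submodule.mem_inf, Submodule.mem_comap, and_assoc]

theorem mem_B {r p q : ℕ} {x : K.Fam} :
    x ∈ K.B r p q ↔ ∃ a b, a ∈ K.deg (p + q) ∧ a ∈ K.fil (p + 1) ∧ K.D a ∈ K.fil (p + r) ∧
      b ∈ K.fil (p + 1 - r) ∧ K.D b ∈ K.deg (p + q) ∧ K.D b ∈ K.fil p ∧ a + K.D b = x := by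
  simp only [B, Submodule.mem_sup, Submodule.mem_inf, Submodule.mem_comap, Submodule.mem_map]
  constructor
  · rintro ⟨a, ⟨⟨ha, ha'⟩, ha''⟩, _, ⟨⟨⟨b, hb, rfl⟩, hb'⟩, hb''⟩, rfl⟩
    exact ⟨a, b, ha, ha', ha'', hb, hb', hb'', rfl⟩
  · rintro ⟨a, b, ha, ha', ha'', hb, hb', hb'', rfl⟩
    exact ⟨a, ⟨⟨ha, ha'⟩, ha''⟩, _, ⟨⟨⟨b, hb, rfl⟩, hb'⟩, hb''⟩, rfl⟩

theorem mem_B_of_mem_fil {r p q : ℕ} {x : K.Fam} (h : x ∈ K.deg (p + q)) (h' : x ∈ K.fil (p + 1))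
    (h'' : K.D x ∈ K.fil (p + r)) : x ∈ K.B r p q :=
  mem_B.2 ⟨x, 0, h, h', h'', zero_mem _, by simp, by simp, by simp⟩

variable (K)

/-- The page `E_r` in bidegree `(p, q)`. -/
abbrev Pg (r p q : ℕ) : Type v := K.Z r p q ⧸ (K.B r p q).submoduleOf (K.Z r p q)

variable {K}

theorem D_mem_Z {r p q p' q' : ℕ} (hp : p + r = p') (hq : q + 1 = q' + r) {x : K.Fam}
    (hx : x ∈ K.Z r p q) (r' : ℕ) : K.D x ∈ K.Z r' p' q' := by
  obtain ⟨h1, h2, h3⟩ := mem_Z.1 hx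
  refine mem_Z.2 ⟨?_, hp ▸ h3, by rw [D_D]; exact zero_mem _⟩
  have := D_mem_deg h1
  rwa [show p + q + 1 = p' + q' by omega] at this

theorem D_mem_B {r p q p' q' : ℕ} (hp : p + r = p') (hq : q + 1 = q' + r) {x : K.Fam}
    (hx : x ∈ K.B r p q) : K.D x ∈ K.B r p' q' := by
  obtain ⟨a, b, ha, ha', ha'', hb, hb', hb'', rfl⟩ := mem_B.1 hx
  have : K.D (a + K.D b) = K.D a := by rw [map_add, D_D, add_zero]
  rw [this]
  refine mem_B.2 ⟨0, a, zero_mem _, zero_mem _, by simp, fil_anti (by omega) ha', ?_, hp ▸ ha'',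
    zero_add _⟩
  have := D_mem_deg ha
  rwa [show p + q + 1 = p' + q' by omega] at this

/-- The differential of the page `E_r`. -/
noncomputable def dPg {r p q p' q' : ℕ} (hp : p + r = p') (hq : q + 1 = q' + r) :
    K.Pg r p q →ₗ[R] K.Pg r p' q' :=
  Submodule.mapQ _ _ (K.D.restrict fun _ hx => D_mem_Z hp hq hx r) fun _ hx => D_mem_B hp hq hx

theorem Z_anti {r r' p q : ℕ} (h : r ≤ r') {x : K.Fam} (hx : x ∈ K.Z r' p q) : x ∈ K.Z r p q := by
  obtain ⟨h1, h2, h3⟩ := mem_Z.1 hx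
  exact mem_Z.2 ⟨h1, h2, fil_anti (by omega) h3⟩

/-- If D x = a + D b with a one filtration step deeper than required, then x − b is an (r +
1)-cycle, and the homogeneous part of b lies in B_r. So every cycle of E_r has a representative in
Z_{r+1}. -/
theorem sub_mem_Z_of_D_mem_B {r p q p' q' : ℕ} (hp : p + r = p') (hq : q + 1 = q' + r)
    {x : K.Fam} (hx : x ∈ K.Z r p q) (hD : K.D x ∈ K.B r p' q') :
    ∃ y ∈ K.Z (r + 1) p q, x - y ∈ K.B r p q := by
  obtain ⟨h1, h2, h3⟩ := mem_Z.1 hx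
  obtain ⟨a, b, ha, ha', ha'', hb, hb', hb'', e⟩ := mem_B.1 hD
  have hpq : p' + q' = p + q + 1 := by omega
  rw [hpq] at hb'
  have hb1 := predPart_mem_deg (p + q) b
  have hb2 : predPart (p + q + 1) b ∈ K.fil (p + 1) :=
    predPart_mem_fil _ (by rwa [show p' + 1 - r = p + 1 by omega] at hb)
  have hb3 := D_predPart hb'
  set c := predPart (p + q + 1) b
  refine ⟨x - c, mem_Z.2 ⟨sub_mem h1 hb1, sub_mem h2 (fil_anti (by omega) hb2), ?_⟩, ?_⟩
  · rw [map_sub, hb3, ← e, add_sub_cancel_right]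
    exact fil_anti (by omega) ha'
  · rw [sub_sub_cancel]
    refine mem_B_of_mem_fil hb1 hb2 ?_
    rw [hb3]
    exact hp ▸ hb''

/-- D x has total degree p + q + 1 but horizontal degree at least p + r > p + q + 1. -/
theorem mem_Z_succ_of_lt {r p q : ℕ} (h : q + 1 < r) {x : K.Fam} (hx : x ∈ K.Z r p q) :
    K.D x = 0 := by
  obtain ⟨h1, h2, h3⟩ := mem_Z.1 hx
  exact eq_zero_of_mem_deg_fil (by omega) (D_mem_deg h1) h3

theorem exists_of_mem_B_succ {r p q p₀ q₀ : ℕ} (hp : p₀ + r = p) (hq : q₀ + 1 = q + r)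
    {x : K.Fam} (hx : x ∈ K.Z (r + 1) p q) (hB : x ∈ K.B (r + 1) p q) :
    ∃ y ∈ K.Z r p₀ q₀, x - K.D y ∈ K.B r p q := by
  obtain ⟨a, b, ha, ha', ha'', hb, hb', hb'', rfl⟩ := mem_B.1 hB
  have hpq : p + q = p₀ + q₀ + 1 := by omega
  rw [hpq] at hb'
  refine ⟨predPart (p₀ + q₀ + 1) b, mem_Z.2 ⟨predPart_mem_deg _ _, predPart_mem_fil _
    (by rwa [show p + 1 - (r + 1) = p₀ by omega] at hb), ?_⟩, ?_⟩
  · rw [D_predPart hb', hp]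
    exact hb''
  · rw [D_predPart hb', add_sub_cancel_right]
    exact mem_B_of_mem_fil ha ha' (fil_anti (by omega) ha'')

/-- The source (p − r, q + r − 1) of the incoming differential lies outside the quadrant, so the
next page has no new boundaries. -/
theorem mem_B_of_mem_B_succ {r p q : ℕ} (h : p < r ∨ q + r < 1)
    {x : K.Fam} (hB : x ∈ K.B (r + 1) p q) : x ∈ K.B r p q := by
  obtain ⟨a, b, ha, ha', ha'', hb, hb', hb'', rfl⟩ := mem_B.1 hB
  rcases h with h | h
  · exact mem_B.2 ⟨a, b, ha, ha', fil_anti (by omega) ha'',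
      by rw [show p + 1 - r = 0 by omega]; exact mem_fil_zero b, hb', hb'', rfl⟩
  · obtain rfl : q = 0 := by omega
    obtain rfl : r = 0 := by omega
    refine mem_B.2 ⟨a, predPart (p + 0) b, ha, ha', fil_anti (by omega) ha'', ?_,
      by rwa [D_predPart hb'], by rwa [D_predPart hb'], by rw [D_predPart hb']⟩
    -- The homogeneous part of `b` lives in horizontal degrees below p, where `b` vanishes; it is
    -- therefore zero and lies in every filtration step.
    intro p' q' hp'
    by_cases hpp : p' + q' + 1 = p + 0
    · have : p' < p := by omega
      simp only [predPart]
      rw [if_pos hpp]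
      exact hb p' q' (by omega)
    · exact if_neg hpp

/-- Writing x = a + D (b + y), the relation D ∘ D = 0 gives D a = D x, so a inherits the deeper
filtration that page r + 1 demands. -/
theorem mem_B_succ_of_sub {r p q p₀ q₀ : ℕ} (hp : p₀ + r = p) (hq : q₀ + 1 = q + r)
    {x y : K.Fam} (hx : x ∈ K.Z (r + 1) p q) (hy : y ∈ K.Z r p₀ q₀) (h : x - K.D y ∈ K.B r p q) :
    x ∈ K.B (r + 1) p q := by
  obtain ⟨h1, h2, h3⟩ := mem_Z.1 hx
  obtain ⟨y1, y2, y3⟩ := mem_Z.1 hy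
  obtain ⟨a, b, ha, ha', ha'', hb, hb', hb'', e⟩ := mem_B.1 h
  have e' : x = a + K.D (b + y) := by
    rw [map_add, ← add_assoc, e, sub_add_cancel]
  refine mem_B.2 ⟨a, b + y, ha, ha', ?_, add_mem (fil_anti (by omega) hb)
    (fil_anti (by omega) y2), ?_, ?_, e'.symm⟩
  · have : K.D a = K.D x := by rw [e', map_add, D_D, add_zero]
    rwa [this]
  · rw [map_add]
    refine add_mem hb' ?_
    have := D_mem_deg y1
    rwa [show p₀ + q₀ + 1 = p + q by omega] at this
  · rw [map_add]
    exact add_mem hb'' (hp ▸ y3)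

theorem mem_B_succ_of_mem_B {r p q : ℕ} {x : K.Fam} (hx : x ∈ K.Z (r + 1) p q)
    (h : x ∈ K.B r p q) : x ∈ K.B (r + 1) p q := by
  obtain ⟨h1, h2, h3⟩ := mem_Z.1 hx
  obtain ⟨a, b, ha, ha', ha'', hb, hb', hb'', e⟩ := mem_B.1 h
  refine mem_B.2 ⟨a, b, ha, ha', ?_, fil_anti (by omega) hb, hb', hb'', e⟩
  have : K.D a = K.D x := by rw [← e, map_add, D_D, add_zero]
  rwa [this]

end SnDoubleComplex

/-! ### The pages as complexes and their homology. -/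

namespace SnDoubleComplex

section HomologyOfModules

variable {R : Type w} [Ring R] {ι : Type*} {c : ComplexShape ι}
  (C : HomologicalComplex (ModuleCat.{v} R) c) (i : ι)

/-- Homology is the cokernel of `toCycles`, and as the inclusion of the cycles is injective, being a
boundary can be tested in `C.X i`. -/
theorem homologyπ_eq_zero_iff (x : C.cycles i) :
    C.homologyπ i x = 0 ↔ ∃ y : C.X (c.prev i), C.d (c.prev i) i y = C.iCycles i x := by
  have hex := ShortComplex.exact_of_g_is_cokernel
    (ShortComplex.mk _ _ (C.toCycles_comp_homologyπ (c.prev i) i)) (C.homologyIsCokernel _ i rfl)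
  have hinj := (ModuleCat.mono_iff_injective (C.iCycles i)).1 inferInstance
  have hcomp (y) : C.iCycles i (C.toCycles (c.prev i) i y) = C.d (c.prev i) i y :=
    ConcreteCategory.congr_hom (C.toCycles_i (c.prev i) i) y
  constructor
  · intro h
    obtain ⟨y, hy⟩ := (ShortComplex.moduleCat_exact_iff _).1 hex x h
    exact ⟨y, (hcomp y).symm.trans (congrArg _ hy)⟩
  · rintro ⟨y, hy⟩
    have : x = C.toCycles (c.prev i) i y := hinj (hy.symm.trans (hcomp y).symm)
    rw [this]
    exact ConcreteCategory.congr_hom (C.toCycles_comp_homologyπ (c.prev i) i) y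

/-- The isomorphism from the homology of a complex of modules to a quotient, for a linear map `s`
onto the cycles for which the preimage of the boundaries is `N`. -/
theorem exists_homology_iso {Z : Type v} [AddCommGroup Z] [Module R Z] (s : Z →ₗ[R] C.X i)
    (N : Submodule R Z) (hs : ∀ j z, C.d i j (s z) = 0)
    (hs' : ∀ x : C.X i, (∀ j, C.d i j x = 0) → ∃ z, s z = x)
    (hN : ∀ z, z ∈ N ↔ ∃ y : C.X (c.prev i), C.d (c.prev i) i y = s z) :
    ∃ e : C.homology i ≅ ModuleCat.of R (Z ⧸ N), ∀ (x : C.cycles i) (z : Z),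
      C.iCycles i x = s z → e.hom (C.homologyπ i x) = N.mkQ z := by
  let k : ModuleCat.of R Z ⟶ C.X i := ModuleCat.ofHom s
  have hk : k ≫ C.d i (c.next i) = 0 := ModuleCat.hom_ext (LinearMap.ext fun z => hs _ z)
  let Ψ : Z →ₗ[R] C.homology i := (C.liftCycles k _ rfl hk ≫ C.homologyπ i).hom
  have hi (z : Z) : C.iCycles i (C.liftCycles k _ rfl hk z) = s z :=
    ConcreteCategory.congr_hom (C.liftCycles_i k _ rfl hk) z
  have hΨ (z : Z) : Ψ z = C.homologyπ i (C.liftCycles k _ rfl hk z) := rfl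
  have hinj := (ModuleCat.mono_iff_injective (C.iCycles i)).1 inferInstance
  have hsurj : Function.Surjective Ψ := by
    intro ξ
    obtain ⟨x, rfl⟩ := (ModuleCat.epi_iff_surjective (C.homologyπ i)).1 inferInstance ξ
    obtain ⟨z, hz⟩ := hs' (C.iCycles i x) fun j =>
      ConcreteCategory.congr_hom (C.iCycles_d i j) x
    refine ⟨z, ?_⟩
    rw [hΨ]
    congr 1
    exact hinj ((hi z).trans hz)
  have hker : LinearMap.ker Ψ = N := by
    ext z
    rw [LinearMap.mem_ker, hΨ, homologyπ_eq_zero_iff, hN, hi]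
  let e : (Z ⧸ N) ≃ₗ[R] C.homology i :=
    (Submodule.quotEquivOfEq _ _ hker.symm).trans (Ψ.quotKerEquivOfSurjective hsurj)
  refine ⟨e.symm.toModuleIso, fun x z h => ?_⟩
  have : C.homologyπ i x = e (N.mkQ z) := by
    have : e (N.mkQ z) = Ψ z := rfl
    rw [this, hΨ]
    congr 1
    exact hinj (h.trans (hi z).symm)
  rw [this]
  exact e.symm_apply_apply _

end HomologyOfModules

variable {R : Type w} [NormedRing R] (K : SnDoubleComplex.{v} R)

/-- The pages of the spectral sequence as complexes. -/
noncomputable def pageComplex (r : ℤ) (hr : 0 ≤ r) :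
    HomologicalComplex (ModuleCat.{v} R) (ComplexShape.spectralSequenceNat ⟨r, 1 - r⟩) where
  X a := ModuleCat.of R (K.Pg r.toNat a.1 a.2)
  d a b := open Classical in
    if h : (ComplexShape.spectralSequenceNat ⟨r, 1 - r⟩).Rel a b then
      ModuleCat.ofHom (dPg (by simp at h; omega) (by simp at h; omega)) else 0
  shape a b h := dif_neg h
  d_comp_d' a b c h h' := by
    rw [dif_pos h, dif_pos h']
    refine ModuleCat.hom_ext (LinearMap.ext fun x => ?_)
    obtain ⟨z, rfl⟩ := Submodule.mkQ_surjective _ x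
    refine (Submodule.Quotient.mk_eq_zero _).2 ?_
    change K.D (K.D z.1) ∈ K.B _ _ _
    rw [D_D]
    exact zero_mem _

theorem pageComplex_d {r : ℤ} (hr : 0 ≤ r) {n p q p' q' : ℕ} (hn : r.toNat = n)
    (hp : p + n = p') (hq : q + 1 = q' + n) :
    ((K.pageComplex r hr).d (p, q) (p', q')).hom = dPg (by omega) (by omega) := by
  have h : (ComplexShape.spectralSequenceNat ⟨r, 1 - r⟩).Rel (p, q) (p', q') := by
    simp
    omega
  simp only [pageComplex]
  rw [dif_pos h]
  rfl

/-- Z_{r+1} maps onto the d_r-cycles of E_r, and the preimage of the d_r-boundaries is B_{r+1};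
`exists_homology_iso` turns this into H(E_r) ≅ E_{r+1}. -/
theorem exists_page_iso (r r' : ℤ) (a : ℕ × ℕ) (hr : 0 ≤ r) (hrr' : r + 1 = r') :
    ∃ e : (K.pageComplex r hr).homology a ≅ (K.pageComplex r' (by omega)).X a,
      ∀ (x : (K.pageComplex r hr).cycles a) (z : K.Z r'.toNat a.1 a.2),
        (K.pageComplex r hr).iCycles a x =
          Submodule.mkQ _ ⟨z.1, Z_anti (by omega) z.2⟩ →
        e.hom ((K.pageComplex r hr).homologyπ a x) = Submodule.mkQ _ z := by
  obtain ⟨p, q⟩ := a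
  obtain ⟨n, hn⟩ : ∃ n, n = r.toNat := ⟨_, rfl⟩
  have hn' : r'.toNat = n + 1 := by omega
  refine exists_homology_iso (Z := K.Z r'.toNat p q) (K.pageComplex r hr) (p, q)
    ((Submodule.mkQ ((K.B r.toNat p q).submoduleOf (K.Z r.toNat p q))).comp
      (Submodule.inclusion fun x hx => Z_anti (by omega) hx))
    ((K.B r'.toNat p q).submoduleOf (K.Z r'.toNat p q)) ?_ ?_ ?_
  · rintro ⟨p', q'⟩ z
    by_cases h : (ComplexShape.spectralSequenceNat ⟨r, 1 - r⟩).Rel (p, q) (p', q')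
    · simp only [ComplexShape.spectralSequenceNat_rel_iff] at h
      have := K.pageComplex_d hr hn.symm (p := p) (q := q) (p' := p') (q' := q') (by omega)
        (by omega)
      refine (DFunLike.congr_fun this _).trans ((Submodule.Quotient.mk_eq_zero _).2 ?_)
      have hz := mem_Z.1 z.2
      have h1 := D_mem_deg hz.1
      rw [show p + q + 1 = p' + q' by omega] at h1
      refine mem_B_of_mem_fil h1 (fil_anti (by dsimp only; omega) hz.2.2) ?_
      change K.D (K.D _) ∈ _
      rw [D_D]
      exact zero_mem _
    · rw [(K.pageComplex r hr).shape _ _ h]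
      rfl
  · intro x hx
    obtain ⟨z, rfl⟩ := Submodule.mkQ_surjective _ x
    -- For n ≤ q + 1 the differential ends at (p + n, q + 1 − n); otherwise its target is outside
    -- the quadrant and already D z = 0.
    by_cases h : n ≤ q + 1
    · have := K.pageComplex_d hr hn.symm (p := p) (q := q) (p' := p + n) (q' := q + 1 - n) rfl
        (by omega)
      have h0 := (DFunLike.congr_fun this _).symm.trans (hx (p + n, q + 1 - n))
      have h1 := (Submodule.Quotient.mk_eq_zero _).1 h0
      obtain ⟨y, hy, hy'⟩ := sub_mem_Z_of_D_mem_B (by omega) (by omega) z.2 h1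
      refine ⟨⟨y, by rw [hn', hn]; exact hy⟩, ?_⟩
      refine (Submodule.Quotient.eq _).2 ?_
      change y - z.1 ∈ K.B _ _ _
      rw [← neg_sub]
      exact neg_mem hy'
    · have h0 : K.D z.1 = 0 := mem_Z_succ_of_lt (by dsimp only; omega) z.2
      have hz := mem_Z.1 z.2
      refine ⟨⟨z.1, mem_Z.2 ⟨hz.1, hz.2.1, by rw [h0]; exact zero_mem _⟩⟩, rfl⟩
  · intro z
    have hN : r'.toNat = r.toNat + 1 := by omega
    have hzZ : z.1 ∈ K.Z (r.toNat + 1) p q := hN ▸ z.2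
    have hzB : z ∈ (K.B r'.toNat p q).submoduleOf (K.Z r'.toNat p q) ↔
        z.1 ∈ K.B (r.toNat + 1) p q := by
      rw [← hN]
      rfl
    rw [hzB]
    -- This says that the source (p − n, q + n − 1) lies in the quadrant; the second condition fails
    -- only for q = n = 0.
    by_cases h : n ≤ p ∧ 1 ≤ q + n
    · have hrel : (ComplexShape.spectralSequenceNat ⟨r, 1 - r⟩).Rel (p - n, q + n - 1) (p, q) := by
        simp
        omega
      rw [ComplexShape.prev_eq' _ hrel]
      have hd := K.pageComplex_d hr hn.symm (p := p - n) (q := q + n - 1) (p' := p) (q' := q)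
        (by omega) (by omega)
      constructor
      · intro hz
        obtain ⟨y, hy, hy'⟩ := exists_of_mem_B_succ (K := K) (r := r.toNat) (p := p) (q := q)
          (p₀ := p - n) (q₀ := q + n - 1) (by omega) (by omega)
          hzZ hz
        refine ⟨Submodule.mkQ _ ⟨y, hy⟩, (DFunLike.congr_fun hd _).trans ?_⟩
        refine (Submodule.Quotient.eq _).2 ?_
        change K.D y - z.1 ∈ K.B _ _ _
        rw [← neg_sub]
        exact neg_mem hy'
      · rintro ⟨y, hy⟩
        obtain ⟨y, rfl⟩ := Submodule.mkQ_surjective _ y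
        have h1 := (Submodule.Quotient.eq _).1 ((DFunLike.congr_fun hd _).symm.trans hy)
        change K.D y.1 - z.1 ∈ K.B _ _ _ at h1
        rw [← neg_mem_iff, neg_sub] at h1
        exact mem_B_succ_of_sub (p₀ := p - n) (q₀ := q + n - 1) (by omega) (by omega) hzZ y.2 h1
    · have hrel : ∀ b, ¬ (ComplexShape.spectralSequenceNat ⟨r, 1 - r⟩).Rel b (p, q) := by
        intro b
        simp
        omega
      rw [(K.pageComplex r hr).shape _ _ (hrel _)]
      constructor
      · intro hz
        refine ⟨0, ((Submodule.Quotient.mk_eq_zero _).2 ?_).symm⟩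
        exact mem_B_of_mem_B_succ (by omega) hz
      · rintro ⟨y, hy⟩
        have h1 := (Submodule.Quotient.mk_eq_zero _).1 hy.symm
        exact mem_B_succ_of_mem_B hzZ h1

/-- The spectral sequence of a double complex. -/
noncomputable def spectralSeq : K.SpectralSeq where
  E :=
    { page := fun r hr => K.pageComplex r hr
      iso := fun r r' a h hr => (K.exists_page_iso r r' a hr h).choose }
  π r p q := Submodule.mkQ _
  π_surjective r p q := Submodule.mkQ_surjective _
  π_eq_zero_iff r p q z := Submodule.Quotient.mk_eq_zero _
  d_π r p q p' q' hp hq z z' h := by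
    refine (DFunLike.congr_fun (K.pageComplex_d (by omega) (Int.toNat_natCast r) hp hq) _).trans ?_
    exact congrArg _ (Subtype.ext h.symm)
  iso_π r p q z z' h c hc := by
    refine (K.exists_page_iso r (r + 1 : ℕ) (p, q) (by omega) (by simp)).choose_spec c z' ?_
    rw [hc]
    exact congrArg _ (Subtype.ext h.symm)

end SnDoubleComplex

/-! ### Convergence to the cohomology of the total complex. -/

namespace SnDoubleComplex

variable {R : Type w} [NormedRing R] {K : SnDoubleComplex.{v} R}

/-- The cocycles of degree `n` of the total complex. -/
def cocyc (K : SnDoubleComplex.{v} R) (n : ℕ) : Submodule R K.Fam := K.deg n ⊓ LinearMap.ker K.D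

theorem mem_cocyc {n : ℕ} {x : K.Fam} : x ∈ K.cocyc n ↔ x ∈ K.deg n ∧ K.D x = 0 := by
  simp [cocyc]

theorem Z_le_cocyc {r p q : ℕ} (h : q + 1 < r) : K.Z r p q ≤ K.cocyc (p + q) := fun _ hx =>
  mem_cocyc.2 ⟨(mem_Z.1 hx).1, mem_Z_succ_of_lt h hx⟩

/-- The spectral sequence converges to `H` if `H` is identified with the cohomology of the total
complex. -/
theorem SpectralSeq.convergesTo_of_total (S : K.SpectralSeq) (H : ℕ → SnMod.{v} R)
    (ρ : ∀ n, K.cocyc n →ₗ[R] H n) (hsurj : ∀ n, Function.Surjective (ρ n))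
    (hker : ∀ n x, ρ n x = 0 ↔ ∃ y, K.D y = x.1) : S.ConvergesTo H := by
  let F : (n : ℕ) → ℕ → Submodule R (H n) := fun n s =>
    ((K.fil s).submoduleOf (K.cocyc n)).map (ρ n)
  have memF {n s : ℕ} {y : H n} : y ∈ F n s ↔ ∃ x, x.1 ∈ K.fil s ∧ ρ n x = y := Iff.rfl
  refine ⟨F, ?_, ?_, ?_, ?_⟩
  · rintro n s t h _ ⟨x, hx, rfl⟩
    exact ⟨x, fil_anti h hx, rfl⟩
  · intro n
    rw [eq_top_iff]
    intro y _
    obtain ⟨x, rfl⟩ := hsurj n y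
    exact ⟨x, mem_fil_zero _, rfl⟩
  · intro n
    rw [eq_bot_iff]
    rintro _ ⟨x, hx, rfl⟩
    have : x = 0 := Subtype.ext (eq_zero_of_mem_deg_fil (Nat.lt_succ_self n)
      (mem_cocyc.1 x.2).1 hx)
    rw [this, map_zero]
    exact zero_mem _
  · intro p q r hp hq
    let j : K.Z r p q →ₗ[R] F (p + q) p :=
      (ρ (p + q) ∘ₗ Submodule.inclusion (Z_le_cocyc hq)).codRestrict _ fun z =>
        ⟨Submodule.inclusion (Z_le_cocyc hq) z, (mem_Z.1 z.2).2.1, rfl⟩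
    let θ := ((F (p + q) (p + 1)).submoduleOf (F (p + q) p)).mkQ ∘ₗ j
    have hθ : Function.Surjective θ := by
      intro y
      obtain ⟨⟨_, x, hx, rfl⟩, rfl⟩ := Submodule.mkQ_surjective _ y
      obtain ⟨h1, h2⟩ := mem_cocyc.1 x.2
      exact ⟨⟨x.1, mem_Z.2 ⟨h1, hx, by rw [h2]; exact zero_mem _⟩⟩, rfl⟩
    -- As r > q + 1, all r-cycles are total cocycles. As r > p, the filtration index p + 1 − r
    -- truncates to 0, so B_r admits every primitive. Hence E_r and the graded piece are quotients
    -- of Z_r by the same kernel.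
    have hk : LinearMap.ker θ = LinearMap.ker (S.π r p q) := by
      ext z
      rw [LinearMap.mem_ker, LinearMap.mem_ker, S.π_eq_zero_iff]
      refine (Submodule.Quotient.mk_eq_zero _).trans ?_
      have hz := mem_Z.1 z.2
      have hz0 := mem_Z_succ_of_lt hq z.2
      constructor
      · rintro ⟨x, hx, e⟩
        obtain ⟨y, hy⟩ := (hker _ (Submodule.inclusion (Z_le_cocyc hq) z - x)).1
          (by rw [map_sub, sub_eq_zero]; exact e.symm)
        obtain ⟨h1, h2⟩ := mem_cocyc.1 x.2
        have hy' : K.D y = z.1 - x.1 := hy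
        refine mem_B.2 ⟨x.1, y, h1, hx, by rw [h2]; exact zero_mem _, ?_, ?_, ?_, ?_⟩
        · rw [show p + 1 - r = 0 by omega]
          exact mem_fil_zero y
        · rw [hy']
          exact sub_mem hz.1 h1
        · rw [hy']
          exact sub_mem hz.2.1 (fil_anti (Nat.le_succ p) hx)
        · rw [hy', add_sub_cancel]
      · intro hB
        obtain ⟨a, b, ha, ha', ha'', hb, hb', hb'', e⟩ := mem_B.1 hB
        have hDa : K.D a = 0 := by
          have : K.D a = K.D z.1 := by rw [← e, map_add, D_D, add_zero]
          rw [this, hz0]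
        refine ⟨⟨a, mem_cocyc.2 ⟨ha, hDa⟩⟩, ha', ?_⟩
        refine Eq.symm ?_
        rw [← sub_eq_zero]
        change ρ _ (Submodule.inclusion (Z_le_cocyc hq) z) - _ = 0
        rw [← map_sub, hker]
        refine ⟨b, ?_⟩
        change _ = z.1 - a
        rw [← e, add_sub_cancel_left]
    exact ⟨((S.π r p q).quotKerEquivOfSurjective (S.π_surjective r p q)).symm.trans
      ((Submodule.quotEquivOfEq _ _ hk.symm).trans (θ.quotKerEquivOfSurjective hθ))⟩

/-! ### The second page -/

/-- The family with the single entry `a` in bidegree `(p, q)`. -/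
def single (p q : ℕ) (a : K.X p q) : K.Fam := Pi.single p (Pi.single q a)

theorem single_same (p q : ℕ) (a : K.X p q) : single p q a p q = a := by simp [single]

theorem single_of_ne {p q p' q' : ℕ} (a : K.X p q) (h : p' ≠ p ∨ q' ≠ q) :
    single p q a p' q' = 0 := by
  by_cases hp : p' = p
  · subst hp
    simp [single, h.resolve_left (by simp)]
  · simp [single, hp]

theorem single_mem_fil (p q : ℕ) (a : K.X p q) : single p q a ∈ K.fil p :=
  fun _ _ h => single_of_ne a (Or.inl h.ne)

theorem single_mem_deg (p q : ℕ) (a : K.X p q) : single p q a ∈ K.deg (p + q) :=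
  fun p' q' h => single_of_ne a (by omega)

/-- The family whose only entry is that of `b` in bidegree `(p, q - 1)` if `q ≥ 1`. -/
def below (p q : ℕ) (b : K.Fam) : K.Fam :=
  match q with
  | 0 => 0
  | q + 1 => single p q (b p q)

theorem below_mem_fil (p q : ℕ) (b : K.Fam) : below p q b ∈ K.fil p := by
  cases q with
  | zero => exact zero_mem _
  | succ q => exact single_mem_fil _ _ _

theorem intoV_below (p q : ℕ) (b : K.Fam) : K.intoV p q (below p q b) = K.intoV p q b := by
  cases q with
  | zero => rfl
  | succ q => simp [below, single_same]

theorem intoV_below_of_ne {p q q' : ℕ} (b : K.Fam) (h : q' ≠ q) :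
    K.intoV p q' (below p q b) = 0 := by
  refine intoV_eq_zero fun k hk => ?_
  cases q with
  | zero => rfl
  | succ q => exact single_of_ne _ (by omega)

theorem below_mem_deg (p q : ℕ) (b : K.Fam) {n : ℕ} (hn : p + q = n + 1) :
    below p q b ∈ K.deg n := by
  cases q with
  | zero => exact zero_mem _
  | succ q =>
    obtain rfl : n = p + q := by omega
    exact single_mem_deg _ _ _

theorem D_below_mem_deg (p q : ℕ) (b : K.Fam) : K.D (below p q b) ∈ K.deg (p + q) := by
  cases q with
  | zero => simp [below]
  | succ q => exact D_mem_deg (single_mem_deg p q (b p q))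

theorem intoH_eq_zero_of_mem_fil {x : K.Fam} {p q : ℕ} (h : x ∈ K.fil p) : K.intoH p q x = 0 :=
  intoH_eq_zero fun p' hp => h p' q (by omega)

theorem SpectralSeq.pageNorm_le (S : K.SpectralSeq) {r p q : ℕ} (z : K.Z r p q) :
    S.pageNorm r p q (S.π r p q z) ≤ ‖z.1 p q‖ :=
  csInf_le ⟨0, by rintro _ ⟨_, _, rfl⟩; exact norm_nonneg _⟩ ⟨z, rfl, rfl⟩

theorem SpectralSeq.le_pageNorm (S : K.SpectralSeq) {r p q : ℕ} {ξ : S.page r p q} {c : ℝ}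
    (h : ∀ z : K.Z r p q, S.π r p q z = ξ → c ≤ ‖z.1 p q‖) : c ≤ S.pageNorm r p q ξ := by
  refine le_csInf ?_ ?_
  · obtain ⟨z, hz⟩ := S.π_surjective r p q ξ
    exact ⟨_, z, hz, rfl⟩
  · rintro _ ⟨z, hz, rfl⟩
    exact h z hz

theorem apply_mem_ker_dv {p q : ℕ} {x : K.Fam} (h : x ∈ K.fil p) (h' : K.D x ∈ K.fil (p + 1)) :
    K.dv p q (x p q) = 0 := by
  have := h' p (q + 1) (Nat.lt_succ_self p)
  rwa [D_apply, intoH_eq_zero_of_mem_fil h, zero_add] at this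

theorem dh_mem_ker_dv {p q : ℕ} {a : K.X p q} (h : K.dv p q a = 0) :
    K.dv (p + 1) q (K.dh p q a) = 0 := by
  have := K.dv_dh p q a
  rwa [h, map_zero, add_zero] at this

/-- The second page is computed by a complex `L` with norm non-increasing maps `Φ` from the vertical
cocycles to `L` which are compatible with the differentials, vanish on the vertical coboundaries,
admit almost isometric lifts and are injective modulo the vertical coboundaries. -/
theorem SpectralSeq.exists_page_two_equiv (S : K.SpectralSeq) (L : SnComplex.{v} R) (p q : ℕ)
    (Φ : ∀ n, LinearMap.ker (K.dv n q) →ₗ[R] L.X n)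
    (hnorm : ∀ n a, ‖Φ n a‖ ≤ ‖a.1‖)
    (hcob : ∀ n a, (∃ x : K.Fam, K.intoV n q x = a.1) → Φ n a = 0)
    (hδ : ∀ n a a', a'.1 = K.dh n q a.1 → L.d n (Φ n a) = Φ (n + 1) a')
    (hlift : ∀ n ψ (ε : ℝ), 0 < ε → ∃ a, Φ n a = ψ ∧ ‖a.1‖ ≤ ‖ψ‖ + ε)
    (hinj : ∀ n a, n = p ∨ n = p + 1 → Φ n a = 0 → ∃ x : K.Fam, K.intoV n q x = a.1) :
    ∃ e : S.page 2 p q ≃ₗ[R] L.H p, ∀ ξ, ‖e ξ‖ = S.pageNorm 2 p q ξ := by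
  have hZ (z : K.Z 2 p q) : z.1 p q ∈ LinearMap.ker (K.dv p q) := by
    obtain ⟨-, h2, h3⟩ := mem_Z.1 z.2
    exact apply_mem_ker_dv h2 (fil_anti (by omega) h3)
  let lead : K.Z 2 p q →ₗ[R] LinearMap.ker (K.dv p q) :=
    { toFun := fun z => ⟨z.1 p q, hZ z⟩
      map_add' := fun _ _ => rfl
      map_smul' := fun _ _ => rfl }
  have hker (z : K.Z 2 p q) : L.d p (Φ p (lead z)) = 0 := by
    obtain ⟨-, h2, h3⟩ := mem_Z.1 z.2
    have h4 : K.dh p q (z.1 p q) = K.intoV (p + 1) q (-z.1) := by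
      have := h3 (p + 1) q (by omega)
      rw [D_apply, intoH_succ] at this
      rw [map_neg, ← sub_eq_zero, sub_neg_eq_add, this]
    rw [hδ p (lead z) ⟨K.dh p q (z.1 p q), dh_mem_ker_dv (hZ z)⟩ rfl]
    exact hcob _ _ ⟨_, h4.symm⟩
  let Ψ : K.Z 2 p q →ₗ[R] L.H p := L.cls p ∘ₗ (Φ p ∘ₗ lead).codRestrict _ hker
  have hΨ (z : K.Z 2 p q) : Ψ z = L.cls p ⟨Φ p (lead z), hker z⟩ := rfl
  have hΨn (z : K.Z 2 p q) : ‖Ψ z‖ ≤ ‖z.1 p q‖ :=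
    (SnComplex.norm_cls_le _ _).trans (hnorm p (lead z))
  -- A lift a of a cocycle is only vertically closed, but d_h a is killed by Φ and so is a vertical
  -- coboundary. Subtracting its primitive in column p + 1 makes the total differential vanish up to
  -- column p + 1, without touching the leading entry a or its norm.
  have hsurj (η : L.H p) (ε : ℝ) (hε : 0 < ε) : ∃ z, Ψ z = η ∧ ‖z.1 p q‖ ≤ ‖η‖ + ε := by
    obtain ⟨ψ, rfl, hψ⟩ := L.exists_cls_eq_norm_lt p η (half_pos hε)
    obtain ⟨a, ha, hna⟩ := hlift p ψ.1 (ε / 2) (half_pos hε)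
    obtain ⟨c, hc⟩ := hinj (p + 1) ⟨K.dh p q a.1, dh_mem_ker_dv a.2⟩ (Or.inr rfl) (by
      rw [← hδ p a _ rfl, ha]
      exact ψ.2)
    have hne : (single p q a.1 - below (p + 1) q c) p q = a.1 := by
      rw [Pi.sub_apply, Pi.sub_apply, single_same,
        below_mem_fil (p + 1) q c p q (Nat.lt_succ_self p), sub_zero]
    have hz : single p q a.1 - below (p + 1) q c ∈ K.Z 2 p q := by
      refine mem_Z.2 ⟨sub_mem (single_mem_deg _ _ _) (below_mem_deg _ _ _ (by omega)),
        sub_mem (single_mem_fil _ _ _) (fil_anti (Nat.le_succ p) (below_mem_fil _ _ _)), ?_⟩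
      intro p' q' hp'
      rw [map_sub, Pi.sub_apply, Pi.sub_apply, D_apply, D_apply]
      have hb := below_mem_fil (p + 1) q c
      rcases Nat.lt_trichotomy p' p with h | rfl | h
      · rw [intoH_eq_zero fun k hk => single_of_ne _ (by omega),
          intoV_eq_zero fun k hk => single_of_ne _ (by omega),
          intoH_eq_zero fun k hk => hb _ _ (by omega),
          intoV_eq_zero fun k hk => hb _ _ (by omega)]
        simp
      · rw [intoH_eq_zero fun k hk => single_of_ne _ (by omega),
          intoH_eq_zero fun k hk => hb _ _ (by omega),
          intoV_eq_zero (x := below _ _ _) fun k hk => hb _ _ (by omega)]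
        simp only [zero_add, sub_zero]
        cases q' with
        | zero => rfl
        | succ q' =>
          by_cases hq : q' = q
          · subst hq
            rw [intoV_succ, single_same]
            exact a.2
          · rw [intoV_succ, single_of_ne _ (Or.inr hq), map_zero]
      · obtain rfl : p' = p + 1 := by omega
        rw [intoV_eq_zero (x := single _ _ _) fun k hk => single_of_ne _ (by omega),
          intoH_eq_zero (x := below _ _ _) fun k hk => hb _ _ (by omega), add_zero, zero_add,
          intoH_succ]
        by_cases hq : q' = q
        · subst hq
          rw [single_same, intoV_below, hc, sub_self]
        · rw [single_of_ne _ (Or.inr hq), map_zero, intoV_below_of_ne _ hq, sub_zero]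
    have hl : lead ⟨_, hz⟩ = a := Subtype.ext hne
    refine ⟨⟨_, hz⟩, ?_, ?_⟩
    · rw [hΨ]
      congr 1
      exact Subtype.ext ((congrArg (Φ p) hl).trans ha)
    · change ‖(single p q a.1 - below (p + 1) q c) p q‖ ≤ _
      rw [hne]
      linarith
  have hkerΨ : LinearMap.ker Ψ = LinearMap.ker (S.π 2 p q) := by
    ext z
    rw [LinearMap.mem_ker, LinearMap.mem_ker, S.π_eq_zero_iff, hΨ, SnComplex.cls_eq_zero_iff]
    obtain ⟨hz1, hz2, hz3⟩ := mem_Z.1 z.2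
    constructor
    · intro h
      -- Modulo B_2 only the leading entry of z counts: if D w has the same one, then z − D w has
      -- filtration p + 1. The index p − 1 is p + 1 − 2, truncated at 0.
      suffices hw : ∃ w ∈ K.fil (p - 1), K.D w ∈ K.fil p ∧ K.D w ∈ K.deg (p + q) ∧
          K.D w p q = z.1 p q by
        obtain ⟨w, h1, h2, h3, h4⟩ := hw
        refine mem_B.2 ⟨z.1 - K.D w, w, sub_mem hz1 h3, ?_, by rwa [map_sub, D_D, sub_zero],
          h1, h3, h2, by rw [sub_add_cancel]⟩
        intro p' q' hp'
        rcases (Nat.lt_succ_iff.1 hp').lt_or_eq with hp | rfl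
        · exact sub_mem hz2 h2 p' q' hp
        · by_cases hq : q' = q
          · subst hq
            rw [Pi.sub_apply, Pi.sub_apply, h4, sub_self]
          · exact sub_mem hz1 h3 p' q' (by omega)
      have hbelow (b : K.Fam) : K.D (below p q b) p q = K.intoV p q b := by
        rw [D_apply, intoH_eq_zero_of_mem_fil (below_mem_fil p q b), zero_add, intoV_below]
      cases p with
      | zero =>
        obtain ⟨b, hb⟩ := hinj 0 (lead z) (Or.inl rfl) (SnComplex.mem_cobound_zero.1 h)
        refine ⟨below 0 q b, below_mem_fil _ _ _, mem_fil_zero _, D_below_mem_deg _ _ _, ?_⟩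
        exact (hbelow b).trans hb
      | succ p =>
        obtain ⟨ψ, hψ⟩ := SnComplex.mem_cobound_succ.1 h
        obtain ⟨a, ha, -⟩ := hlift p ψ 1 one_pos
        have hs1 : K.D (single p q a.1) ∈ K.fil (p + 1) := by
          intro p' q' hp'
          rw [D_apply, intoH_eq_zero fun k hk => single_of_ne _ (by omega), zero_add]
          cases q' with
          | zero => rfl
          | succ q' =>
            rw [intoV_succ]
            by_cases hpq : p' = p ∧ q' = q
            · obtain ⟨rfl, rfl⟩ := hpq
              rw [single_same]
              exact a.2
            · rw [single_of_ne _ (by omega), map_zero]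
        have hs2 : K.D (single p q a.1) (p + 1) q = K.dh p q a.1 := by
          rw [D_apply, intoV_eq_zero fun k hk => single_of_ne _ (by omega), add_zero, intoH_succ,
            single_same]
        have hs3 := D_mem_deg (single_mem_deg p q a.1)
        rw [show p + q + 1 = p + 1 + q by omega] at hs3
        -- The leading entry of z and d_h a have the same image under Φ, so they differ by a
        -- vertical coboundary.
        obtain ⟨b, hb⟩ := hinj (p + 1) (lead z - ⟨K.dh p q a.1, dh_mem_ker_dv a.2⟩)
          (Or.inl rfl) (by
            rw [map_sub, ← hδ p a ⟨_, dh_mem_ker_dv a.2⟩ rfl, ha, sub_eq_zero]; exact hψ.symm)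
        refine ⟨single p q a.1 + below (p + 1) q b, add_mem (single_mem_fil _ _ _)
          (fil_anti (by omega) (below_mem_fil _ _ _)), ?_, ?_, ?_⟩
        · rw [map_add]
          exact add_mem hs1 (D_mem_fil (below_mem_fil _ _ _))
        · rw [map_add]
          exact add_mem hs3 (D_below_mem_deg _ _ _)
        · rw [map_add, Pi.add_apply, Pi.add_apply, hs2, hbelow, hb]
          exact add_sub_cancel _ _
    · intro hB
      obtain ⟨a, b, ha, ha', ha'', hb, hb', hb'', e⟩ := mem_B.1 hB
      have hzD : z.1 p q = K.intoH p q b + K.intoV p q b := by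
        rw [← e, Pi.add_apply, Pi.add_apply, ha' p q (Nat.lt_succ_self p), zero_add]
        rfl
      cases p with
      | zero =>
        rw [SnComplex.mem_cobound_zero]
        exact hcob _ _ ⟨b, by rw [intoH_zero, zero_add] at hzD; exact hzD.symm⟩
      | succ p =>
        rw [intoH_succ] at hzD
        -- Here b ∈ F^p and D b ∈ F^{p+1}, so the leading entry of b is vertically closed and Φ
        -- applies to it.
        have hbk : K.dv p q (b p q) = 0 := by
          refine apply_mem_ker_dv (by simpa using hb) hb''
        refine SnComplex.mem_cobound_succ.2 ⟨Φ p ⟨b p q, hbk⟩, ?_⟩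
        rw [hδ p _ ⟨K.dh p q (b p q), dh_mem_ker_dv hbk⟩ rfl, ← sub_eq_zero, ← map_sub, ← neg_eq_zero,
          ← map_neg]
        refine hcob _ _ ⟨b, ?_⟩
        change _ = -(K.dh p q (b p q) - z.1 (p + 1) q)
        rw [hzD]
        abel
  have hΨs : Function.Surjective Ψ := fun η => by
    obtain ⟨z, hz, -⟩ := hsurj η 1 one_pos
    exact ⟨z, hz⟩
  let e : S.page 2 p q ≃ₗ[R] L.H p :=
    ((S.π 2 p q).quotKerEquivOfSurjective (S.π_surjective 2 p q)).symm.trans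
      ((Submodule.quotEquivOfEq _ _ hkerΨ.symm).trans (Ψ.quotKerEquivOfSurjective hΨs))
  have he (z : K.Z 2 p q) : e (S.π 2 p q z) = Ψ z := by
    have : ((S.π 2 p q).quotKerEquivOfSurjective (S.π_surjective 2 p q)).symm (S.π 2 p q z) =
        (LinearMap.ker (S.π 2 p q)).mkQ z := (LinearEquiv.symm_apply_eq _).2 rfl
    simp only [e, LinearEquiv.trans_apply]
    rw [this]
    rfl
  refine ⟨e, fun ξ => le_antisymm ?_ ?_⟩
  · refine S.le_pageNorm fun z hz => ?_
    rw [← hz, he]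
    exact hΨn z
  · refine le_of_forall_pos_le_add fun ε hε => ?_
    obtain ⟨z, hz, hzn⟩ := hsurj (e ξ) ε hε
    have : ξ = S.π 2 p q z := e.injective (by rw [he, hz])
    conv_lhs => rw [this]
    exact (S.pageNorm_le z).trans hzn

end SnDoubleComplex

/-! ### Cones and canonical paths -/

open SSet

/-- A cone structure on a simplicial set: a vertex, edges from it to all vertices, and triangles
on all edges. -/
class Coned (K : SSet.{u}) where
  pt : K _⦋0⦌
  e (x : K _⦋0⦌) : Edge pt x
  tri {x y : K _⦋0⦌} (f : Edge x y) : Edge.CompStruct (e x) f (e y)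

theorem vtx_obj₀Equiv {n : ℕ} (x : (Δ[n] : SSet.{u}) _⦋0⦌) :
    vtx n (SSet.stdSimplex.obj₀Equiv x) = x := Equiv.symm_apply_apply _ _

theorem le_of_edge {n : ℕ} {x y : (Δ[n] : SSet.{u}) _⦋0⦌} (f : Edge x y) : x 0 ≤ y 0 := by
  have h0 : f.edge 0 = x 0 := DFunLike.congr_fun f.src_eq 0
  have h1 : f.edge 1 = y 0 := DFunLike.congr_fun f.tgt_eq 0
  exact (h0.symm.le.trans (SSet.stdSimplex.monotone_apply f.edge (Fin.zero_le _))).trans h1.le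

theorem stdSimplex_edge_ext {n : ℕ} {x y : (Δ[n] : SSet.{u}) _⦋0⦌} (f g : Edge x y) : f = g := by
  have h0 : ∀ f : Edge x y, f.edge 0 = x 0 := fun f => DFunLike.congr_fun f.src_eq 0
  have h1 : ∀ f : Edge x y, f.edge 1 = y 0 := fun f => DFunLike.congr_fun f.tgt_eq 0
  ext k
  fin_cases k
  · exact congrArg Fin.val ((h0 f).trans (h0 g).symm)
  · exact congrArg Fin.val ((h1 f).trans (h1 g).symm)

/-- Vertex 0 precedes all others, and an edge of Δ[n] is determined by its ends, so the triangle on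
three vertices has the prescribed faces. -/
instance (n : ℕ) : Coned (Δ[n] : SSet.{u}) where
  pt := vtx n 0
  e x := (stdEdge 0 (x 0) (Fin.zero_le _)).ofEq rfl (vtx_obj₀Equiv x)
  tri {x y} f := (stdTriangle 0 (x 0) (y 0) (Fin.zero_le _) (le_of_edge f)).ofEq rfl
    (congrArg Edge.edge (stdSimplex_edge_ext ((stdEdge (x 0) (y 0) (le_of_edge f)).ofEq
      (vtx_obj₀Equiv x) (vtx_obj₀Equiv y)) f)) rfl

instance (K L : SSet.{u}) [Coned K] [Coned L] : Coned (K ⊗ L) where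
  pt := (Coned.pt, Coned.pt)
  e x := prodEdge (Coned.e x.1) (Coned.e x.2)
  tri f := prodTriangle (Coned.tri (f.map (fst K L))) (Coned.tri (f.map (snd K L)))

section Paths

variable {K K' X : SSet.{u}} [Coned K] [Coned K']

/-- The canonical path between the images of two vertices of a coned simplicial set. -/
noncomputable def tr (a : K ⟶ X) (x y : K _⦋0⦌) : FundGrpd.pt (a.app _ x) ⟶ FundGrpd.pt (a.app _ y) :=
  inv (FundGrpd.edge ((Coned.e x).map a)) ≫ FundGrpd.edge ((Coned.e y).map a)

@[simp] theorem tr_self (a : K ⟶ X) (x : K _⦋0⦌) : tr a x x = 𝟙 _ := by simp [tr]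

theorem tr_comp (a : K ⟶ X) (x y z : K _⦋0⦌) : tr a x y ≫ tr a y z = tr a x z := by simp [tr]

/-- The cone triangle on `e` is exactly this relation in the fundamental groupoid. Together with
`tr_comp` it makes transport inside a coned simplicial set independent of the path. -/
theorem tr_edge (a : K ⟶ X) {x y : K _⦋0⦌} (e : Edge x y) :
    tr a x y = FundGrpd.edge (e.map a) := by
  rw [tr, IsIso.inv_comp_eq]
  exact (FundGrpd.edge_comp ((Coned.tri e).map a)).symm

/-- `θ` need not preserve the cone point; the paths through the image of the cone point cancel. -/
theorem tr_map (θ : K' ⟶ K) (a : K ⟶ X) (x y : K' _⦋0⦌) :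
    tr (θ ≫ a) x y = tr a (θ.app _ x) (θ.app _ y) := by
  have h (x : K' _⦋0⦌) : FundGrpd.edge ((Coned.e x).map (θ ≫ a)) =
      tr a (θ.app _ Coned.pt) (θ.app _ x) := (tr_edge a ((Coned.e x).map θ)).symm
  refine (IsIso.inv_comp_eq _).2 ?_
  exact (h y).trans ((tr_comp a _ _ _).symm.trans (congrArg (· ≫ _) (h x).symm))

theorem inv_edge_eq_tr (a : K ⟶ X) {x y : K _⦋0⦌} (e : Edge x y) :
    inv (FundGrpd.edge (e.map a)) = tr a y x :=
  IsIso.inv_eq_of_hom_inv_id ((congrArg (· ≫ tr a y x) (tr_edge a e).symm).trans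
    ((tr_comp _ _ _ _).trans (tr_self _ _)))

end Paths

/-! ### Evaluation of cochains on maps from coned simplicial sets -/

section Evaluation

variable {R : Type w} [NormedRing R] {P Q X : SSet.{u}} (B : LocalCoeff.{u, v} R Q)
variable {K K' : SSet.{u}} [Coned K] [Coned K']

/-- The value of a cochain on the simplex `θ` of `a : K ⟶ Q`, transported to the vertex `x`. -/
noncomputable def evc {n : ℕ} (φ : Cochain B n) (a : K ⟶ Q) (θ : Δ[n] ⟶ K) (x : K _⦋0⦌) :
    B.at₀ (a.app _ x) :=
  (B.map (tr a (θ.app _ (vtx n 0)) x)).lin (φ.1 (θ ≫ a))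

theorem LocalCoeff.map_lin_comp {a b c : FundGrpd Q} (g : a ⟶ b) (h : b ⟶ c) (x : B.obj a) :
    (B.map h).lin ((B.map g).lin x) = (B.map (g ≫ h)).lin x := by
  rw [B.map_comp]
  rfl

theorem LocalCoeff.map_lin_id {a : FundGrpd Q} (x : B.obj a) : (B.map (𝟙 a)).lin x = x := by
  rw [B.map_id]
  rfl

/-- The transport from σ_{α(0)} back to σ₀ is a canonical path and is absorbed by `tr_comp`.
Evaluated at a fixed vertex, cochain operators thus become plain precomposition, and simplicial
identities need no bookkeeping of coefficients. -/
theorem evc_cochainOp {m n : ℕ} (α : ⦋m⦌ ⟶ ⦋n⦌) (φ : Cochain B m) (a : K ⟶ Q) (θ : Δ[n] ⟶ K)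
    (x : K _⦋0⦌) :
    evc B (cochainOp B α φ) a θ x = evc B φ a (SSet.stdSimplex.map α ≫ θ) x := by
  have h : inv (FundGrpd.edge (opEdge α (θ ≫ a))) =
      tr a (θ.app _ (vtx n (α.toOrderHom 0))) (θ.app _ (vtx n 0)) :=
    (inv_edge_eq_tr (θ ≫ a) (stdEdge 0 (α.toOrderHom 0) (Fin.zero_le _))).trans
      (tr_map θ a (vtx n (α.toOrderHom 0)) (vtx n 0))
  refine (LocalCoeff.map_lin_comp B _ _ (φ.1 (SSet.stdSimplex.map α ≫ θ ≫ a))).trans ?_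
  refine congrArg (fun m => (B.map m).lin (φ.1 (SSet.stdSimplex.map α ≫ θ ≫ a))) ?_
  exact (congrArg (· ≫ tr a (θ.app _ (vtx n 0)) x) h).trans (tr_comp a _ _ _)

end Evaluation

/-! ### The prism identity -/

section Prism

open Finset

/-- Row j is the boundary of the j-th simplex of a prism. Its faces j and j + 1 are the inner faces
u j and u (j + 1), with opposite signs, and telescope over j; the remaining faces come from the
faces of the base, recorded by G. -/
theorem prism_row {M : Type*} [AddCommGroup M] (N : ℕ) (F G : ℕ → ℕ → M) (u : ℕ → M)
    (hlt : ∀ i j, i < j → j ≤ N → F i j = G i (j - 1))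
    (hgt : ∀ i j, j + 1 < i → i ≤ N + 1 → F i j = G (i - 1) j)
    (heq : ∀ j, j ≤ N → F j j = u j) (hsucc : ∀ j, j ≤ N → F (j + 1) j = u (j + 1))
    (j : ℕ) (hj : j ≤ N) :
    ∑ i ∈ range (N + 2), (-1 : ℤ) ^ (i + j) • F i j =
      (∑ i ∈ range j, (-1 : ℤ) ^ (i + j) • G i (j - 1)) + (u j - u (j + 1)) -
        ∑ i ∈ Ico (j + 1) (N + 1), (-1 : ℤ) ^ (i + j) • G i j := by
  have e : N + 2 = (j + 2) + (N - j) := by omega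
  rw [e, sum_range_add, sum_range_succ, sum_range_succ, heq j hj, hsucc j hj,
    sum_Ico_eq_sum_range, show N + 1 - (j + 1) = N - j by omega, sub_eq_add_neg _ (∑ _ ∈ _, _),
    ← sum_neg_distrib]
  rw [show (-1 : ℤ) ^ (j + j) = 1 from Even.neg_one_pow ⟨j, rfl⟩,
    show (-1 : ℤ) ^ (j + 1 + j) = -1 from Odd.neg_one_pow ⟨j, by ring⟩, one_smul, neg_one_smul,
    add_assoc _ (u j), ← sub_eq_add_neg]
  refine congrArg₂ _ (congrArg₂ _ (sum_congr rfl fun i hi => ?_) rfl)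
    (sum_congr rfl fun i hi => ?_)
  · rw [hlt i j (mem_range.1 hi) hj]
  · have hi' := mem_range.1 hi
    rw [hgt _ j (by omega) (by omega), ← neg_smul]
    refine congrArg₂ _ ?_ (congrArg₂ _ (by omega) rfl)
    rw [show j + 2 + i + j = (j + 1 + i + j) + 1 by ring, pow_succ, mul_neg_one]

/-- The alternating sums of a simplicial homotopy. -/
theorem prism_identity {M : Type*} [AddCommGroup M] (N : ℕ) (F G : ℕ → ℕ → M) (u : ℕ → M)
    (hlt : ∀ i j, i < j → j ≤ N → F i j = G i (j - 1))
    (hgt : ∀ i j, j + 1 < i → i ≤ N + 1 → F i j = G (i - 1) j)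
    (heq : ∀ j, j ≤ N → F j j = u j) (hsucc : ∀ j, j ≤ N → F (j + 1) j = u (j + 1)) :
    (∑ j ∈ range (N + 1), ∑ i ∈ range (N + 2), (-1 : ℤ) ^ (i + j) • F i j) +
      ∑ j ∈ range N, ∑ i ∈ range (N + 1), (-1 : ℤ) ^ (i + j) • G i j = u 0 - u (N + 1) := by
  have h1 : ∑ j ∈ range (N + 1), ∑ i ∈ range (N + 2), (-1 : ℤ) ^ (i + j) • F i j =
      ∑ j ∈ range (N + 1), ((∑ i ∈ range j, (-1 : ℤ) ^ (i + j) • G i (j - 1)) +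
        (u j - u (j + 1)) - ∑ i ∈ Ico (j + 1) (N + 1), (-1 : ℤ) ^ (i + j) • G i j) :=
    sum_congr rfl fun j hj =>
      prism_row N F G u hlt hgt heq hsucc j (by have := mem_range.1 hj; omega)
  have h2 : ∑ j ∈ range N, ∑ i ∈ range (N + 1), (-1 : ℤ) ^ (i + j) • G i j =
      ∑ j ∈ range N, ((∑ i ∈ range (j + 1), (-1 : ℤ) ^ (i + j) • G i j) +
        ∑ i ∈ Ico (j + 1) (N + 1), (-1 : ℤ) ^ (i + j) • G i j) :=
    sum_congr rfl fun j hj =>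
      (sum_range_add_sum_Ico _ (by have := mem_range.1 hj; omega)).symm
  -- Shifting j by one produces the sign that cancels these terms against half of the sum over G.
  have h3 : ∑ j ∈ range (N + 1), ∑ i ∈ range j, (-1 : ℤ) ^ (i + j) • G i (j - 1) =
      -∑ j ∈ range N, ∑ i ∈ range (j + 1), (-1 : ℤ) ^ (i + j) • G i j := by
    rw [sum_range_succ', range_zero, sum_empty, add_zero, ← sum_neg_distrib]
    refine sum_congr rfl fun j _ => ?_
    rw [← sum_neg_distrib]
    refine sum_congr rfl fun i _ => ?_
    rw [← add_assoc, pow_succ, mul_neg_one, neg_smul, Nat.add_sub_cancel]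
  have h4 : ∑ j ∈ range (N + 1), ∑ i ∈ Ico (j + 1) (N + 1), (-1 : ℤ) ^ (i + j) • G i j =
      ∑ j ∈ range N, ∑ i ∈ Ico (j + 1) (N + 1), (-1 : ℤ) ^ (i + j) • G i j := by
    rw [sum_range_succ, Ico_self, sum_empty, add_zero]
  rw [h1, h2, sum_sub_distrib, sum_add_distrib, h3, h4, sum_add_distrib, sum_range_sub' u]
  abel

end Prism

theorem altSum_apply {R : Type w} [Ring R] {M N : Type*} [AddCommGroup M] [AddCommGroup N]
    [Module R M] [Module R N] {k : ℕ} (a : Fin k → M →ₗ[R] N) (x : M) :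
    altSum a x = ∑ i : Fin k, (-1 : ℤ) ^ (i : ℕ) • a i x := by
  simp [altSum, LinearMap.sum_apply]

/-! ### Maps between products of standard simplices -/

/-- The operator given by a monotone function on natural numbers. -/
def natOp {a b : ℕ} (f : ℕ → ℕ) (hf : Monotone f) (h : ∀ k ≤ a, f k ≤ b) : ⦋a⦌ ⟶ ⦋b⦌ :=
  SimplexCategory.mkHom
    ⟨fun k => ⟨f k, Nat.lt_succ_of_le (h k (Nat.le_of_lt_succ k.2))⟩, fun _ _ hk => hf hk⟩

theorem stdSimplex_hom_ext {K : SSet.{u}} {c : ℕ} {f g : K ⟶ Δ[c]}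
    (h : ∀ (m : ℕ) (s : K _⦋m⦌) (k : Fin (m + 1)),
      ((f.app _ s : (Δ[c] : SSet.{u}) _⦋m⦌) k : ℕ) = (g.app _ s : (Δ[c] : SSet.{u}) _⦋m⦌) k) :
    f = g := by
  refine NatTrans.ext (funext fun m => ConcreteCategory.hom_ext _ _ fun s => ?_)
  exact SSet.stdSimplex.ext (n := c) (d := m.unop.len) _ _ fun k => Fin.ext (h m.unop.len s k)

/-- The map of simplicial sets given by a monotone function of two variables. -/
def natMap₂ {a b c : ℕ} (g : ℕ → ℕ → ℕ) (hg : ∀ x x' y y', x ≤ x' → y ≤ y' → g x y ≤ g x' y')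
    (h : ∀ x ≤ a, ∀ y ≤ b, g x y ≤ c) : (Δ[a] : SSet.{u}) ⊗ Δ[b] ⟶ Δ[c] where
  app _ := ↾fun s => SSet.stdSimplex.objEquiv.symm (SimplexCategory.mkHom
    ⟨fun k => ⟨g (SSet.stdSimplex.asOrderHom s.1 k) (SSet.stdSimplex.asOrderHom s.2 k),
      Nat.lt_succ_of_le (h _ (Nat.le_of_lt_succ (Fin.is_lt _)) _
        (Nat.le_of_lt_succ (Fin.is_lt _)))⟩,
      fun _ _ hk => hg _ _ _ _ ((SSet.stdSimplex.asOrderHom s.1).monotone hk)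
        ((SSet.stdSimplex.asOrderHom s.2).monotone hk)⟩)
  naturality _ _ _ := rfl

theorem natMap₂_app {a b c : ℕ} (g : ℕ → ℕ → ℕ) (hg) (h : ∀ x ≤ a, ∀ y ≤ b, g x y ≤ c) {m : ℕ}
    (s : ((Δ[a] : SSet.{u}) ⊗ Δ[b]) _⦋m⦌) (k : Fin (m + 1)) :
    (((natMap₂.{u} g hg h).app _ s : (Δ[c] : SSet.{u}) _⦋m⦌) k : ℕ) =
      g ((s.1 : (Δ[a] : SSet.{u}) _⦋m⦌) k) ((s.2 : (Δ[b] : SSet.{u}) _⦋m⦌) k) := rfl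

theorem δ_apply_val {n : ℕ} (i : Fin (n + 2)) (k : Fin (n + 1)) :
    ((SimplexCategory.δ i).toOrderHom k : ℕ) = if (k : ℕ) < i then (k : ℕ) else k + 1 := by
  change ((i.succAbove k : Fin (n + 2)) : ℕ) = _
  rw [Fin.succAbove]
  split_ifs with h1 h2 h2
  · rfl
  · exact absurd h1 h2
  · exact absurd h2 h1
  · rfl

/-! ### Prism decompositions -/

/-- The coface operator `δᵢ`, with a natural number as index. -/
def dOp (n i : ℕ) : ⦋n⦌ ⟶ ⦋n + 1⦌ :=
  natOp (fun k => if k < i then k else k + 1)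
    (fun a b h => by dsimp only; split_ifs <;> omega) (fun k hk => by split_ifs <;> omega)

theorem dOp_eq (n : ℕ) (i : Fin (n + 2)) : dOp n i = SimplexCategory.δ i := by
  refine SimplexCategory.Hom.ext _ _ (OrderHom.ext _ _ (funext fun k => Fin.ext ?_))
  exact (δ_apply_val i k).symm

/-- The codegeneracy operator `σⱼ`, with a natural number as index. -/
def sOp (n j : ℕ) : ⦋n + 1⦌ ⟶ ⦋n⦌ :=
  -- The minimum only makes the operator defined for every natural number j; for j ≤ n it has no
  -- effect.
  natOp (fun k => min n (if k ≤ j then k else k - 1))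
    (fun a b h => by dsimp only; split_ifs <;> omega) (fun k hk => by omega)

/-- The operator `[n] → [1]` sending the `k < j` to `0`. -/
def cutOp (n j : ℕ) : ⦋n⦌ ⟶ ⦋1⦌ :=
  natOp (fun k => if k < j then 0 else 1)
    (fun a b h => by dsimp only; split_ifs <;> omega) (fun k hk => by split_ifs <;> omega)

/-- The `j`-th top-dimensional simplex of `Δ[n] × Δ[1]`. -/
def prismTop (n j : ℕ) : (Δ[n + 1] : SSet.{u}) ⟶ Δ[n] ⊗ Δ[1] :=
  lift (SSet.stdSimplex.map (sOp n j)) (SSet.stdSimplex.map (cutOp (n + 1) (j + 1)))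

/-- The `j`-th inner simplex of `Δ[n] × Δ[1]` projecting to the identity. -/
def prismMid (n j : ℕ) : (Δ[n] : SSet.{u}) ⟶ Δ[n] ⊗ Δ[1] :=
  lift (𝟙 _) (SSet.stdSimplex.map (cutOp n j))

theorem natOp_comp_ext {K : SSet.{u}} {n : ℕ} {f g : K ⟶ Δ[n] ⊗ Δ[1]}
    (h : ∀ (m : ℕ) (s : K _⦋m⦌) (k : Fin (m + 1)),
      (((f.app _ s).1 : (Δ[n] : SSet.{u}) _⦋m⦌) k : ℕ) =
          ((g.app _ s).1 : (Δ[n] : SSet.{u}) _⦋m⦌) k ∧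
        (((f.app _ s).2 : (Δ[1] : SSet.{u}) _⦋m⦌) k : ℕ) =
          ((g.app _ s).2 : (Δ[1] : SSet.{u}) _⦋m⦌) k) : f = g :=
  CartesianMonoidalCategory.hom_ext _ _ (stdSimplex_hom_ext fun m s k => (h m s k).1)
    (stdSimplex_hom_ext fun m s k => (h m s k).2)

theorem prismTop_lt {n i j : ℕ} (h : i < j) (hj : j ≤ n + 1) :
    SSet.stdSimplex.map (dOp (n + 1) i) ≫ prismTop.{u} (n + 1) j =
      prismTop n (j - 1) ≫ SSet.stdSimplex.map (dOp n i) ▷ Δ[1] := by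
  refine natOp_comp_ext fun m s k => ?_
  have hk : (s k : ℕ) < n + 2 := (s k).2
  constructor
  · change min (n + 1) (if (if (s k : ℕ) < i then (s k : ℕ) else s k + 1) ≤ j then
        (if (s k : ℕ) < i then (s k : ℕ) else s k + 1) else
        (if (s k : ℕ) < i then (s k : ℕ) else s k + 1) - 1) =
      if min n (if (s k : ℕ) ≤ j - 1 then (s k : ℕ) else s k - 1) < i then
        min n (if (s k : ℕ) ≤ j - 1 then (s k : ℕ) else s k - 1) else
        min n (if (s k : ℕ) ≤ j - 1 then (s k : ℕ) else s k - 1) + 1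
    split_ifs <;> omega
  · change (if (if (s k : ℕ) < i then (s k : ℕ) else s k + 1) < j + 1 then 0 else 1) =
      if (s k : ℕ) < j - 1 + 1 then 0 else 1
    split_ifs <;> omega

theorem prismTop_gt {n i j : ℕ} (h : j + 1 < i) (hi : i ≤ n + 2) :
    SSet.stdSimplex.map (dOp (n + 1) i) ≫ prismTop.{u} (n + 1) j =
      prismTop n j ≫ SSet.stdSimplex.map (dOp n (i - 1)) ▷ Δ[1] := by
  refine natOp_comp_ext fun m s k => ?_
  have hk : (s k : ℕ) < n + 2 := (s k).2
  constructor
  · change min (n + 1) (if (if (s k : ℕ) < i then (s k : ℕ) else s k + 1) ≤ j then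
        (if (s k : ℕ) < i then (s k : ℕ) else s k + 1) else
        (if (s k : ℕ) < i then (s k : ℕ) else s k + 1) - 1) =
      if min n (if (s k : ℕ) ≤ j then (s k : ℕ) else s k - 1) < i - 1 then
        min n (if (s k : ℕ) ≤ j then (s k : ℕ) else s k - 1) else
        min n (if (s k : ℕ) ≤ j then (s k : ℕ) else s k - 1) + 1
    split_ifs <;> omega
  · change (if (if (s k : ℕ) < i then (s k : ℕ) else s k + 1) < j + 1 then 0 else 1) =
      if (s k : ℕ) < j + 1 then 0 else 1
    split_ifs <;> omega

/-- The simplices j and j + 1 of the prism share the face `prismMid n (j + 1)`, which is why the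
inner faces cancel. -/
theorem prismTop_face {n i j : ℕ} (h : i = j ∨ i = j + 1) (hj : j ≤ n) :
    SSet.stdSimplex.map (dOp n i) ≫ prismTop.{u} n j = prismMid n i := by
  refine natOp_comp_ext fun m s k => ?_
  have hk : (s k : ℕ) < n + 1 := (s k).2
  constructor
  · change min n (if (if (s k : ℕ) < i then (s k : ℕ) else s k + 1) ≤ j then
        (if (s k : ℕ) < i then (s k : ℕ) else s k + 1) else
        (if (s k : ℕ) < i then (s k : ℕ) else s k + 1) - 1) = s k
    split_ifs <;> omega
  · change (if (if (s k : ℕ) < i then (s k : ℕ) else s k + 1) < j + 1 then 0 else 1) =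
      if (s k : ℕ) < i then 0 else 1
    split_ifs <;> omega

/-- A cut at 0 puts all vertices over the end 1, and a cut at n + 1 puts them over the end 0: what
survives of a prism is the difference of its two ends. -/
theorem prismMid_zero (n : ℕ) : prismMid.{u} n 0 = lift (𝟙 _) (SSet.const (vtx 1 1)) :=
  natOp_comp_ext fun _ _ _ => ⟨rfl, rfl⟩

theorem prismMid_last (n : ℕ) : prismMid.{u} n (n + 1) = lift (𝟙 _) (SSet.const (vtx 1 0)) :=
  natOp_comp_ext fun _ s k => ⟨rfl, if_pos (s k).2⟩

/-! ### Transport along equalities -/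

section Transport

variable {R : Type w} [NormedRing R] {P Q X K : SSet.{u}}

theorem edge_map_congr {g g' : K ⟶ X} (h : g = g') {x y : K _⦋0⦌} (e : Edge x y) :
    FundGrpd.edge (e.map g) ≫ eqToHom (congrArg FundGrpd.pt (app_congr h _ y)) =
      eqToHom (congrArg FundGrpd.pt (app_congr h _ x)) ≫ FundGrpd.edge (e.map g') := by
  subst h
  simp

theorem edge_congr {x y x' y' : X _⦋0⦌} (e : Edge x y) (e' : Edge x' y') (hx : x = x')
    (hy : y = y') (h : e.edge = e'.edge) :
    FundGrpd.edge e ≫ eqToHom (congrArg FundGrpd.pt hy) =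
      eqToHom (congrArg FundGrpd.pt hx) ≫ FundGrpd.edge e' := by
  subst hx hy
  obtain rfl : e = e' := Edge.ext h
  simp

theorem tr_congr [Coned K] (a : K ⟶ X) {x y : K _⦋0⦌} (h : x = y) :
    tr a x y = eqToHom (congrArg (fun z => FundGrpd.pt (a.app _ z)) h) := by
  subst h
  exact tr_self a x

variable (B : LocalCoeff.{u, v} R P)

/-- The type of `φ.1 σ` depends on σ, so replacing σ by an equal simplex has to be paid for by an
`eqToHom` in the transporting morphism. -/
theorem cochain_congr {n : ℕ} (φ : Cochain B n) {σ σ' : Δ[n] ⟶ P} (h : σ = σ') {c : FundGrpd P}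
    (g : FundGrpd.pt (vtx₀ σ) ⟶ c) (g' : FundGrpd.pt (vtx₀ σ') ⟶ c)
    (hg : g = eqToHom (congrArg (fun s => FundGrpd.pt (vtx₀ s)) h) ≫ g') :
    (B.map g).lin (φ.1 σ) = (B.map g').lin (φ.1 σ') := by
  subst h
  rw [hg, eqToHom_refl, Category.id_comp]

end Transport

/-! ### Homotopies starting at the identity -/

section Homotopy

variable {R : Type w} [NormedRing R] {P : SSet.{u}} (B : LocalCoeff.{u, v} R P)

/-- The inclusion of `P` at an end of the cylinder. -/
def cylEnd (P : SSet.{u}) (i : Fin 2) : P ⟶ P ⊗ Δ[1] := lift (𝟙 P) (SSet.const (vtx 1 i))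

variable {H : P ⊗ Δ[1] ⟶ P} (H₀ : cylEnd P 0 ≫ H = 𝟙 P)

theorem cyl_vtx (H₀ : cylEnd P 0 ≫ H = 𝟙 P) {n : ℕ} (σ : (Δ[n] : SSet.{u}) ⟶ P) :
    (σ ▷ Δ[1] ≫ H).app _ (vtx n 0, vtx 1 0) = vtx₀ σ :=
  app_congr H₀ _ (vtx₀ σ)

/-- The morphism along which the values of a cochain on the simplices of a cylinder are moved to
the initial vertex. -/
noncomputable def cylTr {n m : ℕ} (σ : (Δ[n] : SSet.{u}) ⟶ P) (θ : (Δ[m] : SSet.{u}) ⟶ Δ[n] ⊗ Δ[1]) :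
    FundGrpd.pt (vtx₀ (θ ≫ σ ▷ Δ[1] ≫ H)) ⟶ FundGrpd.pt (vtx₀ σ) :=
  tr (σ ▷ Δ[1] ≫ H) (θ.app _ (vtx m 0)) (vtx n 0, vtx 1 0) ≫
    eqToHom (congrArg FundGrpd.pt (cyl_vtx H₀ σ))

/-- The operator on cochains given by a simplex of `Δ[n] × Δ[1]`. -/
noncomputable def cylOp {n m : ℕ} (θ : (Δ[m] : SSet.{u}) ⟶ Δ[n] ⊗ Δ[1]) :
    Cochain B m →ₗ[R] Cochain B n :=
  B.pull (fun σ => θ ≫ σ ▷ Δ[1] ≫ H) fun σ => cylTr H₀ σ θ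

theorem cylOp_apply {n m : ℕ} (θ : (Δ[m] : SSet.{u}) ⟶ Δ[n] ⊗ Δ[1]) (φ : Cochain B m)
    (σ : (Δ[n] : SSet.{u}) ⟶ P) : (cylOp B H₀ θ φ).1 σ =
      (B.map (eqToHom (congrArg FundGrpd.pt (cyl_vtx H₀ σ)))).lin
        (evc B φ (σ ▷ Δ[1] ≫ H) θ (vtx n 0, vtx 1 0)) :=
  (LocalCoeff.map_lin_comp B _ _ _).symm

theorem cylOp_cochainOp {n m l : ℕ} (α : ⦋l⦌ ⟶ ⦋m⦌) (θ : (Δ[m] : SSet.{u}) ⟶ Δ[n] ⊗ Δ[1])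
    (φ : Cochain B l) :
    cylOp B H₀ θ (cochainOp B α φ) = cylOp B H₀ (SSet.stdSimplex.map α ≫ θ) φ := by
  refine Subtype.ext (funext fun σ => ?_)
  exact (cylOp_apply B H₀ θ _ σ).trans ((congrArg _ (evc_cochainOp B α φ _ θ _)).trans
    (cylOp_apply B H₀ _ φ σ).symm)

theorem comp_assoc_of_eq {C : Type*} [Category* C] {a b c d e : C} {t' t'' : a ⟶ b} {t : a ⟶ d}
    {f : d ⟶ b} {g' : b ⟶ c} {g : d ⟶ e} {o : e ⟶ c} (h₁ : t' = t'') (h₂ : f ≫ g' = g ≫ o)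
    (h₃ : t'' = t ≫ f) : t' ≫ g' = (t ≫ g) ≫ o := by
  rw [h₁, h₃, Category.assoc, h₂, Category.assoc]

/-- Restriction along α moves the base vertex from σ₀ to σ_{α(0)}. As H is the identity at the end
0, it sends the edge (0 → α(0)) × {0} of the cylinder to the corresponding edge of σ, so the two
transports agree. -/
theorem cochainOp_cylOp {n m l : ℕ} (α : ⦋m⦌ ⟶ ⦋n⦌) (θ : (Δ[l] : SSet.{u}) ⟶ Δ[m] ⊗ Δ[1])
    (φ : Cochain B l) :
    cochainOp B α (cylOp B H₀ θ φ) = cylOp B H₀ (θ ≫ SSet.stdSimplex.map α ▷ Δ[1]) φ := by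
  refine Subtype.ext (funext fun σ => ?_)
  refine (LocalCoeff.map_lin_comp B _ _
    (φ.1 (θ ≫ (SSet.stdSimplex.map α ≫ σ) ▷ Δ[1] ≫ H))).trans ?_
  refine congrArg (fun g => (B.map g).lin
    (φ.1 ((θ ≫ SSet.stdSimplex.map α ▷ Δ[1]) ≫ σ ▷ Δ[1] ≫ H))) ?_
  have h1 : tr ((SSet.stdSimplex.map α ≫ σ) ▷ Δ[1] ≫ H) (θ.app _ (vtx l 0)) (vtx m 0, vtx 1 0) =
      tr (σ ▷ Δ[1] ≫ H) ((θ ≫ SSet.stdSimplex.map α ▷ Δ[1]).app _ (vtx l 0))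
        (vtx n (α.toOrderHom 0), vtx 1 0) :=
    tr_map (SSet.stdSimplex.map α ▷ Δ[1]) (σ ▷ Δ[1] ≫ H) _ _
  have h2 : FundGrpd.edge ((prodEdge (stdEdge 0 (α.toOrderHom 0) (Fin.zero_le _))
        (Edge.id (vtx 1 0))).map (σ ▷ Δ[1] ≫ H)) ≫
        eqToHom (congrArg FundGrpd.pt (cyl_vtx H₀ (SSet.stdSimplex.map α ≫ σ))) =
      eqToHom (congrArg FundGrpd.pt (cyl_vtx H₀ σ)) ≫ FundGrpd.edge (opEdge α σ) :=
    edge_congr ((prodEdge (stdEdge 0 (α.toOrderHom 0) (Fin.zero_le _))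
        (Edge.id (vtx 1 0))).map (σ ▷ Δ[1] ≫ H)) (opEdge α σ) (cyl_vtx H₀ σ)
        (cyl_vtx H₀ (SSet.stdSimplex.map α ≫ σ)) (app_congr H₀ _ (opEdge α σ).edge)
  have h3 := tr_edge (σ ▷ Δ[1] ≫ H) (prodEdge (stdEdge 0 (α.toOrderHom 0) (Fin.zero_le _))
        (Edge.id (vtx 1 0)))
  refine (IsIso.comp_inv_eq _).2 ?_
  exact comp_assoc_of_eq h1 h2
    ((tr_comp (σ ▷ Δ[1] ≫ H) _ _ _).symm.trans (congrArg (_ ≫ ·) h3))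

theorem cylOp_last (n : ℕ) (φ : Cochain B n) : cylOp B H₀ (prismMid n (n + 1)) φ = φ := by
  refine Subtype.ext (funext fun σ => ?_)
  have h : prismMid n (n + 1) ≫ σ ▷ Δ[1] ≫ H = σ := by
    rw [prismMid_last]
    exact congrArg (σ ≫ ·) H₀
  refine (cochain_congr B φ h _ (𝟙 _) ?_).trans (LocalCoeff.map_lin_id B _)
  have h1 : (prismMid.{u} n (n + 1)).app _ (vtx n 0) = (vtx n 0, vtx 1 0) := by
    rw [prismMid_last]; rfl
  exact (congrArg (· ≫ _) (tr_congr _ h1)).trans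
    ((eqToHom_trans _ _).trans (Category.comp_id _).symm)

/-- The bounded cochain homotopy given by a homotopy. -/
noncomputable def cylHomotopy (H₀ : cylEnd P 0 ≫ H = 𝟙 P) (n : ℕ) :
    Cochain B (n + 1) →ₗ[R] Cochain B n :=
  altSum fun j : Fin (n + 1) => cylOp B H₀ (prismTop n j)

theorem norm_cylHomotopy_le (n : ℕ) (φ : Cochain B (n + 1)) :
    ‖cylHomotopy B H₀ n φ‖ ≤ (n + 1) * ‖φ‖ := by
  refine (norm_altSum_le _ (fun _ φ => B.norm_pull_le _ _ φ) φ).trans_eq ?_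
  push_cast
  rfl

theorem cobdry_eq (n : ℕ) (φ : Cochain B n) :
    cobdry B n φ = ∑ i ∈ Finset.range (n + 2), (-1 : ℤ) ^ i • cochainOp B (dOp n i) φ := by
  rw [cobdry, altSum_apply, ← Fin.sum_univ_eq_sum_range
    (fun i => (-1 : ℤ) ^ i • cochainOp B (dOp n i) φ)]
  exact Finset.sum_congr rfl fun i _ => by rw [dOp_eq]

theorem cylHomotopy_eq (n : ℕ) (φ : Cochain B (n + 1)) :
    cylHomotopy B H₀ n φ =
      ∑ j ∈ Finset.range (n + 1), (-1 : ℤ) ^ j • cylOp B H₀ (prismTop n j) φ := by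
  rw [cylHomotopy, altSum_apply, ← Fin.sum_univ_eq_sum_range
    (fun j => (-1 : ℤ) ^ j • cylOp B H₀ (prismTop n j) φ)]

theorem cylHomotopy_cobdry (n : ℕ) (φ : Cochain B n) :
    cylHomotopy B H₀ n (cobdry B n φ) =
      ∑ j ∈ Finset.range (n + 1), ∑ i ∈ Finset.range (n + 2), (-1 : ℤ) ^ (i + j) •
        cylOp B H₀ (SSet.stdSimplex.map (dOp n i) ≫ prismTop n j) φ := by
  rw [cylHomotopy_eq, cobdry_eq]
  refine Finset.sum_congr rfl fun j _ => ?_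
  rw [map_sum, Finset.smul_sum]
  refine Finset.sum_congr rfl fun i _ => ?_
  rw [map_zsmul, cylOp_cochainOp, smul_smul, pow_add, mul_comm]

theorem cobdry_cylHomotopy (n : ℕ) (φ : Cochain B (n + 1)) :
    cobdry B n (cylHomotopy B H₀ n φ) =
      ∑ j ∈ Finset.range (n + 1), ∑ i ∈ Finset.range (n + 2), (-1 : ℤ) ^ (i + j) •
        cylOp B H₀ (prismTop n j ≫ SSet.stdSimplex.map (dOp n i) ▷ Δ[1]) φ := by
  rw [cobdry_eq, cylHomotopy_eq, Finset.sum_comm]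
  refine Finset.sum_congr rfl fun i _ => ?_
  rw [map_sum, Finset.smul_sum]
  refine Finset.sum_congr rfl fun j _ => ?_
  rw [map_zsmul, cochainOp_cylOp, smul_smul, pow_add]

/-- No coboundary arrives in degree 0, so the prism identity is used with G = 0. -/
theorem cylHomotopy_zero (φ : Cochain B 0) :
    cylOp B H₀ (prismMid 0 0) φ - φ = cylHomotopy B H₀ 0 (cobdry B 0 φ) := by
  have h := prism_identity 0
    (fun i j => cylOp B H₀ (SSet.stdSimplex.map (dOp 0 i) ≫ prismTop 0 j) φ) (fun _ _ => 0)
    (fun i => cylOp B H₀ (prismMid 0 i) φ) (fun i j h h' => by omega) (fun i j h h' => by omega)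
    (fun j hj => by rw [prismTop_face (.inl rfl) hj])
    (fun j hj => by rw [prismTop_face (.inr rfl) hj])
  rw [cylOp_last, Finset.range_zero, Finset.sum_empty, add_zero] at h
  rw [cylHomotopy_cobdry, h]

/-- This is the prism identity for the cylinder: u 0 is the pullback along the end 1 and u (n + 2)
the one along the end 0, where H is the identity. -/
theorem cylHomotopy_succ (n : ℕ) (φ : Cochain B (n + 1)) :
    cylOp B H₀ (prismMid (n + 1) 0) φ - φ =
      cobdry B n (cylHomotopy B H₀ n φ) + cylHomotopy B H₀ (n + 1) (cobdry B (n + 1) φ) := by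
  have h := prism_identity (n + 1)
    (fun i j => cylOp B H₀ (SSet.stdSimplex.map (dOp (n + 1) i) ≫ prismTop (n + 1) j) φ)
    (fun i j => cylOp B H₀ (prismTop n j ≫ SSet.stdSimplex.map (dOp n i) ▷ Δ[1]) φ)
    (fun i => cylOp B H₀ (prismMid (n + 1) i) φ)
    (fun i j h h' => by rw [prismTop_lt h h'])
    (fun i j h h' => by rw [prismTop_gt h h'])
    (fun j hj => by rw [prismTop_face (.inl rfl) hj])
    (fun j hj => by rw [prismTop_face (.inr rfl) hj])
  rw [cylOp_last] at h
  rw [cylHomotopy_cobdry, cobdry_cylHomotopy]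
  exact h.symm.trans (add_comm _ _)

end Homotopy

/-! ### Maps of coefficient systems and trivial fibrations -/

section CoeffMap

variable {R : Type w} [NormedRing R] {P F G : SSet.{u}}

/-- A map of local coefficient systems over a map of simplicial sets, contravariant in the map. -/
structure CoeffMap (t : P ⟶ F) (B' : LocalCoeff.{u, v} R F) (B : LocalCoeff.{u, v} R P) where
  app (x : P _⦋0⦌) : B'.at₀ (t.app _ x) ⟶ B.at₀ x
  nat {x y : P _⦋0⦌} (e : Edge x y) :
    B'.map (FundGrpd.edge (e.map t)) ≫ app y = app x ≫ B.map (FundGrpd.edge e)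

namespace CoeffMap

variable {t : P ⟶ F} {B' : LocalCoeff.{u, v} R F} {B : LocalCoeff.{u, v} R P} (μ : CoeffMap t B' B)

/-- The identity as a map from a pulled back coefficient system. -/
def ofPullback (t : P ⟶ F) (B' : LocalCoeff.{u, v} R F) : CoeffMap t B' (B'.pullback t) where
  app _ := 𝟙 _
  nat e := (Category.comp_id _).trans
    ((congrArg B'.map (FundGrpd.map_edge t e).symm).trans (Category.id_comp _).symm)

theorem nat_inv {x y : P _⦋0⦌} (e : Edge x y) :
    μ.app y ≫ B.map (inv (FundGrpd.edge e)) =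
      B'.map (inv (FundGrpd.edge (e.map t))) ≫ μ.app x := by
  rw [Functor.map_inv, Functor.map_inv, IsIso.comp_inv_eq, Category.assoc, IsIso.eq_inv_comp]
  exact μ.nat e

/-- The map induced on cochains. -/
noncomputable def cochain (n : ℕ) : Cochain B' n →ₗ[R] Cochain B n where
  toFun φ := ⟨fun σ => (μ.app (vtx₀ σ)).lin (φ.1 (σ ≫ t)), by
    obtain ⟨C, hC⟩ := SnMod.bprod_bddAbove φ
    refine ⟨C, ?_⟩
    rintro _ ⟨σ, rfl⟩
    exact ((μ.app _).norm_le _).trans (hC ⟨σ ≫ t, rfl⟩)⟩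
  map_add' φ ψ := Subtype.ext (funext fun σ => map_add (μ.app (vtx₀ σ)).lin _ _)
  map_smul' r φ := Subtype.ext (funext fun σ => map_smul (μ.app (vtx₀ σ)).lin _ _)

theorem norm_cochain_le {n : ℕ} (φ : Cochain B' n) : ‖μ.cochain n φ‖ ≤ ‖φ‖ := by
  rw [SnMod.bprod_norm, SnMod.bprod_norm]
  refine Real.iSup_le (fun σ => ?_) (Real.iSup_nonneg fun _ => norm_nonneg _)
  exact ((μ.app _).norm_le _).trans (le_ciSup (SnMod.bprod_bddAbove φ) (σ ≫ t))

theorem cochainOp_cochain {m n : ℕ} (α : ⦋m⦌ ⟶ ⦋n⦌) (φ : Cochain B' m) :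
    cochainOp B α (μ.cochain m φ) = μ.cochain n (cochainOp B' α φ) :=
  Subtype.ext (funext fun σ =>
    congrArg (fun g => SnMod.Hom.lin g (φ.1 (SSet.stdSimplex.map α ≫ σ ≫ t)))
      (μ.nat_inv (opEdge α σ)))

theorem cobdry_cochain (n : ℕ) (φ : Cochain B' n) :
    cobdry B n (μ.cochain n φ) = μ.cochain (n + 1) (cobdry B' n φ) := by
  rw [cobdry_eq, cobdry_eq, map_sum]
  refine Finset.sum_congr rfl fun i _ => ?_
  rw [map_zsmul, cochainOp_cochain]

/-- The map of bounded cochain complexes. -/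
noncomputable def cmap : SnComplex.CMap (cochainComplex B') (cochainComplex B) where
  f := μ.cochain
  norm_le _ := μ.norm_cochain_le
  comm := μ.cobdry_cochain

end CoeffMap

theorem edge_eq_of_degenerate {x y : P _⦋0⦌} (e : Edge x y) (hxy : x = y)
    (h : e.edge = (Edge.id x).edge) :
    FundGrpd.edge e = eqToHom (congrArg FundGrpd.pt hxy) := by
  subst hxy
  obtain rfl : e = Edge.id x := Edge.ext h
  exact FundGrpd.edge_id x

theorem exists_lift_of_rlp {t : P ⟶ F} (ht : (MorphismProperty.monomorphisms SSet.{u}).rlp t)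
    {K L : SSet.{u}} (i : K ⟶ L) [Mono i] {a : K ⟶ P} {b : L ⟶ F} (w : a ≫ t = i ≫ b) :
    ∃ l : L ⟶ P, i ≫ l = a ∧ l ≫ t = b := by
  have := ht i (MorphismProperty.monomorphisms.infer_property i)
  have sq : CommSq a i t b := ⟨w⟩
  exact ⟨sq.lift, sq.fac_left, sq.fac_right⟩

/-- A simplex of ∂Δ[1] misses one of the two vertices. This makes the case distinction in `ofEnds`
simplicial. -/
theorem boundary_one_const {m : ℕ} {c : (Δ[1] : SSet.{u}) _⦋m⦌} (hc : c ∈ (∂Δ[1]).obj (op ⦋m⦌))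
    (k l : Fin (m + 1)) : c k = c l := by
  rw [mem_boundary_iff_notMem_range] at hc
  obtain ⟨j, hj⟩ := hc
  have hk : c k ≠ j := fun h => hj ⟨k, h⟩
  have hl : c l ≠ j := fun h => hj ⟨l, h⟩
  generalize c k = x at *
  generalize c l = y at *
  omega

/-- The map `P × ∂Δ[1] ⟶ Q` given by two maps `P ⟶ Q`. -/
noncomputable def ofEnds {Q : SSet.{u}} (g h : P ⟶ Q) : P ⊗ (∂Δ[1] : SSet.{u}) ⟶ Q where
  app m := ↾fun s => if SSet.stdSimplex.asOrderHom s.2.1 0 = 0 then g.app m s.1 else h.app m s.1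
  naturality m m' α := by
    refine ConcreteCategory.hom_ext _ _ fun s => ?_
    have e : SSet.stdSimplex.asOrderHom ((∂Δ[1] : (Δ[1] : SSet.{u}).Subcomplex).toSSet.map α s.2).1 0
        = SSet.stdSimplex.asOrderHom s.2.1 0 :=
      boundary_one_const (m := m.unop.len) s.2.2 (α.unop.toOrderHom 0) 0
    change (if SSet.stdSimplex.asOrderHom
      ((∂Δ[1] : (Δ[1] : SSet.{u}).Subcomplex).toSSet.map α s.2).1 0 = 0 then _ else _) =
      Q.map α (if SSet.stdSimplex.asOrderHom s.2.1 0 = 0 then g.app m s.1 else h.app m s.1)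
    rw [e]
    split_ifs
    · exact NatTrans.naturality_apply g α s.1
    · exact NatTrans.naturality_apply h α s.1

theorem mono_whiskerLeft (P : SSet.{u}) {K L : SSet.{u}} (i : K ⟶ L) [Mono i] : Mono (P ◁ i) where
  right_cancellation a b h := by
    refine CartesianMonoidalCategory.hom_ext _ _ ?_ ?_
    · simpa using congrArg (· ≫ fst _ _) h
    · rw [← cancel_mono i]
      simpa using congrArg (· ≫ snd _ _) h

/-- The section lifts against ∅ ⟶ F, and the homotopy lifts against P × ∂Δ[1] ⟶ P × Δ[1]. Lifting
over the constant homotopy of t makes it fiberwise, which is what keeps track of the coefficients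
later. -/
theorem exists_section_homotopy {t : P ⟶ F}
    (ht : (MorphismProperty.monomorphisms SSet.{u}).rlp t) :
    ∃ (s : F ⟶ P) (H : P ⊗ Δ[1] ⟶ P), s ≫ t = 𝟙 F ∧ cylEnd P 0 ≫ H = 𝟙 P ∧
      cylEnd P 1 ≫ H = t ≫ s ∧ H ≫ t = fst _ _ ≫ t := by
  obtain ⟨s, -, hs⟩ := exists_lift_of_rlp ht (⊥ : F.Subcomplex).ι
    (a := Subcomplex.isInitialBot.to P) (b := 𝟙 F) (Subcomplex.isInitialBot.hom_ext _ _)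
  have := mono_whiskerLeft P (∂Δ[1] : (Δ[1] : SSet.{u}).Subcomplex).ι
  obtain ⟨H, h₁, h₂⟩ := exists_lift_of_rlp ht (P ◁ (∂Δ[1] : (Δ[1] : SSet.{u}).Subcomplex).ι)
    (a := ofEnds (𝟙 P) (t ≫ s)) (b := fst _ _ ≫ t) (by
      refine NatTrans.ext (funext fun m => ConcreteCategory.hom_ext _ _ fun x => ?_)
      change t.app m (if _ then x.1 else s.app m (t.app m x.1)) = t.app m x.1
      split_ifs
      · rfl
      · exact app_congr hs m (t.app m x.1))
  have hmem (i : Fin 2) (m : SimplexCategoryᵒᵖ) :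
      SSet.stdSimplex.const 1 i m ∈ (∂Δ[1] : (Δ[1] : SSet.{u}).Subcomplex).obj m := by
    intro h
    obtain ⟨a, ha⟩ := h 0
    obtain ⟨b, hb⟩ := h 1
    have ha' : i = 0 := ha
    have hb' : i = 1 := hb
    simp [ha'] at hb'
  refine ⟨s, H, hs, ?_, ?_, h₂⟩
  · refine NatTrans.ext (funext fun m => ConcreteCategory.hom_ext _ _ fun x => ?_)
    refine (app_congr h₁ m (x, ⟨SSet.stdSimplex.const 1 0 m, hmem 0 m⟩)).trans ?_
    exact (if_pos rfl : (if (0 : Fin 2) = 0 then x else (t ≫ s).app m x) = x)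
  · refine NatTrans.ext (funext fun m => ConcreteCategory.hom_ext _ _ fun x => ?_)
    refine (app_congr h₁ m (x, ⟨SSet.stdSimplex.const 1 1 m, hmem 1 m⟩)).trans ?_
    exact (if_neg (by decide) : (if (1 : Fin 2) = 0 then x else (t ≫ s).app m x) =
      (t ≫ s).app m x)

end CoeffMap

/-! ### Retractions on cochains from sections of trivial fibrations. -/

section TrivialFibration

variable {R : Type w} [NormedRing R] {P F : SSet.{u}} {t : P ⟶ F} {s : F ⟶ P}
variable {B' : LocalCoeff.{u, v} R F} {B : LocalCoeff.{u, v} R P}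

/-- The map of coefficient systems over a section of `t` given by the inverse isomorphisms. -/
noncomputable def CoeffMap.section' (μ : CoeffMap t B' B) [∀ x, IsIso (μ.app x)] (hs : s ≫ t = 𝟙 F) :
    CoeffMap s B B' where
  app z := inv (μ.app (s.app _ z)) ≫ B'.map (eqToHom (congrArg FundGrpd.pt (app_congr hs _ z)))
  nat {x y} e := by
    have h1 := μ.nat (e.map s)
    have h2 : B'.map (FundGrpd.edge ((e.map s).map t)) ≫
        B'.map (eqToHom (congrArg FundGrpd.pt (app_congr hs _ y))) =
        B'.map (eqToHom (congrArg FundGrpd.pt (app_congr hs _ x))) ≫ B'.map (FundGrpd.edge e) :=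
      (B'.map_comp _ _).symm.trans
        ((congrArg B'.map (edge_map_congr hs e)).trans (B'.map_comp _ _))
    have h3 := (IsIso.eq_comp_inv _).2 ((Category.assoc _ _ _).trans ((IsIso.inv_comp_eq _).2 h1))
    refine ((Category.assoc _ _ _).symm.trans (congrArg (· ≫ _) h3.symm)).trans ?_
    exact (Category.assoc _ _ _).trans ((congrArg (_ ≫ ·) h2).trans (Category.assoc _ _ _).symm)

variable {H : P ⊗ Δ[1] ⟶ P}

/-- The edge traced out by a vertex during a homotopy. -/
def homotopyEdge (H₀ : cylEnd P 0 ≫ H = 𝟙 P) (H₁ : cylEnd P 1 ≫ H = t ≫ s) (x : P _⦋0⦌) :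
    Edge x (s.app _ (t.app _ x)) :=
  ((prodEdge (Edge.id x) (stdEdge 0 1 (Fin.zero_le _))).map H).ofEq (app_congr H₀ _ x)
    (app_congr H₁ _ x)

theorem inv_eq_of_comp_eq {C : Type*} [Category* C] {a b c d : C} {i : a ⟶ b} {i' : b ⟶ a}
    {n : b ⟶ d} {m : a ⟶ c} {e : c ⟶ d} [IsIso n] [IsIso e] (h : i ≫ n = m ≫ e)
    (h' : i' ≫ i = 𝟙 b) : (inv n ≫ i') ≫ m = inv e := by
  rw [(IsIso.eq_comp_inv e).2 h.symm, Category.assoc, Category.assoc, reassoc_of% h',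
    IsIso.inv_hom_id_assoc]

theorem inv_eq_comp_inv_comp {C : Type*} [Category* C] {a b c d : C} {p : a ⟶ b} {y : b ⟶ d}
    {x : a ⟶ c} {e : c ⟶ d} {y' : d ⟶ b} [IsIso p] [IsIso e] (h : p ≫ y = x ≫ e)
    (h' : y' ≫ y = 𝟙 d) : inv e = y' ≫ inv p ≫ x := by
  rw [(IsIso.eq_comp_inv e).2 h.symm, Category.assoc, IsIso.inv_hom_id_assoc, reassoc_of% h']

/-- The homotopy is fiberwise, so t sends its track at x to a degenerate edge of F. Naturality of μ
along the track then leaves only the transport along the track itself. -/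
theorem inv_homotopyEdge (μ : CoeffMap t B' B) [∀ x, IsIso (μ.app x)] (hs : s ≫ t = 𝟙 F)
    (H₀ : cylEnd P 0 ≫ H = 𝟙 P) (H₁ : cylEnd P 1 ≫ H = t ≫ s) (H₂ : H ≫ t = fst _ _ ≫ t)
    (x : P _⦋0⦌) :
    (μ.section' hs).app (t.app _ x) ≫ μ.app x =
      B.map (inv (FundGrpd.edge (homotopyEdge H₀ H₁ x))) := by
  have h1 := μ.nat (homotopyEdge H₀ H₁ x)
  have hx : t.app _ x = t.app _ (s.app _ (t.app _ x)) := (app_congr hs _ (t.app _ x)).symm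
  have h2 : FundGrpd.edge ((homotopyEdge H₀ H₁ x).map t) = eqToHom (congrArg FundGrpd.pt hx) := by
    refine edge_eq_of_degenerate _ hx ?_
    refine (app_congr H₂ _ ((Edge.id x).edge, (stdEdge 0 1 (Fin.zero_le _)).edge)).trans ?_
    exact congrArg Edge.edge (Edge.map_id x t)
  rw [h2] at h1
  rw [Functor.map_inv]
  refine inv_eq_of_comp_eq h1 ?_
  rw [← B'.map_comp, eqToHom_trans, eqToHom_refl, B'.map_id]

/-- The left side pulls back along t ≫ s, the end 1 of the homotopy, and by `inv_homotopyEdge` moves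
the coefficients back along its track, as the cylinder operator does. -/
theorem cochain_section_cochain (μ : CoeffMap t B' B) [∀ x, IsIso (μ.app x)] (hs : s ≫ t = 𝟙 F)
    (H₀ : cylEnd P 0 ≫ H = 𝟙 P) (H₁ : cylEnd P 1 ≫ H = t ≫ s) (H₂ : H ≫ t = fst _ _ ≫ t)
    (n : ℕ) (ψ : Cochain B n) :
    μ.cochain n ((μ.section' hs).cochain n ψ) = cylOp B H₀ (prismMid n 0) ψ := by
  refine Subtype.ext (funext fun σ => ?_)
  have h := inv_homotopyEdge μ hs H₀ H₁ H₂ (vtx₀ σ)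
  refine (congrArg (fun g => SnMod.Hom.lin g (ψ.1 (σ ≫ t ≫ s))) h).trans ?_
  have e : σ ≫ t ≫ s = prismMid n 0 ≫ σ ▷ Δ[1] ≫ H := by
    rw [prismMid_zero, ← H₁]
    rfl
  refine cochain_congr B ψ e _ _ ?_
  have h0 : (σ ▷ Δ[1] ≫ H).app _ (vtx n 0, vtx 1 1) = s.app _ (t.app _ (vtx₀ σ)) :=
    app_congr H₁ _ (vtx₀ σ)
  have h1 := edge_congr ((prodEdge (Edge.id (vtx n 0)) (stdEdge 0 1 (Fin.zero_le _))).map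
    (σ ▷ Δ[1] ≫ H)) (homotopyEdge H₀ H₁ (vtx₀ σ)) (cyl_vtx H₀ σ) h0 ?_
  · have h2 := inv_edge_eq_tr (σ ▷ Δ[1] ≫ H)
      (prodEdge (Edge.id (vtx n 0)) (stdEdge 0 1 (Fin.zero_le _)))
    refine (inv_eq_comp_inv_comp h1 ?_).trans (congrArg (fun g => eqToHom _ ≫ g ≫ eqToHom _) h2)
    exact (eqToHom_trans _ _).trans (eqToHom_refl _ _)
  · exact congrArg (fun z => H.app _ (z, (stdEdge 0 1 (Fin.zero_le _)).edge))
      (congrArg Edge.edge (Edge.map_id (vtx n 0) σ))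

theorem section_cochain_cochain (μ : CoeffMap t B' B) [∀ x, IsIso (μ.app x)] (hs : s ≫ t = 𝟙 F)
    (n : ℕ) (φ : Cochain B' n) : (μ.section' hs).cochain n (μ.cochain n φ) = φ := by
  refine Subtype.ext (funext fun σ => ?_)
  have h : μ.app (s.app _ (vtx₀ σ)) ≫ (μ.section' hs).app (vtx₀ σ) =
      B'.map (eqToHom (congrArg FundGrpd.pt (app_congr hs _ (vtx₀ σ)))) :=
    IsIso.hom_inv_id_assoc _ _
  refine (congrArg (fun g => SnMod.Hom.lin g (φ.1 (σ ≫ s ≫ t))) h).trans ?_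
  have e : σ ≫ s ≫ t = σ := by rw [hs, Category.comp_id]
  exact (cochain_congr B' φ e _ (𝟙 _) (Category.comp_id _).symm).trans
    (LocalCoeff.map_lin_id B' _)

/-- A trivial fibration with an isomorphism of coefficient systems induces a chain map with a
norm non-increasing retraction. -/
theorem CoeffMap.exists_retraction (μ : CoeffMap t B' B) [∀ x, IsIso (μ.app x)]
    (ht : (MorphismProperty.monomorphisms SSet.{u}).rlp t) : Nonempty μ.cmap.Retraction := by
  obtain ⟨s, H, hs, H₀, H₁, H₂⟩ := exists_section_homotopy ht
  exact ⟨{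
    s := (μ.section' hs).cmap
    s_m n x := section_cochain_cochain μ hs n x
    h n := cylHomotopy B H₀ n
    norm_h_le n x := norm_cylHomotopy_le B H₀ n x
    h_zero x := (congrArg (· - x) (cochain_section_cochain μ hs H₀ H₁ H₂ 0 x)).trans
      (cylHomotopy_zero B H₀ x)
    h_succ n x := (congrArg (· - x) (cochain_section_cochain μ hs H₀ H₁ H₂ (n + 1) x)).trans
      (cylHomotopy_succ B H₀ n x) }⟩

end TrivialFibration

/-! ### Double complexes whose rows retract to the bottom row -/

namespace SnDoubleComplex

variable {R : Type w} [NormedRing R] {K : SnDoubleComplex.{v} R}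

/-- Retractions of the rows of a double complex onto its bottom row, for which the kernels are
contractible, and which turn the vertical differentials into `0` and `± 1` alternatingly. -/
structure RowRetraction (K : SnDoubleComplex.{v} R) where
  s (p q : ℕ) : K.X p q →ₗ[R] K.X p 0
  i (p q : ℕ) : K.X p 0 →ₗ[R] K.X p q
  s_i (p q : ℕ) (x : K.X p 0) : s p q (i p q x) = x
  s_zero (p : ℕ) (x : K.X p 0) : s p 0 x = x
  s_dh (p q : ℕ) (x : K.X p q) : s (p + 1) q (K.dh p q x) = K.dh p 0 (s p q x)
  s_dv_even (p q : ℕ) (hq : Even q) (x : K.X p q) : s p (q + 1) (K.dv p q x) = 0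
  s_dv_odd (p q : ℕ) (hq : Odd q) (x : K.X p q) :
    s p (q + 1) (K.dv p q x) = (-1 : ℤ) ^ p • s p q x
  h (p q : ℕ) : K.X (p + 1) q →ₗ[R] K.X p q
  h_zero (q : ℕ) (x : K.X 0 q) (hx : s 0 q x = 0) : h 0 q (K.dh 0 q x) = x
  h_succ (p q : ℕ) (x : K.X (p + 1) q) (hx : s (p + 1) q x = 0) :
    K.dh p q (h p q x) + h (p + 1) q (K.dh (p + 1) q x) = x
  s_h (p q : ℕ) (x : K.X (p + 1) q) : s p q (h p q x) = 0

namespace RowRetraction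

variable (ρ : RowRetraction K)

/-- The families in the kernel of the retractions. -/
def kerS : Submodule R K.Fam where
  carrier := {x | ∀ p q, ρ.s p q (x p q) = 0}
  zero_mem' p q := map_zero _
  add_mem' ha hb p q := by
    change ρ.s p q (_ + _) = 0
    rw [map_add, ha p q, hb p q, add_zero]
  smul_mem' r a ha p q := by
    exact (map_smul (ρ.s p q) r (a p q)).trans (by rw [ha p q, smul_zero])

theorem D_mem_kerS {x : K.Fam} (hx : x ∈ ρ.kerS) : K.D x ∈ ρ.kerS := by
  intro p q
  rw [D_apply, map_add]
  have h1 : ρ.s p q (K.intoH p q x) = 0 := by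
    cases p with
    | zero => exact map_zero _
    | succ p => rw [intoH_succ, ρ.s_dh, hx p q, map_zero]
  have h2 : ρ.s p q (K.intoV p q x) = 0 := by
    cases q with
    | zero => exact map_zero _
    | succ q =>
      rcases Nat.even_or_odd q with hq | hq
      · exact ρ.s_dv_even p q hq _
      · rw [intoV_succ, ρ.s_dv_odd p q hq, hx p q, smul_zero]
  rw [h1, h2, add_zero]

/-- The total horizontal contraction. -/
def hTot (x : K.Fam) : K.Fam := fun p q => ρ.h p q (x (p + 1) q)

/-- The kernel of the retractions is a double subcomplex with contractible rows. In the lowest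
nonzero row of a cocycle x no vertical term arrives, so this row is horizontally closed and equals
d_h (h x). Subtracting D (h x) therefore moves the support up by one row, and k counts the rows that
remain to be cleared. -/
theorem exists_D_eq (n k : ℕ) (x : K.Fam) (hx : x ∈ ρ.kerS) (hD : K.D x = 0)
    (hn : x ∈ K.deg (n + 1)) (hk : ∀ p q, q + k < n + 2 → x p q = 0) :
    ∃ y ∈ ρ.kerS ⊓ K.deg n, K.D y = x := by
  induction k generalizing x with
  | zero =>
    refine ⟨0, zero_mem _, ?_⟩
    rw [map_zero]
    refine (funext fun p => funext fun q => ?_ : x = 0).symm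
    by_cases h : p + q = n + 1
    · exact hk p q (by omega)
    · exact hn p q h
  | succ k ih =>
    have h1 : ρ.hTot x ∈ ρ.kerS ⊓ K.deg n := by
      refine ⟨fun p q => ρ.s_h p q _, fun p q hpq => ?_⟩
      change ρ.h p q (x (p + 1) q) = 0
      rw [hn (p + 1) q (by omega), map_zero]
    obtain ⟨y, hy, hyx⟩ := ih (x - K.D (ρ.hTot x)) (sub_mem hx (ρ.D_mem_kerS h1.1))
      (by rw [map_sub, hD, D_D, sub_zero]) (sub_mem hn (D_mem_deg h1.2)) (fun p q hpq => by
        have hv : K.intoV p q (ρ.hTot x) = 0 := by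
          cases q with
          | zero => rfl
          | succ q =>
            change K.dv p q (ρ.h p q (x (p + 1) q)) = 0
            rw [hk (p + 1) q (by omega), map_zero, map_zero]
        have hd : K.dh p q (x p q) = 0 := by
          have h2 : K.D x (p + 1) q = 0 := by rw [hD]; rfl
          rw [D_apply] at h2
          have h3 : K.intoV (p + 1) q x = 0 := by
            cases q with
            | zero => rfl
            | succ q =>
              change K.dv (p + 1) q (x (p + 1) q) = 0
              rw [hk (p + 1) q (by omega), map_zero]
          rw [h3, add_zero] at h2
          exact h2
        change x p q - K.D (ρ.hTot x) p q = 0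
        rw [D_apply, hv, add_zero]
        cases p with
        | zero =>
          have := ρ.h_zero q (x 0 q) (hx 0 q)
          rw [hd, map_zero] at this
          rw [← this]
          exact sub_zero _
        | succ p =>
          have := ρ.h_succ p q (x (p + 1) q) (hx (p + 1) q)
          rw [hd, map_zero, add_zero] at this
          exact sub_eq_zero.2 this.symm)
    exact ⟨y + ρ.hTot x, add_mem hy h1, by rw [map_add, hyx, sub_add_cancel]⟩

/-- The family with sole entry z has differential d_v z, which lies in the kernel of the retractions
because row 0 is even. Hence it equals D y with y in that kernel; since `s n 0` is the identity, y
has entry 0 at (n, 0), and z − y is the wanted cocycle. -/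
theorem exists_cocyc (ρ : RowRetraction K) (n : ℕ) (z : K.X n 0) (hz : K.dh n 0 z = 0) :
    ∃ x : K.cocyc n, x.1 n 0 = z := by
  have hD (p q : ℕ) (h : ¬(p = n ∧ q = 1)) : K.D (single n 0 z) p q = 0 := by
    rw [D_apply]
    have h1 : K.intoH p q (single n 0 z) = 0 := by
      cases p with
      | zero => rfl
      | succ p =>
        change K.dh p q (single n 0 z p q) = 0
        by_cases hp : p = n ∧ q = 0
        · obtain ⟨rfl, rfl⟩ := hp
          rw [single_same, hz]
        · rw [single_of_ne z (by omega), map_zero]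
    have h2 : K.intoV p q (single n 0 z) = 0 := by
      cases q with
      | zero => rfl
      | succ q =>
        change K.dv p q (single n 0 z p q) = 0
        rw [single_of_ne z (by omega), map_zero]
    rw [h1, h2, add_zero]
  obtain ⟨y, ⟨hy, hy'⟩, hyD⟩ := ρ.exists_D_eq n (n + 1) (K.D (single n 0 z)) (fun p q => by
      by_cases h : p = n ∧ q = 1
      · obtain ⟨rfl, rfl⟩ := h
        rw [D_apply, map_add]
        have h1 : K.intoH p 1 (single p 0 z) = 0 := by
          cases p with
          | zero => rfl
          | succ p =>
            change K.dh p 1 (single (p + 1) 0 z p 1) = 0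
            rw [single_of_ne z (by omega), map_zero]
        rw [h1, map_zero, zero_add]
        exact ρ.s_dv_even p 0 Even.zero _
      · rw [hD p q h, map_zero]) (D_D _ _) (D_mem_deg (single_mem_deg n 0 z))
      (fun p q h => hD p q (by omega))
  refine ⟨⟨single n 0 z - y, mem_cocyc.2 ⟨sub_mem (single_mem_deg n 0 z) hy', ?_⟩⟩, ?_⟩
  · rw [map_sub, hyD, sub_self]
  · change single n 0 z n 0 - y n 0 = z
    have := hy n 0
    rw [ρ.s_zero] at this
    rw [single_same, this, sub_zero]

/-- Correction of a family by which it is moved into the kernel of the retractions. -/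
def corr (x : K.Fam) : K.Fam := fun p q =>
  if Odd q then (-1 : ℤ) ^ p • ρ.i p q (ρ.s p (q + 1) (x p (q + 1))) else 0

theorem s_corr_odd (x : K.Fam) {p q : ℕ} (hq : Odd q) :
    ρ.s p q (ρ.corr x p q) = (-1 : ℤ) ^ p • ρ.s p (q + 1) (x p (q + 1)) := by
  rw [corr, if_pos hq, map_zsmul, ρ.s_i]

theorem corr_even (x : K.Fam) {p q : ℕ} (hq : Even q) : ρ.corr x p q = 0 := by
  rw [corr, if_neg (Nat.not_odd_iff_even.2 hq)]

/-- Modulo the kernel of the retractions each column becomes a complex with maps 0, ±1, 0, ±1, …,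
which is contractible above row 0. The correction inverts the maps ±1 from odd to even rows. -/
theorem sub_D_corr_mem {x : K.Fam} (hD : K.D x = 0) (h0 : ∀ p, x p 0 = 0) :
    x - K.D (ρ.corr x) ∈ ρ.kerS := by
  intro p q
  change ρ.s p q (x p q - K.D (ρ.corr x) p q) = 0
  rw [D_apply, map_sub, map_add, sub_eq_zero]
  rcases Nat.even_or_odd q with hq | hq
  · have h1 : K.intoH p q (ρ.corr x) = 0 := by
      cases p with
      | zero => rfl
      | succ p =>
        change K.dh p q (ρ.corr x p q) = 0
        rw [ρ.corr_even x hq, map_zero]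
    rw [h1, map_zero, zero_add]
    cases q with
    | zero => rw [h0, map_zero]; exact (map_zero _).symm
    | succ q =>
      have hq' : Odd q := by
        rw [← Nat.not_even_iff_odd]
        exact Nat.even_add_one.1 hq
      rw [intoV_succ, ρ.s_dv_odd p q hq', ρ.s_corr_odd x hq', smul_smul, ← pow_add, Even.neg_one_pow ⟨p, rfl⟩, one_smul]
  · have h1 : K.intoV p q (ρ.corr x) = 0 := by
      cases q with
      | zero => rfl
      | succ q =>
        change K.dv p q (ρ.corr x p q) = 0
        have hq' : Even q := by
          rw [← Nat.not_odd_iff_even]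
          exact Nat.odd_add_one.1 hq
        rw [ρ.corr_even x hq', map_zero]
    rw [h1, map_zero, add_zero]
    -- The entry of D x just above expresses s x in the odd row q through d_h of the even row q + 1,
    -- which is also how `corr` enters row q.
    have h2 : ρ.s p (q + 1) (K.intoH p (q + 1) x) + (-1 : ℤ) ^ p • ρ.s p q (x p q) = 0 := by
      have h3 : K.D x p (q + 1) = 0 := by rw [hD]; rfl
      rw [D_apply] at h3
      have h4 := congrArg (ρ.s p (q + 1)) h3
      rw [map_add, map_zero] at h4
      rw [← h4]
      exact congrArg _ (ρ.s_dv_odd p q hq (x p q)).symm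
    have h5 : ρ.s p q (x p q) = -((-1 : ℤ) ^ p • ρ.s p (q + 1) (K.intoH p (q + 1) x)) := by
      have h6 := congrArg (fun z => (-1 : ℤ) ^ p • z) h2
      simp only [smul_add, smul_smul, smul_zero] at h6
      rw [← pow_add, Even.neg_one_pow ⟨p, rfl⟩, one_smul, add_comm] at h6
      exact eq_neg_of_add_eq_zero_left h6
    rw [h5]
    cases p with
    | zero =>
      refine Eq.trans ?_ (map_zero (ρ.s 0 q)).symm
      refine (congrArg (fun z => -((-1 : ℤ) ^ 0 • z)) (map_zero (ρ.s 0 (q + 1)))).trans ?_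
      rw [smul_zero, neg_zero]
    | succ p =>
      rw [intoH_succ, intoH_succ, ρ.s_dh, ρ.s_dh, ρ.s_corr_odd x hq, map_zsmul, pow_succ,
        mul_neg_one, neg_smul, neg_neg]

/-- After the correction, x lies in the kernel of the retractions and `exists_D_eq` applies; with k
= n + 2 its vanishing hypothesis is void. -/
theorem exists_D_eq_of_zero (ρ : RowRetraction K) (n : ℕ) (x : K.cocyc n) (h0 : x.1 n 0 = 0) : ∃ y, K.D y = x.1 := by
  have hx := mem_cocyc.1 x.2
  have h0' (p : ℕ) : x.1 p 0 = 0 := by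
    by_cases hp : p = n
    · rw [hp, h0]
    · exact hx.1 p 0 (by omega)
  cases n with
  | zero =>
    refine ⟨0, ?_⟩
    rw [map_zero]
    refine (funext fun p => funext fun q => ?_ : x.1 = 0).symm
    by_cases h : p + q = 0
    · obtain ⟨rfl, rfl⟩ : p = 0 ∧ q = 0 := by omega
      exact h0
    · exact hx.1 p q h
  | succ n =>
    have hc : ρ.corr x.1 ∈ K.deg n := fun p q hpq => by
      rw [corr, hx.1 p (q + 1) (by omega)]
      simp
    obtain ⟨y, -, hy⟩ := ρ.exists_D_eq n (n + 2) _ (ρ.sub_D_corr_mem hx.2 h0')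
      (by rw [map_sub, hx.2, D_D, sub_zero]) (sub_mem hx.1 (D_mem_deg hc)) (fun p q h => by omega)
    exact ⟨y + ρ.corr x.1, by rw [map_add, hy, sub_add_cancel]⟩

/-- Convergence of the spectral sequence to the cohomology of the bottom row. -/
theorem convergesTo (ρ : RowRetraction K) (S : K.SpectralSeq) (L : SnComplex.{v} R) (e : ∀ n, K.X n 0 ≃ₗ[R] L.X n)
    (he : ∀ n x, L.d n (e n x) = e (n + 1) (K.dh n 0 x)) : S.ConvergesTo L.H := by
  have hker (n : ℕ) (x : K.cocyc n) : e n (x.1 n 0) ∈ LinearMap.ker (L.d n) := by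
    have h : K.D x.1 (n + 1) 0 = 0 := by rw [(mem_cocyc.1 x.2).2]; rfl
    have h' : K.dh n 0 (x.1 n 0) = 0 := by
      rw [D_apply] at h
      exact (add_zero _).symm.trans h
    rw [LinearMap.mem_ker, he, h', map_zero]
  let lead (n : ℕ) : K.cocyc n →ₗ[R] LinearMap.ker (L.d n) :=
    { toFun := fun x => ⟨e n (x.1 n 0), hker n x⟩
      map_add' := fun x y => Subtype.ext (map_add (e n) (x.1 n 0) (y.1 n 0))
      map_smul' := fun r x => Subtype.ext (map_smul (e n) r (x.1 n 0)) }
  refine S.convergesTo_of_total L.H (fun n => (L.cls n).comp (lead n)) ?_ ?_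
  · intro n ξ
    obtain ⟨z, rfl⟩ := L.cls_surjective n ξ
    obtain ⟨x, hx⟩ := ρ.exists_cocyc n ((e n).symm z.1) (by
      apply (e (n + 1)).injective
      rw [← he, LinearEquiv.apply_symm_apply, map_zero]
      exact z.2)
    refine ⟨x, congrArg (L.cls n) (Subtype.ext ?_)⟩
    change e n (x.1 n 0) = z.1
    rw [hx, LinearEquiv.apply_symm_apply]
  · intro n x
    refine (SnComplex.cls_eq_zero_iff _ _).trans ?_
    change e n (x.1 n 0) ∈ L.cobound n ↔ _
    constructor
    · intro h
      cases n with
      | zero =>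
        rw [SnComplex.mem_cobound_zero] at h
        exact ρ.exists_D_eq_of_zero 0 x ((e 0).map_eq_zero_iff.1 h)
      | succ n =>
        obtain ⟨w, hw⟩ := h
        have hs : K.dh n 0 ((e n).symm w) = x.1 (n + 1) 0 := by
          apply (e (n + 1)).injective
          rw [← he, LinearEquiv.apply_symm_apply, hw]
        have hx := mem_cocyc.1 x.2
        -- Subtracting D of the primitive in the bottom row clears the bottom entry of x.
        obtain ⟨y, hy⟩ := ρ.exists_D_eq_of_zero (n + 1)
          ⟨x.1 - K.D (single n 0 ((e n).symm w)), mem_cocyc.2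
            ⟨sub_mem hx.1 (D_mem_deg (single_mem_deg n 0 _)),
              by rw [map_sub, hx.2, D_D, sub_zero]⟩⟩ (by
            change x.1 (n + 1) 0 - K.D (single n 0 _) (n + 1) 0 = 0
            rw [D_apply, sub_eq_zero, ← hs]
            refine Eq.trans ?_ (add_zero _).symm
            change _ = K.dh n 0 (single n 0 _ n 0)
            rw [single_same])
        exact ⟨y + single n 0 ((e n).symm w), by rw [map_add, hy, sub_add_cancel]⟩
    · rintro ⟨y, hy⟩
      have h : x.1 n 0 = K.intoH n 0 y := by
        rw [← hy, D_apply]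
        exact add_zero _
      rw [h]
      cases n with
      | zero => exact SnComplex.mem_cobound_zero.2 (map_zero _)
      | succ n => exact ⟨e n (y n 0), he n _⟩

end RowRetraction

end SnDoubleComplex

/-! ### Operators on bisimplices -/

section BiOperators

variable {R : Type w} [NormedRing R] {X Y : SSet.{u}}

/-- A map `Δ[p'] × Δ[q'] ⟶ Δ[p] × Δ[q]` over an operator `[p'] → [p]`. -/
@[ext]
structure BiMap (p' q' p q : ℕ) where
  α : ⦋p'⦌ ⟶ ⦋p⦌
  θ : (Δ[p'] : SSet.{u}) ⊗ Δ[q'] ⟶ Δ[p] ⊗ Δ[q]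
  w : θ ≫ fst _ _ = fst _ _ ≫ SSet.stdSimplex.map α

namespace BiMap

variable {p q p' q' p'' q'' : ℕ}

/-- The identity. -/
def id (p q : ℕ) : BiMap.{u} p q p q where
  α := 𝟙 _
  θ := 𝟙 _
  w := by
    rw [Category.id_comp]
    exact ((congrArg (fst _ _ ≫ ·) (SSet.stdSimplex.map_id _)).trans (Category.comp_id _)).symm

/-- Composition. -/
def comp (a : BiMap.{u} p'' q'' p' q') (b : BiMap.{u} p' q' p q) : BiMap.{u} p'' q'' p q where
  α := a.α ≫ b.α
  θ := a.θ ≫ b.θ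
  w := by
    rw [Category.assoc, b.w, ← Category.assoc, a.w, Category.assoc]
    exact congrArg (fst _ _ ≫ ·) (SSet.stdSimplex.map_comp a.α b.α).symm

/-- The product of two operators. -/
def prod (α : ⦋p'⦌ ⟶ ⦋p⦌) (β : ⦋q'⦌ ⟶ ⦋q⦌) : BiMap.{u} p' q' p q where
  α := α
  θ := SSet.stdSimplex.map α ⊗ₘ SSet.stdSimplex.map β
  w := by simp

/-- Precomposition of a bisimplex with a map. -/
def act {f : X ⟶ Y} (a : BiMap.{u} p' q' p q) (s : BiSimplex f p q) : BiSimplex f p' q' where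
  σ := a.θ ≫ s.σ
  τ := SSet.stdSimplex.map a.α ≫ s.τ
  w := by rw [Category.assoc, s.w, ← Category.assoc, a.w, Category.assoc]

variable (f : X ⟶ Y) (A : LocalCoeff.{u, v} R X)

/-- The operator on bounded bicochains given by a map of bisimplices. -/
noncomputable def op (a : BiMap.{u} p' q' p q) : BiCochain f A p' q' →ₗ[R] BiCochain f A p q :=
  A.pull (fun s => a.act s) fun s => tr s.σ (a.θ.app _ (vtx p' 0, vtx q' 0)) (vtx p 0, vtx q 0)

theorem op_comp (a : BiMap.{u} p'' q'' p' q') (b : BiMap.{u} p' q' p q)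
    (φ : BiCochain f A p'' q'') : b.op f A (a.op f A φ) = (a.comp b).op f A φ := by
  refine Subtype.ext (funext fun s => ?_)
  refine (LocalCoeff.map_lin_comp A _ _ (φ.1 (a.act (b.act s)))).trans ?_
  refine congrArg (fun g => (A.map g).lin (φ.1 ((a.comp b).act s))) ?_
  exact (congrArg (· ≫ _) (tr_map b.θ s.σ _ _)).trans (tr_comp s.σ _ _ _)

theorem op_id (φ : BiCochain f A p q) : (BiMap.id p q).op f A φ = φ := by
  refine Subtype.ext (funext fun s => ?_)
  refine (congrArg (fun g => (A.map g).lin (φ.1 ((BiMap.id p q).act s))) (tr_self s.σ _)).trans ?_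
  have e : (BiMap.id p q).act s = s := by
    refine BiSimplex.ext (Category.id_comp _) ?_
    exact (congrArg (· ≫ s.τ) (SSet.stdSimplex.map_id _)).trans (Category.id_comp _)
  exact (LocalCoeff.map_lin_id A (φ.1 ((BiMap.id p q).act s))).trans
    (eq_of_heq (congr_arg_heq φ.1 e))

/-- The inverse edge in `biOp` is a canonical path in Δ[p] × Δ[q]. Identities between operators on
bicochains are thereby reduced to identities between maps of products of simplices. -/
theorem op_prod (α : ⦋p'⦌ ⟶ ⦋p⦌) (β : ⦋q'⦌ ⟶ ⦋q⦌) (φ : BiCochain f A p' q') :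
    biOp f A α β φ = (prod α β).op f A φ := by
  refine Subtype.ext (funext fun s => ?_)
  refine congrArg (fun g => (A.map g).lin (φ.1 (s.op α β))) ?_
  exact inv_edge_eq_tr s.σ (prodEdge (stdEdge 0 (α.toOrderHom 0) (Fin.zero_le _))
    (stdEdge 0 (β.toOrderHom 0) (Fin.zero_le _)))

theorem ext_apply {a b : BiMap.{u} p' q' p q} (h₀ : ∀ k, (a.α.toOrderHom k : ℕ) = b.α.toOrderHom k)
    (h : ∀ (m : ℕ) (s : ((Δ[p'] : SSet.{u}) ⊗ Δ[q']) _⦋m⦌) (k : Fin (m + 1)),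
      (((a.θ.app _ s).2 : (Δ[q] : SSet.{u}) _⦋m⦌) k : ℕ) =
          ((b.θ.app _ s).2 : (Δ[q] : SSet.{u}) _⦋m⦌) k) : a = b := by
  have h1 : a.α = b.α :=
    SimplexCategory.Hom.ext _ _ (OrderHom.ext _ _ (funext fun k => Fin.ext (h₀ k)))
  refine BiMap.ext h1 (CartesianMonoidalCategory.hom_ext _ _ ?_ (stdSimplex_hom_ext h))
  rw [a.w, b.w, h1]

/-- The `j`-th simplex of the horizontal prism decomposition contracting `Δ[q]` to its initial
vertex. -/
def prismTop (p q j : ℕ) : BiMap.{u} (p + 1) q p q where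
  α := sOp p j
  θ := lift (fst _ _ ≫ SSet.stdSimplex.map (sOp p j)) (natMap₂ (fun x y => if x ≤ j then 0 else y)
    (fun x x' y y' h h' => by split_ifs <;> omega)
    (fun x h y h' => by split_ifs <;> omega))
  w := by simp

/-- The inner faces of the horizontal prism decomposition. -/
def prismMid (p q j : ℕ) : BiMap.{u} p q p q where
  α := 𝟙 _
  θ := lift (fst _ _) (natMap₂ (fun x y => if x < j then 0 else y)
    (fun x x' y y' h h' => by split_ifs <;> omega)
    (fun x h y h' => by split_ifs <;> omega))
  w := by
    rw [lift_fst]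
    exact ((congrArg (fst _ _ ≫ ·) (SSet.stdSimplex.map_id _)).trans (Category.comp_id _)).symm

/-- The horizontal coface maps. -/
def dH (p q i : ℕ) : BiMap.{u} p q (p + 1) q := prod (dOp p i) (𝟙 _)

/-- The projection to the bottom row. -/
def proj (p q : ℕ) : BiMap.{u} p q p 0 := prod (𝟙 _) (⦋q⦌.const ⦋0⦌ 0)

/-- The inclusion of the bottom row at the initial vertex. -/
def incl (p q : ℕ) : BiMap.{u} p 0 p q := prod (𝟙 _) (⦋0⦌.const ⦋q⦌ 0)

theorem prismTop_lt {i j : ℕ} (h : i < j) (hj : j ≤ p + 1) :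
    (dH (p + 1) q i).comp (prismTop (p + 1) q j) =
      (prismTop.{u} p q (j - 1)).comp (dH p q i) := by
  refine ext_apply (fun k => ?_) (fun m s k => ?_)
  · have hk : (k : ℕ) < p + 2 := k.2
    change min (p + 1) (if (if (k : ℕ) < i then (k : ℕ) else k + 1) ≤ j then
        (if (k : ℕ) < i then (k : ℕ) else k + 1) else
        (if (k : ℕ) < i then (k : ℕ) else k + 1) - 1) =
      if min p (if (k : ℕ) ≤ j - 1 then (k : ℕ) else k - 1) < i then
        min p (if (k : ℕ) ≤ j - 1 then (k : ℕ) else k - 1) else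
        min p (if (k : ℕ) ≤ j - 1 then (k : ℕ) else k - 1) + 1
    split_ifs <;> omega
  · change (if (if (s.1 k : ℕ) < i then (s.1 k : ℕ) else s.1 k + 1) ≤ j then 0 else (s.2 k : ℕ)) =
      if (s.1 k : ℕ) ≤ j - 1 then 0 else (s.2 k : ℕ)
    split_ifs <;> omega

theorem prismTop_gt {i j : ℕ} (h : j + 1 < i) (hi : i ≤ p + 2) :
    (dH (p + 1) q i).comp (prismTop (p + 1) q j) =
      (prismTop.{u} p q j).comp (dH p q (i - 1)) := by
  refine ext_apply (fun k => ?_) (fun m s k => ?_)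
  · have hk : (k : ℕ) < p + 2 := k.2
    change min (p + 1) (if (if (k : ℕ) < i then (k : ℕ) else k + 1) ≤ j then
        (if (k : ℕ) < i then (k : ℕ) else k + 1) else
        (if (k : ℕ) < i then (k : ℕ) else k + 1) - 1) =
      if min p (if (k : ℕ) ≤ j then (k : ℕ) else k - 1) < i - 1 then
        min p (if (k : ℕ) ≤ j then (k : ℕ) else k - 1) else
        min p (if (k : ℕ) ≤ j then (k : ℕ) else k - 1) + 1
    split_ifs <;> omega
  · change (if (if (s.1 k : ℕ) < i then (s.1 k : ℕ) else s.1 k + 1) ≤ j then 0 else (s.2 k : ℕ)) =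
      if (s.1 k : ℕ) ≤ j then 0 else (s.2 k : ℕ)
    split_ifs <;> omega

theorem prismTop_face {i j : ℕ} (h : i = j ∨ i = j + 1) (hj : j ≤ p) :
    (dH p q i).comp (prismTop p q j) = prismMid.{u} p q i := by
  refine ext_apply (fun k => ?_) (fun m s k => ?_)
  · have hk : (k : ℕ) < p + 1 := k.2
    change min p (if (if (k : ℕ) < i then (k : ℕ) else k + 1) ≤ j then
        (if (k : ℕ) < i then (k : ℕ) else k + 1) else
        (if (k : ℕ) < i then (k : ℕ) else k + 1) - 1) = k
    split_ifs <;> omega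
  · change (if (if (s.1 k : ℕ) < i then (s.1 k : ℕ) else s.1 k + 1) ≤ j then 0 else (s.2 k : ℕ)) =
      if (s.1 k : ℕ) < i then 0 else (s.2 k : ℕ)
    split_ifs <;> omega

/-- A cut at 0 changes nothing, while a cut at p + 1 collapses all of Δ[q] to its initial vertex:
the prism joins the identity to the projection onto the bottom row. -/
theorem prismMid_zero : prismMid.{u} p q 0 = BiMap.id p q :=
  ext_apply (fun _ => rfl) fun _ _ _ => rfl

theorem prismMid_last : prismMid.{u} p q (p + 1) = (proj p q).comp (incl p q) :=
  ext_apply (fun _ => rfl) fun _ s k => if_pos (Fin.is_lt (s.1 k))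

theorem incl_comp_proj : (incl.{u} p q).comp (proj p q) = BiMap.id p 0 :=
  ext_apply (fun _ => rfl) fun _ s k => by
    have h1 : ∀ z : Fin 1, (z : ℕ) = 0 := fun z => by omega
    exact (h1 _).trans (h1 _).symm

theorem proj_zero : proj.{u} p 0 = BiMap.id p 0 :=
  ext_apply (fun _ => rfl) fun _ s k => by
    have h1 : ∀ z : Fin 1, (z : ℕ) = 0 := fun z => by omega
    exact (h1 _).trans (h1 _).symm

theorem dH_comp_proj (i : ℕ) : (dH.{u} p q i).comp (proj (p + 1) q) = (proj p q).comp (dH p 0 i) :=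
  ext_apply (fun _ => rfl) fun _ _ _ => rfl

theorem dH_comp_incl (i : ℕ) : (dH.{u} p 0 i).comp (incl (p + 1) q) = (incl p q).comp (dH p q i) :=
  ext_apply (fun _ => rfl) fun _ _ _ => rfl

theorem prod_comp_proj (β : ⦋q'⦌ ⟶ ⦋q⦌) : (prod.{u} (𝟙 ⦋p⦌) β).comp (proj p q) = proj p q' :=
  ext_apply (fun _ => rfl) fun _ _ _ => rfl

end BiMap

end BiOperators

/-! ### The rows of the double complex of a map and convergence. -/

section Rows

variable {R : Type w} [NormedRing R] {X Y : SSet.{u}} (f : X ⟶ Y) (A : LocalCoeff.{u, v} R X)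

theorem bi_dh_eq (p q : ℕ) (φ : BiCochain f A p q) :
    bi_dh f A p q φ =
      ∑ i ∈ Finset.range (p + 2), (-1 : ℤ) ^ i • (BiMap.dH p q i).op f A φ := by
  rw [bi_dh, altSum_apply, ← Fin.sum_univ_eq_sum_range
    (fun i => (-1 : ℤ) ^ i • (BiMap.dH p q i).op f A φ)]
  exact Finset.sum_congr rfl fun i _ => by rw [BiMap.op_prod, BiMap.dH, dOp_eq]

theorem bi_dv_eq (p q : ℕ) (φ : BiCochain f A p q) :
    bi_dv f A p q φ = (-1 : ℤ) ^ p • ∑ j ∈ Finset.range (q + 2),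
      (-1 : ℤ) ^ j • (BiMap.prod (𝟙 ⦋p⦌) (dOp q j)).op f A φ := by
  rw [bi_dv, LinearMap.smul_apply, altSum_apply, ← Fin.sum_univ_eq_sum_range
    (fun j => (-1 : ℤ) ^ j • (BiMap.prod (𝟙 ⦋p⦌) (dOp q j)).op f A φ)]
  refine congrArg _ (Finset.sum_congr rfl fun i _ => ?_)
  rw [BiMap.op_prod, dOp_eq]

/-- The contraction of a row onto the bottom row. -/
noncomputable def rowHomotopy (p q : ℕ) : BiCochain f A (p + 1) q →ₗ[R] BiCochain f A p q :=
  ∑ j ∈ Finset.range (p + 1), (-1 : ℤ) ^ j • (BiMap.prismTop p q j).op f A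

theorem rowHomotopy_apply (p q : ℕ) (φ : BiCochain f A (p + 1) q) :
    rowHomotopy f A p q φ =
      ∑ j ∈ Finset.range (p + 1), (-1 : ℤ) ^ j • (BiMap.prismTop p q j).op f A φ := by
  simp [rowHomotopy, LinearMap.sum_apply]

theorem rowHomotopy_bi_dh (p q : ℕ) (φ : BiCochain f A p q) :
    rowHomotopy f A p q (bi_dh f A p q φ) =
      ∑ j ∈ Finset.range (p + 1), ∑ i ∈ Finset.range (p + 2), (-1 : ℤ) ^ (i + j) •
        ((BiMap.dH p q i).comp (BiMap.prismTop p q j)).op f A φ := by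
  rw [rowHomotopy_apply, bi_dh_eq]
  refine Finset.sum_congr rfl fun j _ => ?_
  rw [map_sum, Finset.smul_sum]
  refine Finset.sum_congr rfl fun i _ => ?_
  rw [map_zsmul, BiMap.op_comp, smul_smul, pow_add, mul_comm]

theorem bi_dh_rowHomotopy (p q : ℕ) (φ : BiCochain f A (p + 1) q) :
    bi_dh f A p q (rowHomotopy f A p q φ) =
      ∑ j ∈ Finset.range (p + 1), ∑ i ∈ Finset.range (p + 2), (-1 : ℤ) ^ (i + j) •
        ((BiMap.prismTop p q j).comp (BiMap.dH p q i)).op f A φ := by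
  rw [bi_dh_eq, rowHomotopy_apply, Finset.sum_comm]
  refine Finset.sum_congr rfl fun i _ => ?_
  rw [map_sum, Finset.smul_sum]
  refine Finset.sum_congr rfl fun j _ => ?_
  rw [map_zsmul, BiMap.op_comp, smul_smul, pow_add]

theorem rowHomotopy_zero (q : ℕ) (φ : BiCochain f A 0 q) :
    rowHomotopy f A 0 q (bi_dh f A 0 q φ) =
      φ - (BiMap.incl 0 q).op f A ((BiMap.proj 0 q).op f A φ) := by
  have h := prism_identity 0
    (fun i j => ((BiMap.dH 0 q i).comp (BiMap.prismTop 0 q j)).op f A φ) (fun _ _ => 0)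
    (fun i => (BiMap.prismMid 0 q i).op f A φ)
    (fun i j h h' => by omega) (fun i j h h' => by omega)
    (fun j hj => by rw [BiMap.prismTop_face (.inl rfl) hj])
    (fun j hj => by rw [BiMap.prismTop_face (.inr rfl) hj])
  rw [BiMap.prismMid_zero, BiMap.prismMid_last, BiMap.op_id, ← BiMap.op_comp, Finset.range_zero,
    Finset.sum_empty, add_zero] at h
  rw [rowHomotopy_bi_dh, h]

theorem rowHomotopy_succ (p q : ℕ) (φ : BiCochain f A (p + 1) q) :
    bi_dh f A p q (rowHomotopy f A p q φ) + rowHomotopy f A (p + 1) q (bi_dh f A (p + 1) q φ) =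
      φ - (BiMap.incl (p + 1) q).op f A ((BiMap.proj (p + 1) q).op f A φ) := by
  have h := prism_identity (p + 1)
    (fun i j => ((BiMap.dH (p + 1) q i).comp (BiMap.prismTop (p + 1) q j)).op f A φ)
    (fun i j => ((BiMap.prismTop p q j).comp (BiMap.dH p q i)).op f A φ)
    (fun i => (BiMap.prismMid (p + 1) q i).op f A φ)
    (fun i j h h' => by rw [BiMap.prismTop_lt h h'])
    (fun i j h h' => by rw [BiMap.prismTop_gt h h'])
    (fun j hj => by rw [BiMap.prismTop_face (.inl rfl) hj])
    (fun j hj => by rw [BiMap.prismTop_face (.inr rfl) hj])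
  rw [BiMap.prismMid_zero, BiMap.prismMid_last, BiMap.op_id, ← BiMap.op_comp] at h
  rw [rowHomotopy_bi_dh, bi_dh_rowHomotopy]
  exact (add_comm _ _).trans h

theorem proj_incl (p q : ℕ) (φ : BiCochain f A p 0) :
    (BiMap.proj p q).op f A ((BiMap.incl p q).op f A φ) = φ := by
  rw [BiMap.op_comp, BiMap.incl_comp_proj, BiMap.op_id]

theorem proj_bi_dh (p q : ℕ) (φ : BiCochain f A p q) :
    (BiMap.proj (p + 1) q).op f A (bi_dh f A p q φ) =
      bi_dh f A p 0 ((BiMap.proj p q).op f A φ) := by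
  rw [bi_dh_eq, bi_dh_eq, map_sum]
  refine Finset.sum_congr rfl fun i _ => ?_
  rw [map_zsmul, BiMap.op_comp, BiMap.op_comp, BiMap.dH_comp_proj]

theorem incl_bi_dh (p q : ℕ) (φ : BiCochain f A p 0) :
    (BiMap.incl (p + 1) q).op f A (bi_dh f A p 0 φ) =
      bi_dh f A p q ((BiMap.incl p q).op f A φ) := by
  rw [bi_dh_eq, bi_dh_eq, map_sum]
  refine Finset.sum_congr rfl fun i _ => ?_
  rw [map_zsmul, BiMap.op_comp, BiMap.op_comp, BiMap.dH_comp_incl]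

/-- After projection to the bottom row all q + 2 vertical faces coincide, which leaves an
alternating sum of equal terms. -/
theorem proj_bi_dv (p q : ℕ) (φ : BiCochain f A p q) :
    (BiMap.proj p (q + 1)).op f A (bi_dv f A p q φ) =
      ((-1 : ℤ) ^ p * ∑ j ∈ Finset.range (q + 2), (-1 : ℤ) ^ j) •
        (BiMap.proj p q).op f A φ := by
  rw [bi_dv_eq, map_zsmul, map_sum, mul_smul, Finset.sum_smul]
  refine congrArg _ (Finset.sum_congr rfl fun j _ => ?_)
  rw [map_zsmul, BiMap.op_comp, BiMap.prod_comp_proj]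

theorem sum_neg_one_pow (q : ℕ) :
    ∑ j ∈ Finset.range q, (-1 : ℤ) ^ j = if Even q then 0 else 1 := neg_one_geom_sum

theorem proj_bi_dv_even (p q : ℕ) (hq : Even q) (φ : BiCochain f A p q) :
    (BiMap.proj p (q + 1)).op f A (bi_dv f A p q φ) = 0 := by
  rw [proj_bi_dv, sum_neg_one_pow, if_pos (by simpa [Nat.even_add] using hq), mul_zero, zero_smul]

theorem proj_bi_dv_odd (p q : ℕ) (hq : Odd q) (φ : BiCochain f A p q) :
    (BiMap.proj p (q + 1)).op f A (bi_dv f A p q φ) = (-1 : ℤ) ^ p • (BiMap.proj p q).op f A φ := by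
  rw [proj_bi_dv, sum_neg_one_pow, if_neg (by simpa [Nat.even_add] using hq), mul_one]

/-- The contraction of the kernel of the projection to the bottom row. -/
noncomputable def rowContraction (p q : ℕ) : BiCochain f A (p + 1) q →ₗ[R] BiCochain f A p q :=
  (LinearMap.id - (BiMap.incl p q).op f A ∘ₗ (BiMap.proj p q).op f A) ∘ₗ rowHomotopy f A p q

theorem rowContraction_apply (p q : ℕ) (x : BiCochain f A (p + 1) q) :
    rowContraction f A p q x = rowHomotopy f A p q x - (BiMap.incl p q).op f A
      ((BiMap.proj p q).op f A (rowHomotopy f A p q x)) := rfl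

theorem proj_rowContraction (p q : ℕ) (x : BiCochain f A (p + 1) q) :
    (BiMap.proj p q).op f A (rowContraction f A p q x) = 0 := by
  rw [rowContraction_apply, map_sub, proj_incl, sub_self]

theorem rowContraction_zero (q : ℕ) (x : BiCochain f A 0 q)
    (hx : (BiMap.proj 0 q).op f A x = 0) :
    rowContraction f A 0 q (bi_dh f A 0 q x) = x := by
  rw [rowContraction_apply, rowHomotopy_zero, hx, map_zero, sub_zero, hx, map_zero, sub_zero]

/-- The projection 1 − incl ∘ proj commutes with d_h. Composing the homotopy with it preserves the
homotopy relation on the kernel of proj and forces the values into this kernel. -/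
theorem rowContraction_succ (p q : ℕ) (x : BiCochain f A (p + 1) q)
    (hx : (BiMap.proj (p + 1) q).op f A x = 0) :
    bi_dh f A p q (rowContraction f A p q x) +
      rowContraction f A (p + 1) q (bi_dh f A (p + 1) q x) = x := by
  have h := rowHomotopy_succ f A p q x
  rw [hx, map_zero, sub_zero] at h
  have h2 := congrArg (fun y => (BiMap.incl (p + 1) q).op f A ((BiMap.proj (p + 1) q).op f A y)) h
  rw [hx, map_zero, map_add, map_add, proj_bi_dh, incl_bi_dh] at h2
  rw [rowContraction_apply, rowContraction_apply, map_sub, sub_add_sub_comm, h, h2, sub_zero]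

/-- The rows of the double complex of a map retract to the bottom row. -/
noncomputable def rowRetraction : (doubleComplex f A).RowRetraction where
  s p q := (BiMap.proj p q).op f A
  i p q := (BiMap.incl p q).op f A
  s_i := proj_incl f A
  s_zero _ x := (congrArg (fun m => BiMap.op f A m x) BiMap.proj_zero).trans (BiMap.op_id f A x)
  s_dh := proj_bi_dh f A
  s_dv_even := proj_bi_dv_even f A
  s_dv_odd := proj_bi_dv_odd f A
  h := rowContraction f A
  h_zero := rowContraction_zero f A
  h_succ := rowContraction_succ f A
  s_h := proj_rowContraction f A

/-- The bisimplex of bidegree `(n, 0)` given by a simplex. -/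
def bottomSimplex {n : ℕ} (σ : (Δ[n] : SSet.{u}) ⟶ X) : BiSimplex f n 0 where
  σ := fst _ _ ≫ σ
  τ := σ ≫ f
  w := Category.assoc _ _ _

theorem bottomSimplex_lift {n : ℕ} (s : BiSimplex f n 0) :
    bottomSimplex f (lift (𝟙 _) (SSet.const (vtx 0 0)) ≫ s.σ) = s := by
  refine BiSimplex.ext ?_ ?_
  · have h : fst (Δ[n] : SSet.{u}) Δ[0] ≫ lift (𝟙 _) (SSet.const (vtx 0 0)) = 𝟙 _ := by
      refine CartesianMonoidalCategory.hom_ext _ _ (by simp) (stdSimplex_hom_ext fun m s k => ?_)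
      have h1 : ∀ z : Fin 1, (z : ℕ) = 0 := fun z => by omega
      exact (h1 _).trans (h1 _).symm
    change fst _ _ ≫ lift (𝟙 _) (SSet.const (vtx 0 0)) ≫ s.σ = s.σ
    rw [← Category.assoc, h, Category.id_comp]
  · change (lift (𝟙 _) (SSet.const (vtx 0 0)) ≫ s.σ) ≫ f = s.τ
    rw [Category.assoc, s.w, ← Category.assoc, lift_fst, Category.id_comp]

/-- The bottom row of the double complex consists of the bounded cochains on the source. -/
noncomputable def bottomEquiv (n : ℕ) : BiCochain f A n 0 ≃ₗ[R] Cochain A n where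
  toFun φ := ⟨fun σ => φ.1 (bottomSimplex f σ), by
    obtain ⟨C, hC⟩ := SnMod.bprod_bddAbove φ
    refine ⟨C, ?_⟩
    rintro _ ⟨σ, rfl⟩
    exact hC ⟨bottomSimplex f σ, rfl⟩⟩
  map_add' _ _ := rfl
  map_smul' _ _ := rfl
  invFun ψ := ⟨fun s => ψ.1 (lift (𝟙 _) (SSet.const (vtx 0 0)) ≫ s.σ), by
    obtain ⟨C, hC⟩ := SnMod.bprod_bddAbove ψ
    refine ⟨C, ?_⟩
    rintro _ ⟨s, rfl⟩
    exact hC ⟨lift (𝟙 _) (SSet.const (vtx 0 0)) ≫ s.σ, rfl⟩⟩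
  left_inv φ := Subtype.ext (funext fun s =>
    eq_of_heq (congr_arg_heq φ.1 (bottomSimplex_lift f s)))
  right_inv ψ := rfl

theorem bottomEquiv_dh (n : ℕ) (φ : BiCochain f A n 0) :
    cobdry A n (bottomEquiv f A n φ) = bottomEquiv f A (n + 1) (bi_dh f A n 0 φ) := by
  rw [cobdry, bi_dh, altSum_apply, altSum_apply, map_sum]
  refine Finset.sum_congr rfl fun i _ => ?_
  rw [map_zsmul]
  rfl

/-- Convergence is formal: the rows retract onto the cochains of X for an arbitrary map f. -/
theorem spectralSeq_convergesTo (S : (doubleComplex f A).SpectralSeq) :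
    S.ConvergesTo fun n => Hb A n :=
  (rowRetraction f A).convergesTo S (cochainComplex A) (bottomEquiv f A) (bottomEquiv_dh f A)

end Rows

/-! ### Simplices of mapping spaces -/

section MappingSpace

variable {X Y : SSet.{u}} (f : X ⟶ Y) {p : ℕ} (τ : (Δ[p] : SSet.{u}) ⟶ Y)

/-- The canonical simplex of `{a} × Δ[n]` in `Δ[p] × Δ[n]`, for a simplex `a` of `Δ[p]`. -/
def evalAt {p : ℕ} (n : SimplexCategoryᵒᵖ) (a : (Δ[p] : SSet.{u}).obj n) :
    ((Δ[p] : SSet.{u}) ⊗ SSet.stdSimplex.obj n.unop).obj n :=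
  (a, SSet.stdSimplex.objEquiv.symm (𝟙 n.unop))

/-- The evaluation map of the fiber over a simplex. -/
def evF : Δ[p] ⊗ simplexFiber f τ ⟶ X where
  app n := ↾fun s => s.2.1.app n (evalAt n s.1)
  naturality n m α := by
    refine ConcreteCategory.hom_ext _ _ fun s => ?_
    refine Eq.trans ?_ (NatTrans.naturality_apply s.2.1 α (evalAt n s.1))
    refine congrArg (s.2.1.app m) (Prod.ext rfl ?_)
    exact congrArg SSet.stdSimplex.objEquiv.symm ((Category.id_comp α.unop).trans
      (Category.comp_id α.unop).symm)

theorem evF_comp : evF f τ ≫ f = fst _ _ ≫ τ :=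
  NatTrans.ext (funext fun n => ConcreteCategory.hom_ext _ _ fun s =>
    app_congr s.2.2 n (evalAt n s.1))

variable {K K' : SSet.{u}}

/-- The map out of a product given by a map into the fiber over a simplex. -/
def uncurryF (κ : K ⟶ simplexFiber f τ) : Δ[p] ⊗ K ⟶ X := (Δ[p] ◁ κ) ≫ evF f τ

theorem uncurryF_comp (κ : K ⟶ simplexFiber f τ) : uncurryF f τ κ ≫ f = fst _ _ ≫ τ := by
  rw [uncurryF, Category.assoc, evF_comp, ← Category.assoc, whiskerLeft_fst]

theorem uncurryF_whisker (g : K' ⟶ K) (κ : K ⟶ simplexFiber f τ) :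
    (Δ[p] ◁ g) ≫ uncurryF f τ κ = uncurryF f τ (g ≫ κ) := by
  rw [uncurryF, uncurryF, whiskerLeft_comp, Category.assoc]

variable {f τ}

/-- The map into the fiber over a simplex given by a map out of a product. -/
def curryF (g : Δ[p] ⊗ K ⟶ X) (hg : g ≫ f = fst _ _ ≫ τ) : K ⟶ simplexFiber f τ where
  app n := ↾fun x => ⟨(Δ[p] ◁ yonedaEquiv.symm x) ≫ g, by
    rw [Category.assoc, hg, ← Category.assoc, whiskerLeft_fst]⟩
  naturality n m α := by
    refine ConcreteCategory.hom_ext _ _ fun x => Subtype.ext ?_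
    change (Δ[p] ◁ yonedaEquiv.symm (K.map α x)) ≫ g =
      (Δ[p] ◁ SSet.stdSimplex.map α.unop) ≫ (Δ[p] ◁ yonedaEquiv.symm x) ≫ g
    rw [← Category.assoc, ← whiskerLeft_comp]
    refine congrArg (fun z => (Δ[p] ◁ z) ≫ g) ?_
    exact (yonedaEquiv_symm_naturality_left α.unop x).symm

theorem yonedaEquiv_symm_app_id' {n : SimplexCategoryᵒᵖ} (x : K.obj n) :
    (yonedaEquiv.symm x).app n (SSet.stdSimplex.objEquiv.symm (𝟙 n.unop)) = x :=
  (Functor.map_id_apply K n x : K.map (𝟙 n) x = x)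

theorem uncurryF_curryF (g : Δ[p] ⊗ K ⟶ X) (hg : g ≫ f = fst _ _ ≫ τ) :
    uncurryF f τ (curryF g hg) = g :=
  NatTrans.ext (funext fun n => ConcreteCategory.hom_ext _ _ fun s =>
    congrArg (fun z => g.app n (s.1, z)) (yonedaEquiv_symm_app_id' s.2))

/-- A simplex of F_τ is itself a map out of Δ[p] × Δ[n], and the value of κ at x is the restriction
of the uncurried map along x. -/
theorem uncurryF_injective {κ κ' : K ⟶ simplexFiber f τ} (h : uncurryF f τ κ = uncurryF f τ κ') :
    κ = κ' := by
  have key (κ : K ⟶ simplexFiber f τ) (n) (x : K.obj n) :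
      (κ.app n x).1 = (Δ[p] ◁ yonedaEquiv.symm x) ≫ uncurryF f τ κ := by
    refine NatTrans.ext (funext fun m => ConcreteCategory.hom_ext _ _ fun s => ?_)
    have h1 : κ.app m ((yonedaEquiv.symm x).app m s.2) =
        (simplexFiber f τ).map (SSet.stdSimplex.objEquiv s.2).op (κ.app n x) :=
      NatTrans.naturality_apply κ (SSet.stdSimplex.objEquiv s.2).op x
    refine Eq.symm ((congrArg (fun z => (evF f τ).app m (s.1, z)) h1).trans ?_)
    refine congrArg ((κ.app n x).1.app m) (Prod.ext rfl ?_)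
    exact (congrArg SSet.stdSimplex.objEquiv.symm (Category.id_comp _)).trans
      (Equiv.symm_apply_apply _ _)
  refine NatTrans.ext (funext fun n => ConcreteCategory.hom_ext _ _ fun x => Subtype.ext ?_)
  rw [key, key, h]

theorem curryF_uncurryF (κ : K ⟶ simplexFiber f τ) :
    curryF (uncurryF f τ κ) (uncurryF_comp f τ κ) = κ :=
  uncurryF_injective (uncurryF_curryF _ _)

end MappingSpace

/-! ### Restriction of fibers to vertices -/

section Restriction

theorem mem_face_singleton {p : ℕ} {i : Fin (p + 1)} {m : ℕ} {x : (Δ[p] : SSet.{u}) _⦋m⦌} :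
    x ∈ (SSet.stdSimplex.face {i} : (Δ[p] : SSet.{u}).Subcomplex).obj (op ⦋m⦌) ↔
      ∀ k, x k = i :=
  (SSet.stdSimplex.mem_face_iff _ _).trans (forall_congr' fun _ => Finset.mem_singleton)

theorem face_singleton_eq_horn (i : Fin 2) :
    (SSet.stdSimplex.face {i} : (Δ[1] : SSet.{u}).Subcomplex) = Λ[1, i] := by
  refine Subfunctor.ext (funext fun m => Set.ext fun x => ?_)
  refine (mem_face_singleton (m := m.unop.len)).trans ?_
  refine Iff.trans ?_ (mem_horn_iff i x).symm
  rw [Ne, Set.eq_univ_iff_forall, not_forall]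
  have aux : ∀ i : Fin 2, i.rev ≠ i := by decide
  constructor
  · intro h
    refine ⟨i.rev, ?_⟩
    rintro (⟨k, hk⟩ | hk)
    · exact aux i (hk.symm.trans (h k))
    · exact aux i hk
  · rintro ⟨j, hj⟩ k
    have h1 : SSet.stdSimplex.asOrderHom x k ≠ j := fun h => hj (.inl ⟨k, h⟩)
    have h2 : j ≠ i := fun h => hj (.inr h)
    change SSet.stdSimplex.asOrderHom x k = i
    generalize SSet.stdSimplex.asOrderHom x k = y at *
    omega

theorem anodyne_face_one (i : Fin 2) :
    anodyneExtensions (SSet.stdSimplex.face {i} : (Δ[1] : SSet.{u}).Subcomplex).ι := by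
  rw [face_singleton_eq_horn]
  exact anodyneExtensions.horn_ι i

/-- {0} ⟶ Δ[p] is a retract of its pushout product with {0} ⟶ Δ[1], which is anodyne: Δ[p] sits in
Δ[1] × Δ[p] at the end 1, and `r` retracts onto it while sending the end 0 to the vertex 0. -/
theorem anodyne_face_zero (p : ℕ) :
    anodyneExtensions (SSet.stdSimplex.face {0} : (Δ[p] : SSet.{u}).Subcomplex).ι := by
  intro E B g hg
  let S : (Δ[p] : SSet.{u}).Subcomplex := SSet.stdSimplex.face {0}
  let T : (Δ[1] : SSet.{u}).Subcomplex := SSet.stdSimplex.face {0}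
  let U : ((Δ[1] : SSet.{u}) ⊗ Δ[p]).Subcomplex := T.unionProd S
  have hU : HasLiftingProperty U.ι g :=
    anodyneExtensions_unionProd_ι' T S (anodyne_face_one 0) _ hg
  let r : (Δ[1] : SSet.{u}) ⊗ Δ[p] ⟶ Δ[p] := natMap₂ (fun x y => if x = 0 then 0 else y)
    (fun x x' y y' h h' => by split_ifs <;> omega) (fun x h y h' => by split_ifs <;> omega)
  have hr (m : ℕ) (s : (U : SSet.{u}) _⦋m⦌) : r.app _ s.1 ∈ S.obj (op ⦋m⦌) := by
    rw [mem_face_singleton]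
    intro k
    refine Fin.ext ((natMap₂_app _ _ _ s.1 k).trans ?_)
    rcases (Subcomplex.mem_unionProd_iff T S s.1).1 s.2 with h | h
    · rw [mem_face_singleton.1 h k]
      split_ifs <;> rfl
    · rw [mem_face_singleton.1 h k]
      rfl
  refine ⟨fun {a b} sq => ⟨⟨?_⟩⟩⟩
  let r' : (U : SSet.{u}) ⟶ S := Subfunctor.lift (U.ι ≫ r) (by
    rintro m _ ⟨s, rfl⟩
    exact hr m.unop.len s)
  have hr' : r' ≫ S.ι = U.ι ≫ r := rfl
  have sq' : CommSq (r' ≫ a) U.ι g (r ≫ b) := ⟨by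
    rw [Category.assoc, sq.w, ← Category.assoc, hr', Category.assoc]⟩
  let j : (Δ[p] : SSet.{u}) ⟶ Δ[1] ⊗ Δ[p] := lift (SSet.const (vtx 1 1)) (𝟙 _)
  have hj : j ≫ r = 𝟙 _ := stdSimplex_hom_ext fun m s k => rfl
  let j' : (S : SSet.{u}) ⟶ U := Subfunctor.lift (S.ι ≫ j) (by
    rintro m _ ⟨s, rfl⟩
    exact (Subcomplex.mem_unionProd_iff T S _).2 (.inl s.2))
  have hj' : j' ≫ r' = 𝟙 _ := by
    rw [← cancel_mono S.ι, Category.id_comp, Category.assoc, hr', ← Category.assoc]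
    change (S.ι ≫ j) ≫ r = _
    rw [Category.assoc, hj, Category.comp_id]
  refine ⟨j ≫ sq'.lift, ?_, ?_⟩
  · have : S.ι ≫ j = j' ≫ U.ι := rfl
    rw [← Category.assoc, this, Category.assoc, sq'.fac_left, ← Category.assoc, hj',
      Category.id_comp]
  · rw [Category.assoc, sq'.fac_right, ← Category.assoc, hj, Category.id_comp]

variable {X Y : SSet.{u}} (f : X ⟶ Y) {p : ℕ} (τ : (Δ[p] : SSet.{u}) ⟶ Y)

/-- The restriction of the fiber over a simplex to the fiber over a vertex. -/
def resTo (i : Fin (p + 1)) {y : Y _⦋0⦌} (h : τ.app _ (vtx p i) = y) :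
    simplexFiber f τ ⟶ (fiber f y).toSSet :=
  Subfunctor.lift (evalVtx f τ i) (by
    rintro n _ ⟨σ, rfl⟩
    subst h
    exact app_congr (evalVtx_comp f τ i) n σ)

/-- By adjunction, lifting ∂Δ[n] ⟶ Δ[n] against the restriction amounts to lifting Δ[p] × ∂Δ[n] ∪
{i} × Δ[n] ⟶ Δ[p] × Δ[n] against f. This inclusion is anodyne because {i} ⟶ Δ[p] is. -/
theorem resTo_rlp [HomotopicalAlgebra.Fibration f] (i : Fin (p + 1))
    (hi : anodyneExtensions (SSet.stdSimplex.face {i} : (Δ[p] : SSet.{u}).Subcomplex).ι)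
    {y : Y _⦋0⦌} (h : τ.app _ (vtx p i) = y) :
    (MorphismProperty.monomorphisms SSet.{u}).rlp (resTo f τ i h) := by
  rw [rlp_monomorphisms]
  rintro _ _ _ ⟨n⟩
  let S : (Δ[p] : SSet.{u}).Subcomplex := SSet.stdSimplex.face {i}
  let T : (Δ[n] : SSet.{u}).Subcomplex := ∂Δ[n]
  refine ⟨fun {a b} sq => ⟨⟨?_⟩⟩⟩
  have hS (m : SimplexCategoryᵒᵖ) (s : (S : SSet.{u}).obj m) :
      s.1 = SSet.stdSimplex.const p i m :=
    SSet.stdSimplex.ext (n := p) (d := m.unop.len) _ _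
      (mem_face_singleton (m := m.unop.len).1 s.2)
  have hw : S.ι ▷ (T : SSet.{u}) ≫ uncurryF f τ a =
      (S : SSet.{u}) ◁ T.ι ≫ snd _ _ ≫ b ≫ (fiber f y).ι := by
    refine NatTrans.ext (funext fun m => ConcreteCategory.hom_ext _ _ fun s => ?_)
    change (evF f τ).app m (s.1.1, a.app m s.2) = (b.app m s.2.1).1
    rw [hS m s.1]
    exact congrArg Subtype.val (app_congr sq.w m s.2)
  have hP := Subcomplex.unionProd.isPushout S T
  have hW₁ := hP.inl_desc _ _ hw
  have hW₂ := hP.inr_desc _ _ hw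
  have hU : HasLiftingProperty (S.unionProd T).ι f :=
    anodyneExtensions_unionProd_ι' S T hi _ (HomotopicalAlgebra.mem_fibrations f)
  have sq' : CommSq (hP.desc _ _ hw) (S.unionProd T).ι f (fst _ _ ≫ τ) := ⟨by
    refine hP.hom_ext ?_ ?_
    · rw [← Category.assoc, hW₁, uncurryF_comp]
      rfl
    · rw [← Category.assoc, hW₂]
      refine NatTrans.ext (funext fun m => ConcreteCategory.hom_ext _ _ fun s => ?_)
      change f.app m (b.app m s.2).1 = τ.app m s.1.1
      rw [hS m s.1]
      refine (b.app m s.2).2.trans ?_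
      subst h
      exact (NatTrans.naturality_apply τ (m.unop.const _ 0).op (vtx p i)).symm⟩
  have h₁ : Δ[p] ◁ T.ι ≫ sq'.lift = uncurryF f τ a :=
    (congrArg (Subcomplex.unionProd.ι₁ S T ≫ ·) sq'.fac_left).trans hW₁
  have h₂ : S.ι ▷ (Δ[n] : SSet.{u}) ≫ sq'.lift = snd _ _ ≫ b ≫ (fiber f y).ι :=
    (congrArg (Subcomplex.unionProd.ι₂ S T ≫ ·) sq'.fac_left).trans hW₂
  refine ⟨curryF sq'.lift sq'.fac_right, ?_, ?_⟩
  · apply uncurryF_injective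
    rw [← uncurryF_whisker, uncurryF_curryF, h₁]
  · rw [← cancel_mono (fiber f y).ι]
    refine NatTrans.ext (funext fun m => ConcreteCategory.hom_ext _ _ fun s => ?_)
    have h₃ := app_congr (uncurryF_curryF sq'.lift sq'.fac_right) m
      (SSet.stdSimplex.const p i m, s)
    have hc : SSet.stdSimplex.const p i m ∈ S.obj m :=
      (mem_face_singleton (m := m.unop.len)).2 fun _ => rfl
    exact h₃.trans (app_congr h₂ m (⟨SSet.stdSimplex.const p i m, hc⟩, s))

end Restriction

/-! ### Paths in fibers -/

section FiberPaths

variable {K K' L L' X : SSet.{u}} [Coned K] [Coned K']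

/-- The canonical path between two vertices of `K × {z}`. -/
noncomputable def trL (a : K ⊗ L ⟶ X) (z : L _⦋0⦌) (i k : K _⦋0⦌) :
    FundGrpd.pt (a.app (op ⦋0⦌) (i, z)) ⟶ FundGrpd.pt (a.app (op ⦋0⦌) (k, z)) :=
  inv (FundGrpd.edge ((prodEdge (Coned.e i) (Edge.id z)).map a)) ≫
    FundGrpd.edge ((prodEdge (Coned.e k) (Edge.id z)).map a)

instance (a : K ⊗ L ⟶ X) (z : L _⦋0⦌) (i k : K _⦋0⦌) : IsIso (trL a z i k) := by
  unfold trL; infer_instance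

theorem trL_self (a : K ⊗ L ⟶ X) (z : L _⦋0⦌) (i : K _⦋0⦌) : trL a z i i = 𝟙 _ :=
  IsIso.inv_hom_id _

theorem trL_comp (a : K ⊗ L ⟶ X) (z : L _⦋0⦌) (i j k : K _⦋0⦌) :
    trL a z i j ≫ trL a z j k = trL a z i k := by
  unfold trL
  rw [Category.assoc, IsIso.hom_inv_id_assoc]

theorem trL_edge (a : K ⊗ L ⟶ X) (z : L _⦋0⦌) {i k : K _⦋0⦌} (ε : Edge i k) :
    trL a z i k = FundGrpd.edge ((prodEdge ε (Edge.id z)).map a) := by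
  unfold trL
  rw [IsIso.inv_comp_eq]
  exact (FundGrpd.edge_comp ((prodTriangle (Coned.tri ε)
    (Edge.CompStruct.idComp (Edge.id z))).map a)).symm

theorem trL_map (θ : K' ⟶ K) (a : K ⊗ L ⟶ X) (z : L _⦋0⦌) (i k : K' _⦋0⦌) :
    trL (θ ▷ L ≫ a) z i k = trL a z (θ.app _ i) (θ.app _ k) := by
  have h (x : K' _⦋0⦌) : FundGrpd.edge ((prodEdge (Coned.e x) (Edge.id z)).map (θ ▷ L ≫ a)) =
      trL a z (θ.app _ Coned.pt) (θ.app _ x) := (trL_edge a z ((Coned.e x).map θ)).symm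
  refine (IsIso.inv_comp_eq _).2 ?_
  exact (h k).trans ((trL_comp a z _ _ _).symm.trans (congrArg (· ≫ _) (h i).symm))

theorem prodEdge_id_map {K : SSet.{u}} (g : L' ⟶ L) (a : K ⊗ L ⟶ X) (z : L' _⦋0⦌) {i k : K _⦋0⦌} (ε : Edge i k) :
    (prodEdge ε (Edge.id z)).map (K ◁ g ≫ a) = (prodEdge ε (Edge.id (g.app _ z))).map a :=
  congrArg (fun e => (prodEdge ε e).map a) (Edge.map_id z g)

theorem trL_whisker (g : L' ⟶ L) (a : K ⊗ L ⟶ X) (z : L' _⦋0⦌) (i k : K _⦋0⦌) :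
    trL (K ◁ g ≫ a) z i k = trL a (g.app _ z) i k := by
  refine (IsIso.inv_comp_eq _).2 ?_
  refine (congrArg FundGrpd.edge (prodEdge_id_map g a z (Coned.e k))).trans ?_
  refine Eq.trans ?_ (congrArg (fun e => FundGrpd.edge e ≫ trL a (g.app _ z) i k)
    (prodEdge_id_map g a z (Coned.e i)).symm)
  exact (IsIso.hom_inv_id_assoc _ _).symm

theorem trL_eq_tr [Coned L] (a : K ⊗ L ⟶ X) (z : L _⦋0⦌) (i k : K _⦋0⦌) :
    trL a z i k = tr a (i, z) (k, z) := by
  refine (IsIso.inv_comp_eq _).2 ?_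
  exact (tr_edge a (prodEdge (Coned.e k) (Edge.id z))).symm.trans ((tr_comp a _ _ _).symm.trans
    (congrArg (· ≫ tr a (i, z) (k, z)) (tr_edge a (prodEdge (Coned.e i) (Edge.id z)))))

/-- The product of a cone edge with `e` is a square cut by its diagonal into two triangles, so it
commutes; a path from i to k is a quotient of two cone edges. -/
theorem trL_nat (a : K ⊗ L ⟶ X) {x y : L _⦋0⦌} (e : Edge x y) (i k : K _⦋0⦌) :
    FundGrpd.edge ((prodEdge (Edge.id i) e).map a) ≫ trL a y i k =
      trL a x i k ≫ FundGrpd.edge ((prodEdge (Edge.id k) e).map a) := by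
  have h (i : K _⦋0⦌) :
      FundGrpd.edge ((prodEdge (Coned.e i) (Edge.id x)).map a) ≫
        FundGrpd.edge ((prodEdge (Edge.id i) e).map a) =
      FundGrpd.edge ((prodEdge (Edge.id Coned.pt) e).map a) ≫
        FundGrpd.edge ((prodEdge (Coned.e i) (Edge.id y)).map a) :=
    (FundGrpd.edge_comp ((prodTriangle (Edge.CompStruct.compId (Coned.e i))
        (Edge.CompStruct.idComp e)).map a)).trans
      (FundGrpd.edge_comp ((prodTriangle (Edge.CompStruct.idComp (Coned.e i))
        (Edge.CompStruct.compId e)).map a)).symm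
  unfold trL
  rw [Category.assoc, h k, IsIso.eq_inv_comp, ← Category.assoc, h i, Category.assoc,
    IsIso.hom_inv_id_assoc]

end FiberPaths

/-! ### Coefficient maps between fibers over simplices. -/

section FiberMaps

variable {R : Type w} [NormedRing R] {X Y : SSet.{u}} (f : X ⟶ Y) (A : LocalCoeff.{u, v} R X)
variable {p p' : ℕ} (τ : (Δ[p] : SSet.{u}) ⟶ Y)

theorem edge_evalVtx {x y : (simplexFiber f τ) _⦋0⦌} (e : Edge x y) (i : Fin (p + 1)) :
    (FundGrpd.map (evalVtx f τ i)).map (FundGrpd.edge e) =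
      FundGrpd.edge ((prodEdge (Edge.id (vtx p i)) e).map (evF f τ)) :=
  FundGrpd.map_edge _ _

/-- Pullback of coefficients from the fiber over the vertex `i` to the fiber over a simplex, with
values transported to the vertex `k`. -/
noncomputable def resCoeff (i k : Fin (p + 1)) {y : Y _⦋0⦌} (h : τ.app _ (vtx p i) = y) :
    CoeffMap (resTo f τ i h) (fiberCoeff f A y) (A.pullback (evalVtx f τ k)) where
  app x := A.map (trL (evF f τ) x (vtx p i) (vtx p k))
  nat {x y} e := by
    have h1 : (FundGrpd.map (fiber f _).ι).map (FundGrpd.edge (e.map (resTo f τ i h))) =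
      FundGrpd.edge ((prodEdge (Edge.id (vtx p i)) e).map (evF f τ)) := FundGrpd.map_edge _ _
    have h2 := edge_evalVtx f τ e k
    refine (congrArg (fun g => A.map g ≫ _) h1).trans ?_
    refine Eq.trans ?_ (congrArg (fun g => _ ≫ A.map g) h2).symm
    exact (A.map_comp _ _).symm.trans
      ((congrArg A.map (trL_nat (evF f τ) e _ _)).trans (A.map_comp _ _))

instance (i k : Fin (p + 1)) {y : Y _⦋0⦌} (h : τ.app _ (vtx p i) = y)
    (x : (simplexFiber f τ) _⦋0⦌) : IsIso ((resCoeff f A τ i k h).app x) :=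
  inferInstanceAs (IsIso (A.map (trL (evF f τ) x (vtx p i) (vtx p k))))

variable {τ} {τ' : (Δ[p'] : SSet.{u}) ⟶ Y} {α : ⦋p'⦌ ⟶ ⦋p⦌} (hθ : SSet.stdSimplex.map α ≫ τ = τ')

/-- Restriction of fibers over simplices along a map of standard simplices. -/
def resF : simplexFiber f τ ⟶ simplexFiber f τ' where
  app n := ↾fun σ => ⟨SSet.stdSimplex.map α ▷ SSet.stdSimplex.obj n.unop ≫ σ.1, by
    rw [Category.assoc, σ.2, ← hθ, ← Category.assoc, whiskerRight_fst, Category.assoc]⟩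
  naturality _ _ _ := rfl

/-- The map of coefficient systems covering `resF`. -/
noncomputable def resFCoeff (i : Fin (p' + 1)) (k : Fin (p + 1)) :
    CoeffMap (resF f hθ) (A.pullback (evalVtx f τ' i)) (A.pullback (evalVtx f τ k)) where
  app x := A.map (trL (evF f τ) x (vtx p (α.toOrderHom i)) (vtx p k))
  nat {x y} e := by
    have h1 : (FundGrpd.map (evalVtx f τ' i)).map (FundGrpd.edge (e.map (resF f hθ))) =
      FundGrpd.edge ((prodEdge (Edge.id (vtx p (α.toOrderHom i))) e).map (evF f τ)) :=
      FundGrpd.map_edge _ _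
    have h2 := edge_evalVtx f τ e k
    refine (congrArg (fun g => A.map g ≫ _) h1).trans ?_
    refine Eq.trans ?_ (congrArg (fun g => _ ≫ A.map g) h2).symm
    exact (A.map_comp _ _).symm.trans
      ((congrArg A.map (trL_nat (evF f τ) e _ _)).trans (A.map_comp _ _))

theorem trL_resF (x : (simplexFiber f τ) _⦋0⦌) (i k : Fin (p' + 1)) :
    trL (evF f τ') ((resF f hθ).app _ x) (vtx p' i) (vtx p' k) =
      trL (evF f τ) x (vtx p (α.toOrderHom i)) (vtx p (α.toOrderHom k)) :=
  (trL_whisker (resF f hθ) (evF f τ') x (vtx p' i) (vtx p' k)).symm.trans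
    (trL_map (SSet.stdSimplex.map α) (evF f τ) x (vtx p' i) (vtx p' k))

/-- Restricting F_τ to a face and then to a vertex of the face is restricting to that vertex; the
intermediate vertex i' of the coefficients cancels by `trL_comp`. -/
theorem resFCoeff_resCoeff (i i' : Fin (p' + 1)) (k : Fin (p + 1)) {y : Y _⦋0⦌}
    (h : τ'.app _ (vtx p' i) = y) (h' : τ.app _ (vtx p (α.toOrderHom i)) = y) {n : ℕ}
    (φ : Cochain (fiberCoeff f A y) n) :
    (resFCoeff f A hθ i' k).cochain n ((resCoeff f A τ' i i' h).cochain n φ) =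
      (resCoeff f A τ (α.toOrderHom i) k h').cochain n φ := by
  refine Subtype.ext (funext fun κ => ?_)
  refine (LocalCoeff.map_lin_comp A _ _ _).trans ?_
  refine congrArg (fun g => (A.map g).lin (φ.1 (κ ≫ resTo f τ (α.toOrderHom i) h'))) ?_
  exact (congrArg (· ≫ trL (evF f τ) (vtx₀ κ) (vtx p (α.toOrderHom i')) (vtx p k))
    (trL_resF f hθ (vtx₀ κ) i i')).trans (trL_comp _ _ _ _ _)

/-- The edge of X given by x ∈ (F_γ)₀ is the canonical path in Δ[1] × {x}. This identifies the
zigzag of the statement with a case of `resCoeff`. -/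
theorem resSrcCochain_eq {y z : Y _⦋0⦌} (γ : Edge y z) (q : ℕ) :
    resSrcCochain f A γ q = (resCoeff f A (edgeMap γ) 0 1 (edgeMap_zero γ)).cochain q := by
  refine LinearMap.ext fun φ => Subtype.ext (funext fun κ => ?_)
  refine congrArg (fun g => (A.map g).lin (φ.1 (κ ≫ resSrc f γ))) ?_
  refine Eq.symm ((trL_edge (evF f (edgeMap γ)) (vtx₀ κ) (stdEdge 0 1 (Fin.zero_le _))).trans ?_)
  refine congrArg FundGrpd.edge (Edge.ext ?_)
  refine congrArg ((vtx₀ κ).1.app _) (Prod.ext rfl ?_)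
  refine SSet.stdSimplex.ext (n := 0) (d := 1) _ _ fun k => Subsingleton.elim (α := Fin 1) _ _

theorem resTgtCochain_eq {y z : Y _⦋0⦌} (γ : Edge y z) (q : ℕ) :
    resTgtCochain f A γ q = (resCoeff f A (edgeMap γ) 1 1 (edgeMap_one γ)).cochain q := by
  refine LinearMap.ext fun φ => Subtype.ext (funext fun κ => ?_)
  exact congrArg (fun g => (A.map g).lin (φ.1 (κ ≫ resTgt f γ)))
    (trL_self (evF f (edgeMap γ)) (vtx₀ κ) (vtx 1 1)).symm

end FiberMaps

/-! ### The local coefficient system of the cohomology of the fibers -/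

section Transport

variable {R : Type w} [NormedRing R] {X Y : SSet.{u}} (f : X ⟶ Y) (A : LocalCoeff.{u, v} R X)
variable {y z : Y _⦋0⦌} (γ : Edge y z)

/-- The chain map induced by the restriction of the fiber over an edge to its initial vertex. -/
noncomputable def srcMap :
    SnComplex.CMap (cochainComplex (fiberCoeff f A y)) (cochainComplex (edgeFiberCoeff f A γ)) :=
  (resCoeff f A (edgeMap γ) 0 1 (edgeMap_zero γ)).cmap

/-- The chain map induced by the restriction of the fiber over an edge to its final vertex. -/
noncomputable def tgtMap :
    SnComplex.CMap (cochainComplex (fiberCoeff f A z)) (cochainComplex (edgeFiberCoeff f A γ)) :=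
  (resCoeff f A (edgeMap γ) 1 1 (edgeMap_one γ)).cmap

variable [HomotopicalAlgebra.Fibration f]

/-- A deformation retraction for `srcMap`. -/
noncomputable def srcRetraction : (srcMap f A γ).Retraction :=
  (CoeffMap.exists_retraction _ (resTo_rlp f _ 0 (anodyne_face_one 0) (edgeMap_zero γ))).some

/-- A deformation retraction for `tgtMap`. -/
noncomputable def tgtRetraction : (tgtMap f A γ).Retraction :=
  (CoeffMap.exists_retraction _ (resTo_rlp f _ 1 (anodyne_face_one 1) (edgeMap_one γ))).some

/-- The transport of the cohomology of the fibers along an edge. -/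
noncomputable def transport (q : ℕ) :
    (cochainComplex (fiberCoeff f A y)).H q ≃ₗ[R] (cochainComplex (fiberCoeff f A z)).H q :=
  ((srcRetraction f A γ).HEquiv q).trans ((tgtRetraction f A γ).HEquiv q).symm

theorem tgtMap_transport (q : ℕ) (ξ : (cochainComplex (fiberCoeff f A y)).H q) :
    (tgtMap f A γ).Hmap q (transport f A γ q ξ) = (srcMap f A γ).Hmap q ξ :=
  ((tgtRetraction f A γ).HEquiv q).apply_symm_apply _

theorem norm_transport (q : ℕ) (ξ : (cochainComplex (fiberCoeff f A y)).H q) : ‖transport f A γ q ξ‖ = ‖ξ‖ := by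
  rw [← (tgtRetraction f A γ).norm_Hmap, tgtMap_transport, (srcRetraction f A γ).norm_Hmap]

theorem transport_cls_eq_iff (q : ℕ) (φ : LinearMap.ker ((cochainComplex (fiberCoeff f A y)).d q))
    (ψ : LinearMap.ker ((cochainComplex (fiberCoeff f A z)).d q)) :
    transport f A γ q ((cochainComplex (fiberCoeff f A y)).cls q φ) =
        (cochainComplex (fiberCoeff f A z)).cls q ψ ↔
      resSrcCochain f A γ q φ.1 - resTgtCochain f A γ q ψ.1 ∈
        (cochainComplex (edgeFiberCoeff f A γ)).cobound q := by
  rw [← ((tgtRetraction f A γ).Hmap_injective q).eq_iff, tgtMap_transport, SnComplex.CMap.Hmap_cls,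
    SnComplex.CMap.Hmap_cls, SnComplex.cls_eq_iff, resSrcCochain_eq, resTgtCochain_eq]
  rfl

/-- Transport is compatible with the restriction of the fiber over a simplex to its vertices. -/
theorem Hmap_resCoeff_transport {p : ℕ} (τ : (Δ[p] : SSet.{u}) ⟶ Y) {α : ⦋1⦌ ⟶ ⦋p⦌}
    (hα : SSet.stdSimplex.map α ≫ τ = edgeMap γ) {i j : Fin (p + 1)} (hi : α.toOrderHom 0 = i)
    (hj : α.toOrderHom 1 = j) (k : Fin (p + 1)) (h₀ : τ.app _ (vtx p i) = y)
    (h₁ : τ.app _ (vtx p j) = z) (q : ℕ) (ξ : (cochainComplex (fiberCoeff f A y)).H q) :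
    (resCoeff f A τ j k h₁).cmap.Hmap q (transport f A γ q ξ) =
      (resCoeff f A τ i k h₀).cmap.Hmap q ξ := by
  subst hi hj
  let W := (resFCoeff f A hα 1 k).cmap
  have e₁ (ξ) : (resCoeff f A τ _ k h₁).cmap.Hmap q ξ = W.Hmap q ((tgtMap f A γ).Hmap q ξ) := by
    rw [← SnComplex.CMap.Hmap_comp]
    exact SnComplex.CMap.Hmap_eq_of_eq (fun φ =>
      (resFCoeff_resCoeff f A hα 1 1 k (edgeMap_one γ) h₁ φ).symm) ξ
  have e₀ (ξ) : (resCoeff f A τ _ k h₀).cmap.Hmap q ξ = W.Hmap q ((srcMap f A γ).Hmap q ξ) := by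
    rw [← SnComplex.CMap.Hmap_comp]
    exact SnComplex.CMap.Hmap_eq_of_eq (fun φ =>
      (resFCoeff_resCoeff f A hα 0 1 k (edgeMap_zero γ) h₀ φ).symm) ξ
  rw [e₁, e₀, tgtMap_transport]

/-- A deformation retraction for the restriction of the fiber over a simplex to its initial
vertex. -/
noncomputable def simplexRetraction {p : ℕ} (τ : (Δ[p] : SSet.{u}) ⟶ Y)
    (h : τ.app _ (vtx p 0) = y) : (resCoeff f A τ 0 0 h).cmap.Retraction :=
  (CoeffMap.exists_retraction _ (resTo_rlp f _ 0 (anodyne_face_zero p) h)).some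

/-- All three transports become equalities after pullback to the fiber over the 2-simplex, and
pullback from its vertex 0 is injective on cohomology. -/
theorem transport_comp {y₀ y₁ y₂ : Y _⦋0⦌} {e₀₁ : Edge y₀ y₁} {e₁₂ : Edge y₁ y₂} {e₀₂ : Edge y₀ y₂}
    (h : Edge.CompStruct e₀₁ e₁₂ e₀₂) (q : ℕ) (ξ : (cochainComplex (fiberCoeff f A y₀)).H q) :
    transport f A e₁₂ q (transport f A e₀₁ q ξ) = transport f A e₀₂ q ξ := by
  let τ : (Δ[2] : SSet.{u}) ⟶ Y := yonedaEquiv.symm h.simplex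
  have hα₀₁ : SSet.stdSimplex.map (SimplexCategory.δ 2) ≫ τ = edgeMap e₀₁ :=
    (yonedaEquiv_symm_naturality_left _ _).trans (congrArg yonedaEquiv.symm h.d₂)
  have hα₁₂ : SSet.stdSimplex.map (SimplexCategory.δ 0) ≫ τ = edgeMap e₁₂ :=
    (yonedaEquiv_symm_naturality_left _ _).trans (congrArg yonedaEquiv.symm h.d₀)
  have hα₀₂ : SSet.stdSimplex.map (SimplexCategory.δ 1) ≫ τ = edgeMap e₀₂ :=
    (yonedaEquiv_symm_naturality_left _ _).trans (congrArg yonedaEquiv.symm h.d₁)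
  have h₀ : τ.app _ (vtx 2 0) = y₀ := (app_congr hα₀₁ _ (vtx 1 0)).trans (edgeMap_zero e₀₁)
  have h₁ : τ.app _ (vtx 2 1) = y₁ := (app_congr hα₀₁ _ (vtx 1 1)).trans (edgeMap_one e₀₁)
  have h₂ : τ.app _ (vtx 2 2) = y₂ := (app_congr hα₁₂ _ (vtx 1 1)).trans (edgeMap_one e₁₂)
  have k₀₁ := Hmap_resCoeff_transport f A e₀₁ τ hα₀₁ (i := 0) (j := 1) rfl rfl 0 h₀ h₁ q
  have k₁₂ := Hmap_resCoeff_transport f A e₁₂ τ hα₁₂ (i := 1) (j := 2) rfl rfl 0 h₁ h₂ q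
  have k₀₂ := Hmap_resCoeff_transport f A e₀₂ τ hα₀₂ (i := 0) (j := 2) rfl rfl 0 h₀ h₂ q
  -- Writing the class at vertex 2 as a transport from vertex 0 moves the comparison to vertex 0,
  -- where injectivity is available.
  obtain ⟨ξ', hξ'⟩ := (transport f A e₀₂ q).surjective
    (transport f A e₁₂ q (transport f A e₀₁ q ξ))
  rw [← hξ']
  refine congrArg _ ((simplexRetraction f A τ h₀).Hmap_injective q ?_)
  rw [← k₀₂, hξ', k₁₂, k₀₁]

/-- The degenerate triangle makes this transport idempotent, and it is injective. -/
theorem transport_id (q : ℕ) (ξ : (cochainComplex (fiberCoeff f A y)).H q) :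
    transport f A (Edge.id y) q ξ = ξ :=
  (transport f A (Edge.id y) q).injective (transport_comp f A (Edge.CompStruct.idComp _) q ξ)

/-- Transport as an isomorphism of seminormed modules. -/
noncomputable def transportIso (q : ℕ) :
    (cochainComplex (fiberCoeff f A y)).H q ≅ (cochainComplex (fiberCoeff f A z)).H q where
  hom := ⟨transport f A γ q, fun ξ => (norm_transport f A γ q ξ).le⟩
  inv := ⟨(transport f A γ q).symm, fun ξ => by
    have h := norm_transport f A γ q ((transport f A γ q).symm ξ)
    rw [LinearEquiv.apply_symm_apply] at h
    exact h.ge⟩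
  hom_inv_id := SnMod.Hom.ext (LinearMap.ext (transport f A γ q).symm_apply_apply)
  inv_hom_id := SnMod.Hom.ext (LinearMap.ext (transport f A γ q).apply_symm_apply)

/-- Transport as a morphism in the groupoid of seminormed modules. -/
noncomputable def transportHom (q : ℕ) :
    (⟨(cochainComplex (fiberCoeff f A y)).H q⟩ : Core (SnMod.{max u v} R)) ⟶
      ⟨(cochainComplex (fiberCoeff f A z)).H q⟩ :=
  ⟨transportIso f A γ q⟩

theorem transportHom_id (y : Y _⦋0⦌) (q : ℕ) : transportHom f A (Edge.id y) q = 𝟙 _ :=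
  Core.hom_ext (SnMod.Hom.ext (LinearMap.ext (transport_id f A q)))

theorem transportHom_comp {y₀ y₁ y₂ : Y _⦋0⦌} {e₀₁ : Edge y₀ y₁} {e₁₂ : Edge y₁ y₂}
    {e₀₂ : Edge y₀ y₂} (h : Edge.CompStruct e₀₁ e₁₂ e₀₂) (q : ℕ) :
    transportHom f A e₀₁ q ≫ transportHom f A e₁₂ q = transportHom f A e₀₂ q :=
  Core.hom_ext (SnMod.Hom.ext (LinearMap.ext (transport_comp f A h q)))

/-- The cohomology of the fibers as a functor on the homotopy category. -/
noncomputable def fiberFunctor (q : ℕ) :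
    ((truncation 2).obj Y).HomotopyCategory ⥤ Core (SnMod.{max u v} R) :=
  Truncated.HomotopyCategory.lift (fun y => ⟨(cochainComplex (fiberCoeff f A y)).H q⟩)
    (fun e => transportHom f A (Edge.ofTruncated e) q) (fun y => transportHom_id f A y q)
    (fun h => transportHom_comp f A (Edge.CompStruct.ofTruncated h) q)

theorem fiberFunctor_map (q : ℕ) :
    (fiberFunctor f A q).map (Truncated.HomotopyCategory.homMk γ.toTruncated) =
      transportHom f A γ q :=
  Truncated.HomotopyCategory.lift_map_homMk _
    (fun {x y : Y _⦋0⦌} e => transportHom f A (Edge.ofTruncated (x₀ := x) (x₁ := y) e) q)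
    (fun y => transportHom_id f A y q)
    (fun h => transportHom_comp f A (Edge.CompStruct.ofTruncated h) q) γ.toTruncated

/-- The local coefficient system of the cohomology of the fibers. -/
noncomputable def fiberSystem (q : ℕ) : FiberSystem f A q where
  -- The free groupoid lifts functors to groupoids, hence the detour through the core.
  sys := FreeGroupoid.lift (fiberFunctor f A q) ⋙ Core.inclusion _
  iso y := LinearIsometryEquiv.refl R _
  transport {y z} γ φ ψ := by
    refine Iff.trans ?_ (transport_cls_eq_iff f A γ q φ ψ)
    have h : (FreeGroupoid.lift (fiberFunctor f A q) ⋙ Core.inclusion _).map (FundGrpd.edge γ) =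
        (transportIso f A γ q).hom :=
      congrArg (fun g : (fiberFunctor f A q).obj (Truncated.HomotopyCategory.mk y) ⟶
          (fiberFunctor f A q).obj (Truncated.HomotopyCategory.mk z) => g.iso.hom)
        ((FreeGroupoid.lift_map_homMk (fiberFunctor f A q) _).trans
          (fiberFunctor_map f A γ q))
    exact Iff.of_eq (congrArg (fun g => SnMod.Hom.lin g _ = _) h)

end Transport

/-! ### Bicochains as families of cochains on the fibers over simplices -/

section Families

variable {R : Type w} [NormedRing R] {X Y : SSet.{u}} (f : X ⟶ Y) (A : LocalCoeff.{u, v} R X)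
variable {p q : ℕ} (τ : (Δ[p] : SSet.{u}) ⟶ Y)

/-- The coefficients on the fiber over a simplex given by evaluation at the initial vertex. -/
noncomputable abbrev simplexCoeff : LocalCoeff.{u, v} R (simplexFiber f τ) :=
  A.pullback (evalVtx f τ 0)

/-- The bisimplex given by a simplex of the fiber over a simplex. -/
def toBi (κ : (Δ[q] : SSet.{u}) ⟶ simplexFiber f τ) : BiSimplex f p q :=
  ⟨uncurryF f τ κ, τ, uncurryF_comp f τ κ⟩

/-- The restriction of a bicochain to the bisimplices over a simplex. -/
noncomputable def restrictTo (q : ℕ) :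
    BiCochain f A p q →ₗ[R] Cochain (simplexCoeff f A τ) q where
  toFun a := ⟨fun κ => a.1 (toBi f τ κ), by
    obtain ⟨C, hC⟩ := SnMod.bprod_bddAbove a
    refine ⟨C, ?_⟩
    rintro _ ⟨κ, rfl⟩
    exact hC ⟨toBi f τ κ, rfl⟩⟩
  map_add' _ _ := rfl
  map_smul' _ _ := rfl

theorem norm_restrictTo_le (a : BiCochain f A p q) : ‖restrictTo f A τ q a‖ ≤ ‖a‖ := by
  rw [SnMod.bprod_norm, SnMod.bprod_norm]
  exact Real.iSup_le (fun κ => le_ciSup (SnMod.bprod_bddAbove a) (toBi f τ κ))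
    (Real.iSup_nonneg fun _ => norm_nonneg _)

theorem toBi_curryF (s : BiSimplex f p q) : toBi f s.τ (curryF s.σ s.w) = s :=
  BiSimplex.ext (uncurryF_curryF s.σ s.w) rfl

variable {f A} in
theorem restrictTo_injective {a b : BiCochain f A p q}
    (h : ∀ τ, restrictTo f A τ q a = restrictTo f A τ q b) : a = b := by
  refine Subtype.ext (funext fun s => ?_)
  have := congrFun (congrArg Subtype.val (h s.τ)) (curryF s.σ s.w)
  have e (a : BiCochain f A p q) : a.1 (toBi f s.τ (curryF s.σ s.w)) = a.1 s :=
    eq_of_heq (congr_arg_heq a.1 (toBi_curryF f s))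
  exact (e a).symm.trans (this.trans (e b))

/-- The bicochain given by a bounded family of cochains on the fibers over simplices. -/
noncomputable def glue (c : ∀ τ : (Δ[p] : SSet.{u}) ⟶ Y, Cochain (simplexCoeff f A τ) q) {C : ℝ}
    (hC : ∀ τ, ‖c τ‖ ≤ C) : BiCochain f A p q :=
  ⟨fun s => (c s.τ).1 (curryF s.σ s.w), C, by
    rintro _ ⟨s, rfl⟩
    exact (le_ciSup (SnMod.bprod_bddAbove (c s.τ)) (curryF s.σ s.w)).trans (hC _)⟩

variable {f A} in
theorem norm_glue_le {c : ∀ τ : (Δ[p] : SSet.{u}) ⟶ Y, Cochain (simplexCoeff f A τ) q} {C : ℝ}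
    (hC : ∀ τ, ‖c τ‖ ≤ C) (h0 : 0 ≤ C) : ‖glue f A c hC‖ ≤ C := by
  rw [SnMod.bprod_norm]
  exact Real.iSup_le (fun s =>
    (le_ciSup (SnMod.bprod_bddAbove (c s.τ)) (curryF s.σ s.w)).trans (hC _)) h0

variable {f A} in
theorem restrictTo_glue {c : ∀ τ : (Δ[p] : SSet.{u}) ⟶ Y, Cochain (simplexCoeff f A τ) q} {C : ℝ}
    (hC : ∀ τ, ‖c τ‖ ≤ C) : restrictTo f A τ q (glue f A c hC) = c τ :=
  Subtype.ext (funext fun κ => eq_of_heq (congr_arg_heq (c τ).1 (curryF_uncurryF κ)))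

theorem toBi_op_vertical {q' : ℕ} (β : ⦋q'⦌ ⟶ ⦋q⦌) (κ : (Δ[q] : SSet.{u}) ⟶ simplexFiber f τ) :
    (BiMap.prod (𝟙 ⦋p⦌) β).act (toBi f τ κ) = toBi f τ (SSet.stdSimplex.map β ≫ κ) :=
  BiSimplex.ext
    ((congrArg (fun g => (g ⊗ₘ SSet.stdSimplex.map β) ≫ uncurryF f τ κ)
      (SSet.stdSimplex.{u}.map_id ⦋p⦌)).trans (uncurryF_whisker f τ (SSet.stdSimplex.map β) κ))
    ((congrArg (· ≫ τ) (SSet.stdSimplex.map_id _)).trans (Category.id_comp _))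

/-- Vertical operators fix τ and so act fiberwise. The edge {0} × (0 → β(0)) that carries the
coefficients is a canonical path in Δ[p] × Δ[q]. -/
theorem restrictTo_vertical {q' : ℕ} (β : ⦋q'⦌ ⟶ ⦋q⦌) (a : BiCochain f A p q') :
    restrictTo f A τ q ((BiMap.prod (𝟙 ⦋p⦌) β).op f A a) =
      cochainOp (simplexCoeff f A τ) β (restrictTo f A τ q' a) := by
  refine Subtype.ext (funext fun κ => ?_)
  have h : (FundGrpd.map (evalVtx f τ 0)).map (inv (FundGrpd.edge (opEdge β κ))) =
      tr (uncurryF f τ κ) (vtx p 0, vtx q (β.toOrderHom 0)) (vtx p 0, vtx q 0) := by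
    rw [Functor.map_inv]
    refine IsIso.inv_eq_of_hom_inv_id ?_
    refine (congrArg (· ≫ _) ((FundGrpd.map_edge _ _).trans (tr_edge (uncurryF f τ κ)
      (prodEdge (Edge.id (vtx p 0)) (stdEdge 0 (β.toOrderHom 0) (Fin.zero_le _)))).symm)).trans ?_
    exact (tr_comp (uncurryF f τ κ) _ _ _).trans (tr_self _ _)
  refine Eq.trans ?_ (congrArg (fun g => (A.map g).lin
    (a.1 (toBi f τ (SSet.stdSimplex.map β ≫ κ)))) h).symm
  exact congrArg (A.map (tr (uncurryF f τ κ) (vtx p 0, vtx q (β.toOrderHom 0))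
    (vtx p 0, vtx q 0))).lin (eq_of_heq (congr_arg_heq a.1 (toBi_op_vertical f τ β κ)))

theorem restrictTo_bi_dv (a : BiCochain f A p q) :
    restrictTo f A τ (q + 1) (bi_dv f A p q a) =
      (-1 : ℤ) ^ p • cobdry (simplexCoeff f A τ) q (restrictTo f A τ q a) := by
  rw [bi_dv_eq, cobdry_eq, map_zsmul, map_sum]
  refine congrArg _ (Finset.sum_congr rfl fun j _ => ?_)
  rw [map_zsmul, restrictTo_vertical]

variable {τ} {p' : ℕ} {τ' : (Δ[p'] : SSet.{u}) ⟶ Y} {α : ⦋p'⦌ ⟶ ⦋p⦌}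
  (hα : SSet.stdSimplex.map α ≫ τ = τ')

theorem toBi_op_horizontal (κ : (Δ[q] : SSet.{u}) ⟶ simplexFiber f τ) :
    (BiMap.prod α (𝟙 ⦋q⦌)).act (toBi f τ κ) = toBi f τ' (κ ≫ resF f hα) := by
  refine BiSimplex.ext ?_ hα
  have h : (SSet.stdSimplex.map α ⊗ₘ SSet.stdSimplex.{u}.map (𝟙 ⦋q⦌)) =
    SSet.stdSimplex.map α ▷ Δ[q] := congrArg (SSet.stdSimplex.map α ⊗ₘ ·) (SSet.stdSimplex.map_id _)
  exact congrArg (· ≫ uncurryF f τ κ) h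

/-- Horizontal operators replace τ by α^*τ, which on fibers is `resF`, and move coefficients from
the vertex α(0) to the vertex 0. -/
theorem restrictTo_horizontal (a : BiCochain f A p' q) :
    restrictTo f A τ q ((BiMap.prod α (𝟙 ⦋q⦌)).op f A a) =
      (resFCoeff f A hα 0 0).cochain q (restrictTo f A τ' q a) := by
  refine Subtype.ext (funext fun κ => ?_)
  have h : trL (evF f τ) (vtx₀ κ) (vtx p (α.toOrderHom 0)) (vtx p 0) =
      tr (uncurryF f τ κ) (vtx p (α.toOrderHom 0), vtx q 0) (vtx p 0, vtx q 0) :=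
    (trL_whisker κ (evF f τ) (vtx q 0) _ _).symm.trans (trL_eq_tr (uncurryF f τ κ) (vtx q 0) _ _)
  refine Eq.trans ?_ (congrArg (fun g => (A.map g).lin
    (a.1 (toBi f τ' (κ ≫ resF f hα)))) h).symm
  exact congrArg (A.map (tr (uncurryF f τ κ) (vtx p (α.toOrderHom 0), vtx q 0)
    (vtx p 0, vtx q 0))).lin (eq_of_heq (congr_arg_heq a.1 (toBi_op_horizontal f hα κ)))

end Families

/-! ### Classes of vertical cocycles -/

section Classes

variable {R : Type w} [NormedRing R] {X Y : SSet.{u}} (f : X ⟶ Y) (A : LocalCoeff.{u, v} R X)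

theorem cobdry_restrictTo {p q : ℕ} {a : BiCochain f A p q} (ha : bi_dv f A p q a = 0)
    (τ : (Δ[p] : SSet.{u}) ⟶ Y) : cobdry (simplexCoeff f A τ) q (restrictTo f A τ q a) = 0 := by
  have h := restrictTo_bi_dv f A τ a
  rw [ha, map_zero] at h
  rcases neg_one_pow_eq_or ℤ p with hp | hp
  · rw [hp, one_zsmul] at h
    exact h.symm
  · rw [hp, neg_one_zsmul] at h
    exact neg_eq_zero.1 h.symm

theorem bi_dv_eq_zero {p q : ℕ} {a : BiCochain f A p q}
    (h : ∀ τ : (Δ[p] : SSet.{u}) ⟶ Y,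
      cobdry (simplexCoeff f A τ) q (restrictTo f A τ q a) = 0) : bi_dv f A p q a = 0 :=
  restrictTo_injective fun τ => by rw [restrictTo_bi_dv, h, smul_zero, map_zero]

/-- The restriction of vertical cocycles to the bisimplices over a simplex. -/
noncomputable def restrictKer {p : ℕ} (q : ℕ) (τ : (Δ[p] : SSet.{u}) ⟶ Y) :
    LinearMap.ker (bi_dv f A p q) →ₗ[R]
      LinearMap.ker ((cochainComplex (simplexCoeff f A τ)).d q) :=
  (restrictTo f A τ q).restrict fun _ ha => cobdry_restrictTo f A ha τ

/-- Horizontal operators on vertical cocycles. -/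
noncomputable def opKer {p p' : ℕ} (q : ℕ) (α : ⦋p'⦌ ⟶ ⦋p⦌) :
    LinearMap.ker (bi_dv f A p' q) →ₗ[R] LinearMap.ker (bi_dv f A p q) :=
  ((BiMap.prod α (𝟙 ⦋q⦌)).op f A).restrict fun a ha => bi_dv_eq_zero f A fun τ => by
    rw [restrictTo_horizontal f A (α := α) rfl, CoeffMap.cobdry_cochain,
      cobdry_restrictTo f A ha, map_zero]

/-- The restriction map from the complex of the fiber over the initial vertex to the complex of the
fiber over a simplex. -/
noncomputable abbrev initMap {p : ℕ} (τ : (Δ[p] : SSet.{u}) ⟶ Y) :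
    SnComplex.CMap (cochainComplex (fiberCoeff f A (vtx₀ τ)))
      (cochainComplex (simplexCoeff f A τ)) :=
  (resCoeff f A τ 0 0 rfl).cmap

theorem exists_edge_eq {n : ℕ} (i : Fin (n + 1)) (τ : (Δ[n] : SSet.{u}) ⟶ Y) :
    ∃ e : ⦋1⦌ ⟶ ⦋n⦌, e.toOrderHom 0 = 0 ∧ e.toOrderHom 1 = i ∧
      SSet.stdSimplex.map e ≫ τ = edgeMap ((stdEdge 0 i (Fin.zero_le _)).map τ) :=
  ⟨SSet.stdSimplex.objEquiv (stdEdge.{u} 0 i (Fin.zero_le _)).edge, rfl, rfl,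
    NatTrans.ext (funext fun _ => ConcreteCategory.hom_ext _ _ fun s =>
      NatTrans.naturality_apply τ (SSet.stdSimplex.objEquiv s).op
        (stdEdge.{u} 0 i (Fin.zero_le _)).edge)⟩

variable [HomotopicalAlgebra.Fibration f]

/-- The initial vertex of α^*τ is the vertex α(0) of τ. Classes related by transport along 0 → α(0)
have the same pullback to F_τ, and the pullback from α(0) factors through the fiber over α^*τ. -/
theorem transport_opEdge {m n q : ℕ} (α : ⦋m⦌ ⟶ ⦋n⦌) (τ : (Δ[n] : SSet.{u}) ⟶ Y)
    (a : LinearMap.ker (bi_dv f A m q))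
    (ξ : (cochainComplex (fiberCoeff f A (vtx₀ τ))).H q)
    (h : (initMap f A (SSet.stdSimplex.map α ≫ τ)).Hmap q (transport f A (opEdge α τ) q ξ) =
      (cochainComplex (simplexCoeff f A (SSet.stdSimplex.map α ≫ τ))).cls q
        (restrictKer f A q (SSet.stdSimplex.map α ≫ τ) a)) :
    (initMap f A τ).Hmap q ξ =
      (cochainComplex (simplexCoeff f A τ)).cls q (restrictKer f A q τ (opKer f A q α a)) := by
  obtain ⟨e, he₀, he₁, he⟩ := exists_edge_eq (α.toOrderHom 0) τ
  have h₁ := Hmap_resCoeff_transport f A (opEdge α τ) τ he he₀ he₁ 0 rfl rfl q ξ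
  refine h₁.symm.trans ?_
  let W := (resFCoeff f A (α := α) (τ := τ) rfl 0 0).cmap
  have h₂ (ζ : (cochainComplex (fiberCoeff f A (vtx₀ (SSet.stdSimplex.map α ≫ τ)))).H q) :
      (resCoeff f A τ (α.toOrderHom 0) 0 rfl).cmap.Hmap q ζ =
        W.Hmap q ((initMap f A (SSet.stdSimplex.map α ≫ τ)).Hmap q ζ) := by
    rw [← SnComplex.CMap.Hmap_comp]
    exact SnComplex.CMap.Hmap_eq_of_eq (fun φ =>
      (resFCoeff_resCoeff f A (α := α) (τ := τ) rfl 0 0 0 rfl rfl φ).symm) ζ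
  refine (h₂ _).trans ((congrArg (W.Hmap q) h).trans ?_)
  refine congrArg ((cochainComplex (simplexCoeff f A τ)).cls q) (Subtype.ext ?_)
  exact (restrictTo_horizontal f A (α := α) (τ := τ) rfl a.1).symm

variable {f A} {q : ℕ} (𝓗 : FiberSystem f A q)

/-- The identification of the values of a fiber system, in terms of the cohomology of complexes. -/
noncomputable def FiberSystem.isoH (y : Y _⦋0⦌) :
    𝓗.sys.at₀ y ≃ₗᵢ[R] (cochainComplex (fiberCoeff f A y)).H q := 𝓗.iso y

/-- The zigzag relation determines the transported class, so every fiber system acts on edges by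
`transport`; the second page can be identified for all of them at once. -/
theorem fiberSystem_map_edge {y z : Y _⦋0⦌} (γ : Edge y z)
    (ξ : (cochainComplex (fiberCoeff f A y)).H q) :
    (𝓗.sys.map (FundGrpd.edge γ)).lin ((𝓗.isoH y).symm ξ) =
      (𝓗.isoH z).symm (transport f A γ q ξ) := by
  obtain ⟨φ, rfl⟩ := SnComplex.cls_surjective _ _ ξ
  obtain ⟨ψ, hψ⟩ := SnComplex.cls_surjective _ _
    (transport f A γ q ((cochainComplex (fiberCoeff f A y)).cls q φ))
  rw [← hψ]
  exact (𝓗.transport γ φ ψ).2 ((transport_cls_eq_iff f A γ q φ ψ).1 hψ.symm)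

variable (f A q) in
/-- A deformation retraction for `initMap`. -/
noncomputable def initRetraction {p : ℕ} (τ : (Δ[p] : SSet.{u}) ⟶ Y) :
    (initMap f A τ).Retraction :=
  simplexRetraction f A τ rfl

variable (f A q) in
/-- The cohomology class, on the fiber over the initial vertex, of a vertical cocycle over a
simplex. -/
noncomputable def initClass {p : ℕ} (τ : (Δ[p] : SSet.{u}) ⟶ Y) :
    LinearMap.ker (bi_dv f A p q) →ₗ[R] (cochainComplex (fiberCoeff f A (vtx₀ τ))).H q :=
  (initRetraction f A τ).s.Hmap q ∘ₗ
    (cochainComplex (simplexCoeff f A τ)).cls q ∘ₗ restrictKer f A q τ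

variable (f A) in
-- `initMap` is inverted by the retraction on cohomology, so the class does not depend on the chosen
-- retraction.
theorem initClass_eq_iff {p : ℕ} (τ : (Δ[p] : SSet.{u}) ⟶ Y)
    (a : LinearMap.ker (bi_dv f A p q)) (ξ : (cochainComplex (fiberCoeff f A (vtx₀ τ))).H q) :
    initClass f A q τ a = ξ ↔ (initMap f A τ).Hmap q ξ =
        (cochainComplex (simplexCoeff f A τ)).cls q (restrictKer f A q τ a) := by
  refine ⟨fun h => ?_, fun h => ?_⟩
  · exact (congrArg ((initMap f A τ).Hmap q) h.symm).trans ((initRetraction f A τ).Hmap_m_s q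
      ((cochainComplex (simplexCoeff f A τ)).cls q (restrictKer f A q τ a)))
  · exact (congrArg ((initRetraction f A τ).s.Hmap q) h.symm).trans
      ((initRetraction f A τ).Hmap_s_m q ξ)

variable (f A) in
theorem norm_initClass_le {p : ℕ} (τ : (Δ[p] : SSet.{u}) ⟶ Y)
    (a : LinearMap.ker (bi_dv f A p q)) : ‖initClass f A q τ a‖ ≤ ‖a.1‖ :=
  ((initRetraction f A τ).s.norm_Hmap_le q
    ((cochainComplex (simplexCoeff f A τ)).cls q (restrictKer f A q τ a))).trans
    ((SnComplex.norm_cls_le q (restrictKer f A q τ a)).trans (norm_restrictTo_le f A τ a.1))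

/-- The class of a vertical cocycle over a simplex. -/
noncomputable def fiberClass {p : ℕ} (τ : (Δ[p] : SSet.{u}) ⟶ Y) :
    LinearMap.ker (bi_dv f A p q) →ₗ[R] 𝓗.sys.at₀ (vtx₀ τ) :=
  (𝓗.isoH (vtx₀ τ)).symm.toLinearEquiv.toLinearMap ∘ₗ initClass f A q τ

theorem fiberClass_eq_iff {p : ℕ} (τ : (Δ[p] : SSet.{u}) ⟶ Y)
    (a : LinearMap.ker (bi_dv f A p q)) (ξ : (cochainComplex (fiberCoeff f A (vtx₀ τ))).H q) :
    fiberClass 𝓗 τ a = (𝓗.isoH (vtx₀ τ)).symm ξ ↔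
      (initMap f A τ).Hmap q ξ =
        (cochainComplex (simplexCoeff f A τ)).cls q (restrictKer f A q τ a) :=
  Iff.trans (𝓗.isoH (vtx₀ τ)).symm.injective.eq_iff (initClass_eq_iff f A τ a ξ)

theorem fiberClass_eq_zero_iff {p : ℕ} (τ : (Δ[p] : SSet.{u}) ⟶ Y)
    (a : LinearMap.ker (bi_dv f A p q)) :
    fiberClass 𝓗 τ a = 0 ↔
      restrictTo f A τ q a.1 ∈ (cochainComplex (simplexCoeff f A τ)).cobound q := by
  have h := fiberClass_eq_iff 𝓗 τ a 0
  rw [map_zero, map_zero] at h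
  rw [h, eq_comm]
  exact SnComplex.cls_eq_zero_iff q _

theorem norm_fiberClass_le {p : ℕ} (τ : (Δ[p] : SSet.{u}) ⟶ Y)
    (a : LinearMap.ker (bi_dv f A p q)) : ‖fiberClass 𝓗 τ a‖ ≤ ‖a.1‖ :=
  ((𝓗.isoH (vtx₀ τ)).symm.norm_map (initClass f A q τ a)).le.trans (norm_initClass_le f A τ a)

/-- The cochain of the base given by a vertical cocycle. -/
noncomputable def toBase (p : ℕ) : LinearMap.ker (bi_dv f A p q) →ₗ[R] Cochain 𝓗.sys p where
  toFun a := ⟨fun τ => fiberClass 𝓗 τ a, ‖a.1‖, by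
    rintro _ ⟨τ, rfl⟩
    exact norm_fiberClass_le 𝓗 τ a⟩
  map_add' a b := Subtype.ext (funext fun τ => map_add (fiberClass 𝓗 τ) a b)
  map_smul' r a := Subtype.ext (funext fun τ => map_smul (fiberClass 𝓗 τ) r a)

theorem norm_toBase_le {p : ℕ} (a : LinearMap.ker (bi_dv f A p q)) : ‖toBase 𝓗 p a‖ ≤ ‖a.1‖ := by
  rw [SnMod.bprod_norm]
  exact Real.iSup_le (fun τ => norm_fiberClass_le 𝓗 τ a) (norm_nonneg _)

theorem toBase_eq_zero_iff {p : ℕ} (a : LinearMap.ker (bi_dv f A p q)) :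
    toBase 𝓗 p a = 0 ↔ ∀ τ : (Δ[p] : SSet.{u}) ⟶ Y,
      restrictTo f A τ q a.1 ∈ (cochainComplex (simplexCoeff f A τ)).cobound q :=
  Iff.trans ⟨fun h τ => congrFun (congrArg Subtype.val h) τ,
    fun h => Subtype.ext (funext h)⟩ (forall_congr' fun τ => fiberClass_eq_zero_iff 𝓗 τ a)

/-- By `transport_opEdge` the class at τ₀ of the pulled back cocycle is the class at τ_{α(0)} moved
backwards along the edge, which is the inverse in the cochain operator. -/
theorem cochainOp_toBase {m n : ℕ} (α : ⦋m⦌ ⟶ ⦋n⦌) (a : LinearMap.ker (bi_dv f A m q)) :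
    cochainOp 𝓗.sys α (toBase 𝓗 m a) = toBase 𝓗 n (opKer f A q α a) := by
  refine Subtype.ext (funext fun τ => ?_)
  let γ := opEdge α τ
  let ξ := (transport f A γ q).symm (𝓗.isoH _ (fiberClass 𝓗 (SSet.stdSimplex.map α ≫ τ) a))
  have h₀ : fiberClass 𝓗 (SSet.stdSimplex.map α ≫ τ) a =
      (𝓗.isoH _).symm (transport f A γ q ξ) := by
    refine ((𝓗.isoH _).symm_apply_apply _).symm.trans (congrArg (𝓗.isoH _).symm ?_)
    exact ((transport f A γ q).apply_symm_apply _).symm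
  have h₁ := (fiberClass_eq_iff 𝓗 τ (opKer f A q α a) ξ).2
    (transport_opEdge f A α τ a ξ ((fiberClass_eq_iff 𝓗 _ a _).1 h₀))
  refine Eq.trans ?_ h₁.symm
  refine (congrArg (𝓗.sys.map (inv (FundGrpd.edge γ))).lin
    (h₀.trans (fiberSystem_map_edge 𝓗 γ ξ).symm)).trans ?_
  refine (LocalCoeff.map_lin_comp 𝓗.sys _ _ _).trans ?_
  rw [IsIso.hom_inv_id]
  exact LocalCoeff.map_lin_id 𝓗.sys _

theorem cobdry_toBase {p : ℕ} (a : LinearMap.ker (bi_dv f A p q))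
    (a' : LinearMap.ker (bi_dv f A (p + 1) q)) (h : a'.1 = bi_dh f A p q a.1) :
    cobdry 𝓗.sys p (toBase 𝓗 p a) = toBase 𝓗 (p + 1) a' := by
  have h' : a' = ∑ i ∈ Finset.range (p + 2), (-1 : ℤ) ^ i • opKer f A q (dOp p i) a := by
    refine Subtype.ext ?_
    rw [h, bi_dh_eq, Submodule.coe_sum]
    rfl
  rw [cobdry_eq, h', map_sum]
  refine Finset.sum_congr rfl fun i _ => ?_
  rw [map_zsmul, cochainOp_toBase]

/-- Each value of ψ has a representative of norm at most ‖ψ‖ + ε. The bound is the same for all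
simplices, so the representatives, pulled back to the F_τ, glue to a bounded cochain. -/
theorem exists_toBase_eq {p : ℕ} (ψ : Cochain 𝓗.sys p) {ε : ℝ} (hε : 0 < ε) :
    ∃ a : LinearMap.ker (bi_dv f A p q), toBase 𝓗 p a = ψ ∧ ‖a.1‖ ≤ ‖ψ‖ + ε := by
  have hz (τ : (Δ[p] : SSet.{u}) ⟶ Y) :
      ∃ z : LinearMap.ker ((cochainComplex (fiberCoeff f A (vtx₀ τ))).d q),
        (cochainComplex (fiberCoeff f A (vtx₀ τ))).cls q z = 𝓗.isoH _ (ψ.1 τ) ∧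
          ‖z.1‖ ≤ ‖ψ‖ + ε := by
    obtain ⟨z, hz, hn⟩ := SnComplex.exists_cls_eq_norm_lt q (𝓗.isoH _ (ψ.1 τ)) hε
    refine ⟨z, hz, hn.le.trans (add_le_add_left ?_ ε)⟩
    exact ((𝓗.isoH _).norm_map _).le.trans (le_ciSup (SnMod.bprod_bddAbove ψ) τ)
  choose z hz hn using hz
  let c (τ : (Δ[p] : SSet.{u}) ⟶ Y) : Cochain (simplexCoeff f A τ) q :=
    (initMap f A τ).f q (z τ).1
  have hc (τ) : ‖c τ‖ ≤ ‖ψ‖ + ε := ((initMap f A τ).norm_le q _).trans (hn τ)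
  have hr (τ) : restrictTo f A τ q (glue f A c hc) = c τ := restrictTo_glue τ hc
  have hker : bi_dv f A p q (glue f A c hc) = 0 := bi_dv_eq_zero f A fun τ => by
    rw [hr]
    exact ((initMap f A τ).onKer q (z τ)).2
  refine ⟨⟨glue f A c hc, hker⟩, ?_, norm_glue_le hc (by positivity)⟩
  refine Subtype.ext (funext fun τ => ?_)
  refine ((fiberClass_eq_iff 𝓗 τ _ (𝓗.isoH _ (ψ.1 τ))).2 ?_).trans ((𝓗.isoH _).symm_apply_apply _)
  rw [← hz]
  exact congrArg ((cochainComplex (simplexCoeff f A τ)).cls q) (Subtype.ext (hr τ).symm)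

end Classes

/-! ### The uniform boundary condition in the fibers over a connected base -/

section Squares

variable {C : Type*} [Category* C] {a b c d a' b' c' d' : C}

theorem comp_inv_eq_inv_comp {i : a ⟶ b} {j : c ⟶ d} {k : a ⟶ c} {l : b ⟶ d} [IsIso i] [IsIso j]
    (h : k ≫ j = i ≫ l) : l ≫ inv j = inv i ≫ k := by
  rw [IsIso.comp_inv_eq, Category.assoc, IsIso.eq_inv_comp, h]

theorem paste_squares {i : a ⟶ b} {j : b ⟶ c} {k : c ⟶ d} {i' : a' ⟶ b'} {j' : b' ⟶ c'}
    {k' : c' ⟶ d'} {α : a ⟶ a'} {β : b ⟶ b'} {γ : c ⟶ c'} {δ : d ⟶ d'} (h₁ : α ≫ i' = i ≫ β)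
    (h₂ : β ≫ j' = j ≫ γ) (h₃ : γ ≫ k' = k ≫ δ) : α ≫ i' ≫ j' ≫ k' = (i ≫ j ≫ k) ≫ δ := by
  simp only [Category.assoc]
  rw [← h₃, ← Category.assoc j, ← h₂, Category.assoc, ← Category.assoc i, ← h₁, Category.assoc]

theorem isIso_comp₃ (i : a ⟶ b) (j : b ⟶ c) (k : c ⟶ d) [IsIso i] [IsIso j] [IsIso k] :
    IsIso (i ≫ j ≫ k) := inferInstance

end Squares

namespace CoeffMap

variable {R : Type w} [NormedRing R] {P F G Q : SSet.{u}}

/-- Restriction of the target coefficients in two steps. -/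
def toPullback {t : P ⟶ F} {B' : LocalCoeff.{u, v} R F} {r : P ⟶ G} {j : G ⟶ Q}
    {A : LocalCoeff.{u, v} R Q} (μ : CoeffMap t B' (A.pullback (r ≫ j))) :
    CoeffMap t B' ((A.pullback j).pullback r) where
  app x := μ.app x
  nat {x y} e := by
    have h : (FundGrpd.map j).map ((FundGrpd.map r).map (FundGrpd.edge e)) =
        (FundGrpd.map (r ≫ j)).map (FundGrpd.edge e) :=
      (congrArg (FundGrpd.map j).map (FundGrpd.map_edge r e)).trans
        ((FundGrpd.map_edge j _).trans (FundGrpd.map_edge (r ≫ j) e).symm)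
    exact (μ.nat e).trans (congrArg (fun g => μ.app x ≫ A.map g) h.symm)

theorem nat_pullback {t : P ⟶ F} {t' : P ⟶ G} {B : LocalCoeff.{u, v} R F}
    {B' : LocalCoeff.{u, v} R G} (μ : CoeffMap t B (B'.pullback t')) {x y : P _⦋0⦌} (e : Edge x y) :
    B.map (FundGrpd.edge (e.map t)) ≫ μ.app y =
      μ.app x ≫ B'.map (FundGrpd.edge (e.map t')) :=
  (μ.nat e).trans (congrArg (fun g => μ.app x ≫ B'.map g) (FundGrpd.map_edge t' e))

/-- Constructor for maps to pulled back coefficients. -/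
def mkPullback {t : P ⟶ F} {t' : P ⟶ G} {B : LocalCoeff.{u, v} R F}
    {B' : LocalCoeff.{u, v} R G} (app : ∀ x : P _⦋0⦌, B.at₀ (t.app _ x) ⟶ B'.at₀ (t'.app _ x))
    (nat : ∀ {x y : P _⦋0⦌} (e : Edge x y), B.map (FundGrpd.edge (e.map t)) ≫ app y =
      app x ≫ B'.map (FundGrpd.edge (e.map t'))) : CoeffMap t B (B'.pullback t') where
  app := app
  nat {x _} e := (nat e).trans
    (congrArg (fun g => app x ≫ B'.map g) (FundGrpd.map_edge t' e).symm)

end CoeffMap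

/-! ### Spans of trivial fibrations and uniform boundary constants. -/

section Correspondence

variable {R : Type w} [NormedRing R] {F G H : SSet.{u}}

/-- Two simplicial sets with local coefficients are trivially equivalent if they are connected by a
span of trivial fibrations and an isomorphism of the coefficients pulled back to its apex. -/
def TrivEquiv (B : LocalCoeff.{u, v} R F) (B' : LocalCoeff.{u, v} R G) : Prop :=
  ∃ (P : SSet.{u}) (t : P ⟶ F) (t' : P ⟶ G) (μ : CoeffMap t B (B'.pullback t')),
    (MorphismProperty.monomorphisms SSet.{u}).rlp t ∧
    (MorphismProperty.monomorphisms SSet.{u}).rlp t' ∧ ∀ x, IsIso (μ.app x)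

theorem TrivEquiv.refl (B : LocalCoeff.{u, v} R F) : TrivEquiv B B :=
  ⟨F, 𝟙 F, 𝟙 F, CoeffMap.mkPullback (fun _ => 𝟙 _) fun _ => (Category.comp_id _).trans
    (Category.id_comp _).symm, MorphismProperty.id_mem _ _, MorphismProperty.id_mem _ _,
    fun x => inferInstanceAs (IsIso (𝟙 (B.at₀ x)))⟩

theorem TrivEquiv.symm {B : LocalCoeff.{u, v} R F} {B' : LocalCoeff.{u, v} R G}
    (h : TrivEquiv B B') : TrivEquiv B' B := by
  obtain ⟨P, t, t', μ, ht, ht', hμ⟩ := h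
  have hμ (x) : @IsIso (SnMod.{v} R) _ (B.at₀ (t.app _ x)) (B'.at₀ (t'.app _ x)) (μ.app x) := hμ x
  refine ⟨P, t', t, CoeffMap.mkPullback (fun x => @inv (SnMod.{v} R) _ (B.at₀ (t.app _ x))
    (B'.at₀ (t'.app _ x)) (μ.app x) (hμ x)) fun {x y} e => ?_, ht', ht, fun x => ?_⟩
  · have := hμ x
    have := hμ y
    exact comp_inv_eq_inv_comp (μ.nat_pullback e)
  · exact @IsIso.inv_isIso _ _ _ _ _ (hμ x)

/-- Trivial fibrations are stable under base change and composition, so two spans compose through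
the pullback of their inner legs. -/
theorem TrivEquiv.trans {B : LocalCoeff.{u, v} R F} {B' : LocalCoeff.{u, v} R G}
    {B'' : LocalCoeff.{u, v} R H} (h : TrivEquiv B B') (h' : TrivEquiv B' B'') :
    TrivEquiv B B'' := by
  obtain ⟨P, t, t', μ, ht, ht', hμ⟩ := h
  obtain ⟨P', s, s', ν, hs, hs', hν⟩ := h'
  have hμ (x) : @IsIso (SnMod.{v} R) _ (B.at₀ (t.app _ x)) (B'.at₀ (t'.app _ x)) (μ.app x) := hμ x
  have hν (x) : @IsIso (SnMod.{v} R) _ (B'.at₀ (s.app _ x)) (B''.at₀ (s'.app _ x)) (ν.app x) :=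
    hν x
  let a := Limits.pullback.fst t' s
  let b := Limits.pullback.snd t' s
  have w : a ≫ t' = b ≫ s := Limits.pullback.condition
  have ha : (MorphismProperty.monomorphisms SSet.{u}).rlp a :=
    MorphismProperty.pullback_fst _ _ hs
  have hb : (MorphismProperty.monomorphisms SSet.{u}).rlp b :=
    MorphismProperty.pullback_snd _ _ ht'
  let θ (x : (Limits.pullback t' s) _⦋0⦌) :
      B'.at₀ (t'.app _ (a.app _ x)) ⟶ B'.at₀ (s.app _ (b.app _ x)) :=
    B'.map (eqToHom (congrArg FundGrpd.pt (app_congr w _ x)))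
  refine ⟨_, a ≫ t, b ≫ s', CoeffMap.mkPullback
    (fun x => μ.app (a.app _ x) ≫ θ x ≫ ν.app (b.app _ x)) fun {x y} e => ?_,
    MorphismProperty.comp_mem _ _ _ ha ht, MorphismProperty.comp_mem _ _ _ hb hs', fun x => ?_⟩
  · have h1 := μ.nat_pullback (e.map a)
    have h2 := ν.nat_pullback (e.map b)
    have h3 : B'.map (FundGrpd.edge ((e.map a).map t')) ≫ θ y =
        θ x ≫ B'.map (FundGrpd.edge ((e.map b).map s)) :=
      (B'.map_comp _ _).symm.trans ((congrArg B'.map (edge_map_congr w e)).trans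
        (B'.map_comp _ _))
    exact paste_squares h1 h3 h2
  · have h : IsIso (θ x) := inferInstanceAs (IsIso (B'.map (eqToHom _)))
    exact @isIso_comp₃ _ _ _ _ _ _ (μ.app (a.app _ x)) (θ x) (ν.app (b.app _ x)) (hμ _) h (hν _)

/-- Passing up one leg costs q, passing down the other costs nothing. Since spans compose to a span,
the loss is q however many edges a path in the base has; this gives uniformity over the base. -/
theorem TrivEquiv.ubcWith {B : LocalCoeff.{u, v} R F} {B' : LocalCoeff.{u, v} R G}
    (h : TrivEquiv B B') {κ : ℝ} (hκ : 0 ≤ κ) {q : ℕ} (hB : (cochainComplex B).UBCWith κ q) :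
    (cochainComplex B').UBCWith (κ + q) q := by
  obtain ⟨P, t, t', μ, ht, ht', hμ⟩ := h
  obtain ⟨r⟩ := μ.exists_retraction ht
  have : ∀ x, IsIso ((CoeffMap.ofPullback t' B').app x) :=
    fun x => inferInstanceAs (IsIso (𝟙 (B'.at₀ (t'.app _ x))))
  obtain ⟨r'⟩ := (CoeffMap.ofPullback t' B').exists_retraction ht'
  exact r'.ubc_of_target (by positivity) (r.ubc_of_source hκ hB)

variable {X Y : SSet.{u}} (f : X ⟶ Y) (A : LocalCoeff.{u, v} R X) [HomotopicalAlgebra.Fibration f]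

theorem trivEquiv_of_edge {y z : Y _⦋0⦌} (γ : Edge y z) :
    TrivEquiv (fiberCoeff f A y) (fiberCoeff f A z) :=
  ⟨_, resTo f (edgeMap γ) 0 (edgeMap_zero γ), resTo f (edgeMap γ) 1 (edgeMap_one γ),
    (resCoeff f A (edgeMap γ) 0 1 (edgeMap_zero γ)).toPullback
      (r := resTo f (edgeMap γ) 1 (edgeMap_one γ)) (j := (fiber f z).ι),
    resTo_rlp f _ 0 (anodyne_face_one 0) _, resTo_rlp f _ 1 (anodyne_face_one 1) _,
    fun x => inferInstanceAs (IsIso ((resCoeff f A (edgeMap γ) 0 1 (edgeMap_zero γ)).app x))⟩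

/-- Connectedness means that the equivalence relation generated by the edges identifies all
vertices; the trivial equivalences follow such a chain. -/
theorem trivEquiv_of_connected [Y.IsConnected] (y z : Y _⦋0⦌) :
    TrivEquiv (fiberCoeff f A y) (fiberCoeff f A z) := by
  have h := (π₀.mk_eq_mk_iff y z).1 (Subsingleton.elim _ _)
  induction h with
  | rel _ _ h => exact trivEquiv_of_edge f A h.some
  | refl _ => exact .refl _
  | symm _ _ _ ih => exact ih.symm
  | trans _ _ _ _ _ ih ih' => exact ih.trans ih'

/-- The uniform boundary condition in one fiber implies the uniform boundary condition, with a common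
constant, in the fibers over all simplices. -/
theorem exists_ubcWith_simplexFiber [Y.IsConnected] {y : Y _⦋0⦌} {q : ℕ}
    (h : (cochainComplex (fiberCoeff f A y)).UBC q) :
    ∃ κ : ℝ, 0 ≤ κ ∧ ∀ (p : ℕ) (τ : (Δ[p] : SSet.{u}) ⟶ Y),
      (cochainComplex (simplexCoeff f A τ)).UBCWith κ q := by
  obtain ⟨κ, hκ, h⟩ := h
  -- One q pays for the span from the given fiber to the fiber over τ₀, the other for the passage
  -- from there to F_τ.
  refine ⟨κ + q + q, by positivity, fun p τ => ?_⟩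
  exact (simplexRetraction f A τ rfl).ubc_of_source (by positivity)
    ((trivEquiv_of_connected f A y _).ubcWith hκ h)

end Correspondence

/-! ### Identification of the second page -/

section SecondPage

variable {R : Type w} [NormedRing R] {X Y : SSet.{u}} {f : X ⟶ Y} {A : LocalCoeff.{u, v} R X}

/-- A vertical cocycle whose restrictions are coboundaries of uniformly bounded cochains is a vertical
coboundary. -/
theorem exists_bi_dv_eq {n q : ℕ} (a : BiCochain f A n (q + 1))
    (c : ∀ τ : (Δ[n] : SSet.{u}) ⟶ Y, Cochain (simplexCoeff f A τ) q) {C : ℝ}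
    (hC : ∀ τ, ‖c τ‖ ≤ C)
    (hc : ∀ τ, cobdry (simplexCoeff f A τ) q (c τ) = restrictTo f A τ (q + 1) a) :
    ∃ b, bi_dv f A n q b = a := by
  -- The sign compensates the one in d_v.
  refine ⟨(-1 : ℤ) ^ n • glue f A c hC, restrictTo_injective fun τ => ?_⟩
  rw [map_zsmul, map_zsmul, restrictTo_bi_dv, restrictTo_glue, hc, smul_smul, ← pow_add,
    Even.neg_one_pow ⟨n, rfl⟩, one_zsmul]

/-- Primitives exist over each τ separately, and they glue as soon as they can be chosen with a
common bound. Only this step uses the alternatives of the theorem. -/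
theorem exists_intoV_eq {n q : ℕ} (a : BiCochain f A n q)
    (ha : ∀ τ : (Δ[n] : SSet.{u}) ⟶ Y,
      restrictTo f A τ q a ∈ (cochainComplex (simplexCoeff f A τ)).cobound q)
    (hb : Finite (Y _⦋n⦌) ∨ q = 0 ∨ ∃ κ : ℝ, 0 ≤ κ ∧ ∀ τ : (Δ[n] : SSet.{u}) ⟶ Y,
      (cochainComplex (simplexCoeff f A τ)).UBCWith κ q) :
    ∃ x : (doubleComplex f A).Fam, (doubleComplex f A).intoV n q x = a := by
  rcases q with _ | q
  · refine ⟨0, Eq.symm ?_⟩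
    refine (restrictTo_injective (b := 0) fun τ => ?_)
    rw [map_zero]
    exact SnComplex.mem_cobound_zero.1 (ha τ)
  obtain ⟨c, C, hC, hc⟩ : ∃ (c : ∀ τ : (Δ[n] : SSet.{u}) ⟶ Y, Cochain (simplexCoeff f A τ) q)
      (C : ℝ), (∀ τ, ‖c τ‖ ≤ C) ∧
      ∀ τ, cobdry (simplexCoeff f A τ) q (c τ) = restrictTo f A τ (q + 1) a := by
    rcases hb with hb | hb | ⟨κ, hκ, hb⟩
    -- Finitely many primitives, chosen arbitrarily, have a common bound.
    · choose c hc using ha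
      have : Finite ((Δ[n] : SSet.{u}) ⟶ Y) := Finite.of_equiv _ yonedaEquiv.symm
      obtain ⟨C, hC⟩ := (Set.finite_range fun τ => ‖c τ‖).bddAbove
      exact ⟨c, C, fun τ => hC ⟨τ, rfl⟩, hc⟩
    · omega
    -- The boundary condition yields primitives bounded by κ ‖a‖, independently of τ.
    · choose c hc hn using fun τ => hb τ q rfl _ (ha τ)
      exact ⟨c, κ * ‖a‖, fun τ => (hn τ).trans
        (mul_le_mul_of_nonneg_left (norm_restrictTo_le f A τ a) hκ), hc⟩
  obtain ⟨b, hb⟩ := exists_bi_dv_eq a c hC hc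
  refine ⟨SnDoubleComplex.single (K := doubleComplex f A) n q b, ?_⟩
  refine Eq.trans ?_ hb
  exact congrArg (bi_dv f A n q) (SnDoubleComplex.single_same (K := doubleComplex f A) n q b)

theorem restrictTo_intoV_mem_cobound {n q : ℕ} (x : (doubleComplex f A).Fam)
    (τ : (Δ[n] : SSet.{u}) ⟶ Y) :
    restrictTo f A τ q ((doubleComplex f A).intoV n q x) ∈
      (cochainComplex (simplexCoeff f A τ)).cobound q := by
  rcases q with _ | q
  · exact (congrArg (· ∈ (cochainComplex (simplexCoeff f A τ)).cobound 0)
      (map_zero (restrictTo f A τ 0))).mpr (zero_mem _)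
  · refine ⟨(-1 : ℤ) ^ n • restrictTo f A τ q (x n q), ?_⟩
    exact (map_zsmul (cobdry (simplexCoeff f A τ) q) _ _).trans
      (restrictTo_bi_dv f A τ (x n q)).symm

/-- The identification of the second page with the bounded cohomology of the base. -/
theorem exists_page_two_equiv_base [HomotopicalAlgebra.Fibration f]
    (S : (doubleComplex f A).SpectralSeq) {q : ℕ} (𝓗 : FiberSystem f A q) (p : ℕ)
    (h : (∀ n ≤ p + 1, Finite (Y _⦋n⦌)) ∨ q = 0 ∨
      (Y.IsConnected ∧ ∃ y : Y _⦋0⦌, (cochainComplex (fiberCoeff f A y)).UBC q)) :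
    ∃ e : S.page 2 p q ≃ₗ[R] Hb 𝓗.sys p, ∀ ξ, ‖e ξ‖ = S.pageNorm 2 p q ξ := by
  refine S.exists_page_two_equiv (cochainComplex 𝓗.sys) p q (toBase 𝓗)
    (fun n a => norm_toBase_le 𝓗 a) (fun n a ⟨x, hx⟩ => ?_)
    (fun n a a' ha => cobdry_toBase 𝓗 a a' ha)
    (fun n ψ ε hε => exists_toBase_eq 𝓗 ψ hε) fun n a hn ha => ?_
  · refine (toBase_eq_zero_iff 𝓗 a).2 fun τ => ?_
    exact hx ▸ restrictTo_intoV_mem_cobound x τ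
  · refine exists_intoV_eq a.1 ((toBase_eq_zero_iff 𝓗 a).1 ha) ?_
    rcases h with h | h | ⟨hY, y, hy⟩
    -- Injectivity is needed only in columns p and p + 1, hence finiteness up to dimension p + 1
    -- suffices.
    · exact .inl (h n (by omega))
    · exact .inr (.inl h)
    · obtain ⟨κ, hκ, hb⟩ := exists_ubcWith_simplexFiber f A hy
      exact .inr (.inr ⟨κ, hκ, hb n⟩)

end SecondPage

end BddCoh

theorem theorem3p1 {R : Type w} [NormedRing R] {X Y : SSet.{u}} (f : X ⟶ Y)
    [HomotopicalAlgebra.Fibration f] (A : BddCoh.LocalCoeff.{u, v} R X) :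
    ∃ S : (BddCoh.doubleComplex f A).SpectralSeq,
      S.ConvergesTo (fun n => BddCoh.Hb A n) ∧
      ∀ q : ℕ, Nonempty (BddCoh.FiberSystem f A q) ∧
        ∀ (𝓗 : BddCoh.FiberSystem f A q) (p : ℕ),
          ((∀ n ≤ p + 1, Finite (Y _⦋n⦌)) ∨ q = 0 ∨
            (Y.IsConnected ∧
              ∃ y : Y _⦋0⦌, (BddCoh.cochainComplex (BddCoh.fiberCoeff f A y)).UBC q)) →
          ∃ e : S.page 2 p q ≃ₗ[R] BddCoh.Hb 𝓗.sys p, ∀ ξ, ‖e ξ‖ = S.pageNorm 2 p q ξ := by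
  obtain ⟨S⟩ : Nonempty (BddCoh.doubleComplex f A).SpectralSeq :=
    ⟨(BddCoh.doubleComplex f A).spectralSeq⟩
  exact ⟨S, BddCoh.spectralSeq_convergesTo f A S, fun q => ⟨⟨BddCoh.fiberSystem f A q⟩,
    fun 𝓗 p h => BddCoh.exists_page_two_equiv_base S 𝓗 p h⟩⟩
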